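/- A degree sequence of length $n$ is a sequence $D=(d_1,\dots,d_n)$ of integers with $1\le d_i\le n-1$ and $\sum_i d_i$ even. Let $\mathcal G(D)$ be the set of its realizations, i.e. of the simple graphs on $\{1,\dots,n\}$ in which vertex $i$ has degree $d_i$ for every $i$; $D$ is graphic if $\mathcal G(D)\neq\emptyset$. For positive integers $n>c_1\ge c_2$ and $\Sigma$, let $\mathbb D(n,\Sigma,c_1,c_2)$ be the set of all degree sequences of length $n$ with sum $\Sigma$ and $c_1\ge d_i\ge c_2$ for all $i$; it is fully graphic if all its members are graphic. For a graphic $D$ of length $n$ put $$\partial^{++}(D)=\sum_{1\le i\le j\le n}\frac{|\mathcal G(D+e_i+e_j)|}{|\mathcal G(D)|},$$ where $e_i$ is the $i$-th unit vector. A set of degree sequences is $p$-stable, for a polynomial $p$, if $\partial^{++}(D)\le p(n)$ for each of its graphic members $D$, where $n$ is the length of $D$; an infinite set of degree sequences is P-stable if it is $p$-stable for some polynomial $p$. The switch Markov chain on $\mathcal G(D)$ does nothing with probability $1/2$; otherwise it chooses uniformly four vertices and one of the three 4-cycles on them, and, if the edges of this cycle are alternately edges and non-edges of the current graph, it exchanges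 these edges and non-edges. (Thus a graph moves to each graph obtained by replacing two edges $v_1w_1,v_2w_2$ with two non-edges $v_1w_2,v_2w_1$ with probability $\frac{1}{6}\binom n4^{-1}$.) Its mixing time $\tau_D(\varepsilon)$ is the least $t$ such that after every number $s\ge t$ of steps, from every initial state, the total variation distance to the uniform distribution on $\mathcal G(D)$ is at most $\varepsilon$. **Corollary 1.4.** Let $$\mathbb D:=\bigcup\{\mathbb D(n,\Sigma,c_1,c_2): n>c_1\ge c_2\ge 1,\ \mathbb D(n,\Sigma,c_1,c_2)\text{ is fully graphic}\}.$$ Then $\mathbb D$ is $3n^{13}$-stable; in particular, $\mathbb D$ (which is infinite) is P-stable. Moreover, the switch Markov chain is rapidly mixing on $\mathbb D$: there is a polynomial $q$ in two variables such that $\tau_D(\varepsilon)\le q(n,\log(1/\varepsilon))$ for every $D\in\mathbb D$, where $n$ is the length of $D$, and every $0<\varepsilon<1$. -/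

import Mathlib

namespace FullyGraphic

open scoped Classical

noncomputable section

/-- Finite sequences of natural numbers, of arbitrary length `d.1`. -/
abbrev Seq : Type := Σ n : ℕ, (Fin n → ℕ)

/-- A degree sequence of length `n`: positive integers, none exceeding `n - 1`, with even sum. -/
def IsDegreeSequence (d : Seq) : Prop :=
  (∀ i, 0 < d.2 i ∧ d.2 i < d.1) ∧ Even (∑ i, d.2 i)

/-- The realizations of `d`: simple graphs on `n` labelled vertices in which vertex `i` has
degree `d i`. -/
abbrev Realization {n : ℕ} (d : Fin n → ℕ) : Type :=
  {G : SimpleGraph (Fin n) // ∀ i, G.degree i = d i}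

/-- A sequence is graphic if it has a realization. -/
def IsGraphic (d : Seq) : Prop := Nonempty (Realization d.2)

/-- The simple region `𝔻(n, S, a, b)`: degree sequences of length `n` with sum `S` and all entries
between `b` and `a`. -/
def simpleRegion (n S a b : ℕ) : Set Seq :=
  {d | IsDegreeSequence d ∧ d.1 = n ∧ (∀ i, b ≤ d.2 i ∧ d.2 i ≤ a) ∧ ∑ i, d.2 i = S}

/-- A region is fully graphic if each of its members is graphic. -/
def IsFullyGraphic (R : Set Seq) : Prop := ∀ d ∈ R, IsGraphic d

/-- The union of all fully graphic regions `𝔻(n, S, c₁, c₂)`, over all positive integers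
`n > c₁ ≥ c₂` and all `S`. -/
def maxFullyGraphicRegion : Set Seq :=
  ⋃₀ {R | ∃ n S c₁ c₂ : ℕ, 0 < c₂ ∧ c₂ ≤ c₁ ∧ c₁ < n ∧
    R = simpleRegion n S c₁ c₂ ∧ IsFullyGraphic R}

/-- The number of realizations of `d`. -/
def numRealizations {n : ℕ} (d : Fin n → ℕ) : ℕ := Fintype.card (Realization d)

/-- `∂⁺⁺(d)`: the sum over `i ≤ j` of the number of realizations of the sequence obtained from `d`
by adding one to the `i`-th and one to the `j`-th entry (two to the `i`-th entry if `i = j`),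
divided by the number of realizations of `d`. -/
def perturbationRatio (d : Seq) : ℝ :=
  ∑ i : Fin d.1, ∑ j ∈ Finset.Ici i,
    (numRealizations (d.2 + Pi.single i 1 + Pi.single j 1) : ℝ) / (numRealizations d.2 : ℝ)

/-- A region is `p`-stable if `∂⁺⁺(d) ≤ p(n)` for each graphic member `d`, of length `n`. -/
def IsStable (p : Polynomial ℝ) (R : Set Seq) : Prop :=
  ∀ d ∈ R, IsGraphic d → perturbationRatio d ≤ p.eval (d.1 : ℝ)

/-- An infinite region is P-stable if it is `p`-stable for some polynomial `p`. -/
def IsPStable (R : Set Seq) : Prop := R.Infinite ∧ ∃ p : Polynomial ℝ, IsStable p R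

/-- `H` arises from `G` by a switch: two edges `v₁w₁`, `v₂w₂` of `G` are replaced with the two
non-edges `v₁w₂`, `v₂w₁` of `G`. (The four vertices are then automatically distinct.) -/
def IsSwitch {n : ℕ} (G H : SimpleGraph (Fin n)) : Prop :=
  ∃ v₁ w₁ v₂ w₂ : Fin n, G.Adj v₁ w₁ ∧ G.Adj v₂ w₂ ∧
    v₁ ≠ w₂ ∧ v₂ ≠ w₁ ∧ ¬ G.Adj v₁ w₂ ∧ ¬ G.Adj v₂ w₁ ∧
    H.edgeSet = (G.edgeSet \ {s(v₁, w₁), s(v₂, w₂)}) ∪ {s(v₁, w₂), s(v₂, w₁)}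

/-- The probability that one step of the switch chain leads from `G` to a *different* graph `H`.
With probability `1/2` nothing is done; otherwise four vertices and one of the three 4-cycles on
them are chosen uniformly, and the corresponding switch is performed if it is possible. -/
def switchProb {n : ℕ} (G H : SimpleGraph (Fin n)) : ℝ :=
  if IsSwitch G H then 1 / (6 * (n.choose 4 : ℝ)) else 0

/-- The transition matrix of the (lazy) switch Markov chain on the realizations of `d`. -/
def switchMatrix {n : ℕ} (d : Fin n → ℕ) : Matrix (Realization d) (Realization d) ℝ :=
  fun G H =>
    if G = H then 1 - ∑ K ∈ Finset.univ.erase G, switchProb G.1 K.1 else switchProb G.1 H.1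

/-- Total variation distance between the uniform distribution on the realizations of `d` and the
distribution of the switch chain after `t` steps, started from `G`. -/
def distToUniform {n : ℕ} (d : Fin n → ℕ) (t : ℕ) (G : Realization d) : ℝ :=
  (1 / 2) * ∑ H, |(switchMatrix d ^ t) G H - 1 / (numRealizations d : ℝ)|

/-- The mixing time `τ(ε)` of the switch chain on the realizations of `d` is at most `t`: from time
`t` on, from each starting state, the distance to the uniform distribution is at most `ε`. -/
def MixesWithin {n : ℕ} (d : Fin n → ℕ) (ε : ℝ) (t : ℕ) : Prop :=
  ∀ s, t ≤ s → ∀ G : Realization d, distToUniform d s G ≤ ε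

/-- The switch chain is rapidly mixing on a region: its mixing time `τ(ε)` on the realizations of
each graphic member of length `n` is at most a fixed polynomial in `n` and `log (1/ε)`. -/
def IsRapidlyMixing (R : Set Seq) : Prop :=
  ∃ q : MvPolynomial (Fin 2) ℝ, ∀ d ∈ R, IsGraphic d → ∀ ε : ℝ, 0 < ε → ε < 1 →
    ∃ t : ℕ, (t : ℝ) ≤ MvPolynomial.eval ![(d.1 : ℝ), Real.log (1 / ε)] q ∧ MixesWithin d.2 ε t

end

end FullyGraphic

/-! Stability. In a fully graphic region the most unbalanced member (`m` entries `c₁`, one entry in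
between, then only `c₂`) is graphic. Counting pairs between two vertex sets of a realization gives
inequalities of Erdős–Gallai type. Every member inherits them, because its entries on a set sum to
at most the largest, and at least the smallest, entries of the extremal sequence
(`exists_cornerBound`). Nothing else about the region is used.

Let `G` have degrees `d + e_u + e_v`. To return to `d`, edges and non-edges have to be exchanged
along an alternating walk from `v` to `u` that begins and ends with an edge. Suppose that short
alternating walks from a vertex with surplus reach no vertex with both parities, and do not reach
the other perturbed vertex in a useful way. Then the vertices reached at odd and at even times form
disjoint sets, and the pairs between them violate `CornerBound`, by the surplus at the start
(`exists_reach_both`). So either a short walk joins `u` and `v`, or `u` has an odd closed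
alternating walk of length at most `9`, consisting of a stem and an odd cycle. With the stem
exchanged, a second application from `v` yields a walk to the cycle, and one of the two directions
round the cycle has the right parity. In total `11` steps suffice (`exists_trail`). The result and
the `12` vertices of the walk determine `G`, `u` and `v`, whence `∂⁺⁺ ≤ n ^ 12 ≤ 3 * n ^ 13`.

Mixing. Realizations of `d` are the perfect matchings of a gadget, up to a constant multiplicity.
Following Jerrum and Sinclair, two perfect matchings are joined by exchanging their alternating
cycles one by one, passing through near-perfect matchings. An intermediate matching, the
complementary one and three elements encode the pair, so variance is bounded by local differences
(`sum_perfect_sq_le_localSum`). The graph of a near-perfect matching misses `d` by one unit in at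
most two places, so `exists_trail` puts a perfect matching within bounded distance
(`exists_near_perfect`). Hence near-perfect matchings are not too many, and local moves become
changes of boundedly many pairs of a graph. These decompose into switches, since two graphs with
equal degrees can always be brought closer by a switch in one of them (`exists_switch_closer`). The
outcome is a Poincaré inequality for switches (`sum_sq_le_pairSum_switchRel`). As the chain is lazy,
it contracts the squared norm of mean-zero functions by `1 - 1/poly(n)` (`sum_sq_chainStep_le_mul`),
and the number of realizations is at most `exp (n ^ 2)`. -/

namespace FullyGraphic
open scoped Classical
noncomputable section

/-- The `0/1` entry of the adjacency matrix. -/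
def ind {V : Type*} (G : SimpleGraph V) (x y : V) : ℤ := if G.Adj x y then 1 else 0

/-- The degree, as an integer. -/
def dg {V : Type*} [Fintype V] (G : SimpleGraph V) (x : V) : ℤ := ∑ y, ind G x y

/-! ### Counting pairs, and the inequalities of a fully graphic region -/

section counting

variable {V : Type*} (G : SimpleGraph V)

lemma ind_nonneg (x y : V) : 0 ≤ ind G x y := by unfold ind; split_ifs <;> simp

lemma ind_le_one (x y : V) : ind G x y ≤ 1 := by unfold ind; split_ifs <;> simp

lemma ind_comm (x y : V) : ind G x y = ind G y x := by unfold ind; rw [G.adj_comm]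

lemma ind_self (x : V) : ind G x x = 0 := by simp [ind]

/-- Non-edges are counted from `A` and edges from `B`. A diagonal pair counts as a non-edge, so
disjointness is not needed. -/
lemma card_mul_card_eq (A B : Finset V) :
    (A.card : ℤ) * B.card
      = ∑ x ∈ A, ∑ y ∈ B, (1 - ind G x y) + ∑ y ∈ B, ∑ x ∈ A, ind G y x := by
  rw [Finset.sum_comm (s := B), ← Finset.sum_add_distrib]
  simp_rw [← Finset.sum_add_distrib, ind_comm G _ _]
  have : ∀ x ∈ A, ∑ y ∈ B, (1 - ind G x y + ind G y x) = (B.card : ℤ) := by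
    intro x _
    simp [ind_comm G x]
  simp_rw [ind_comm G] at this ⊢
  simp

variable [Fintype V]

lemma dg_eq_degree (x : V) [Fintype (G.neighborSet x)] : dg G x = (G.degree x : ℤ) := by
  unfold dg ind
  rw [← SimpleGraph.card_neighborFinset_eq_degree, Finset.sum_boole]
  congr 2
  ext y
  simp

lemma sum_ind_le_dg (A : Finset V) (x : V) : ∑ y ∈ A, ind G x y ≤ dg G x :=
  Finset.sum_le_sum_of_subset_of_nonneg (Finset.subset_univ _) fun _ _ _ => ind_nonneg G _ _

lemma sum_ind_eq_dg {A : Finset V} {x : V} (h : ∀ y, G.Adj x y → y ∈ A) :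
    ∑ y ∈ A, ind G x y = dg G x := by
  apply Finset.sum_subset (Finset.subset_univ _)
  intro y _ hy
  simp only [ind, ite_eq_right_iff, one_ne_zero, imp_false]
  exact fun hxy => hy (h y hxy)

lemma sum_erase_one_sub_ind (x : V) :
    ∑ y ∈ Finset.univ.erase x, (1 - ind G x y) = Fintype.card V - 1 - dg G x := by
  have h := Finset.add_sum_erase Finset.univ (fun y => (1 : ℤ) - ind G x y) (Finset.mem_univ x)
  have h2 : ∑ y, ((1 : ℤ) - ind G x y) = Fintype.card V - dg G x := by
    simp [dg, Finset.sum_sub_distrib]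
  rw [h2, ind_self] at h
  linarith

lemma sum_one_sub_ind_eq {B : Finset V} {x : V} (hx : x ∉ B)
    (h : ∀ y, y ≠ x → ¬ G.Adj x y → y ∈ B) :
    ∑ y ∈ B, (1 - ind G x y) = Fintype.card V - 1 - dg G x := by
  rw [← sum_erase_one_sub_ind]
  apply Finset.sum_subset
  · intro y hy
    simp only [Finset.mem_erase, Finset.mem_univ, and_true]
    rintro rfl
    exact hx hy
  · intro y hy hyB
    have : G.Adj x y := by
      by_contra hadj
      exact hyB (h y (Finset.ne_of_mem_erase hy) hadj)
    simp [ind, this]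

/-- A vertex of `A` has at most `n - 1 - |B|` neighbours outside `B`, and the edges from `A` to `B`
are paid for by the degrees in `B`. -/
lemma sum_dg_le (A B : Finset V) (h : Disjoint A B) :
    ∑ x ∈ A, dg G x ≤ ∑ y ∈ B, dg G y + A.card * (Fintype.card V - 1 - B.card) := by
  have h1 := card_mul_card_eq G A B
  have h2 : ∑ y ∈ B, ∑ x ∈ A, ind G y x ≤ ∑ y ∈ B, dg G y :=
    Finset.sum_le_sum fun y _ => sum_ind_le_dg G A y
  have h3 : ∑ x ∈ A, ∑ y ∈ B, (1 - ind G x y) ≤ ∑ x ∈ A, ((Fintype.card V : ℤ) - 1 - dg G x) := by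
    refine Finset.sum_le_sum fun x hx => ?_
    rw [← sum_erase_one_sub_ind]
    refine Finset.sum_le_sum_of_subset_of_nonneg ?_ fun y _ _ => ?_
    · intro y hy
      simp only [Finset.mem_erase, Finset.mem_univ, and_true]
      rintro rfl
      exact Finset.disjoint_left.1 h hx hy
    · linarith [ind_le_one G x y]
  rw [Finset.sum_sub_distrib] at h3
  simp only [Finset.sum_const, nsmul_eq_mul] at h3
  nlinarith

end counting

/-- The inequalities that a degree sequence `d` inherits from the graphic extremal sequence with
entries `c₁` (`m` times), `c₂` (`n - 1 - m` times) and one entry in between. -/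
structure CornerBound {n : ℕ} (d : Fin n → ℕ) (c₁ c₂ m : ℕ) : Prop where
  pos : 0 < c₂
  lt : c₁ < n
  lower : ∀ i, c₂ ≤ d i
  upper : ∀ i, d i ≤ c₁
  left : ∀ (A : Finset (Fin n)) (t : ℕ), t + m + 1 ≤ n → A.card + t ≤ n →
    (A.card : ℤ) * t ≤ ∑ x ∈ A, ((n : ℤ) - 1 - d x) + t * c₂
  right : ∀ (B : Finset (Fin n)) (s : ℕ), s ≤ m → s + B.card ≤ n →
    (s : ℤ) * B.card ≤ s * ((n : ℤ) - 1 - c₁) + ∑ x ∈ B, (d x : ℤ)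

/-- Of `n + 1` entries, the induction sets one to `c₂` as long as the others can absorb the
remaining sum; once they cannot, they all equal `c₁`. -/
lemma exists_extremal_parameters (c₁ c₂ : ℕ) (n S : ℕ) (h1 : (n + 1) * c₂ ≤ S)
    (h2 : S ≤ (n + 1) * c₁) :
    ∃ m a, m ≤ n ∧ c₂ ≤ a ∧ a ≤ c₁ ∧ S = m * c₁ + a + (n - m) * c₂ := by
  induction n generalizing S with
  | zero => exact ⟨0, S, le_rfl, by simpa using h1, by simpa using h2, by simp⟩
  | succ n ih =>
    by_cases h : S ≤ (n + 1) * c₁ + c₂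
    · obtain ⟨m, a, hm, ha, ha', hS⟩ := ih (S - c₂)
        (by rw [add_mul (n + 1)] at h1; omega) (by omega)
      refine ⟨m, a, by omega, ha, ha', ?_⟩
      have : n + 1 - m = (n - m) + 1 := by omega
      rw [this, add_mul]
      have : c₂ ≤ S := by rw [add_mul (n + 1)] at h1; omega
      omega
    · refine ⟨n + 1, S - (n + 1) * c₁, le_rfl, by omega, ?_, by simp; omega⟩
      rw [add_mul (n + 1)] at h2
      omega

/-- The extremal sequence. -/
def extremal (c₁ c₂ m a i : ℕ) : ℕ := if i < m then c₁ else if i = m then a else c₂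

lemma sum_extremal_of_le {c₁ c₂ m a s : ℕ} (h : s ≤ m) :
    ∑ i ∈ Finset.range s, extremal c₁ c₂ m a i = s * c₁ := by
  rw [Finset.sum_congr rfl (g := fun _ => c₁)]
  · simp
  · intro i hi
    have := Finset.mem_range.1 hi
    simp [extremal, show i < m by omega]

lemma sum_extremal_of_lt {c₁ c₂ m a s : ℕ} (h : m < s) :
    ∑ i ∈ Finset.range s, extremal c₁ c₂ m a i = m * c₁ + a + (s - 1 - m) * c₂ := by
  induction s, h using Nat.le_induction with
  | base => rw [Finset.sum_range_succ, sum_extremal_of_le le_rfl]; simp [extremal]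
  | succ s hs ih =>
    rw [Finset.sum_range_succ, ih]
    have h1 : ¬ s < m := by omega
    have h2 : ¬ s = m := by omega
    have h3 : s + 1 - 1 - m = s - 1 - m + 1 := by omega
    simp only [extremal, h1, h2, if_false]
    rw [h3]
    ring

lemma sum_fin_lt (n s : ℕ) (hs : s ≤ n) (f : ℕ → ℕ) :
    ∑ i ∈ Finset.univ.filter (fun i : Fin n => (i : ℕ) < s), f i
      = ∑ i ∈ Finset.range s, f i := by
  refine Finset.sum_bij (fun i _ => (i : ℕ)) ?_ ?_ ?_ ?_
  · intro i hi; simpa using hi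
  · intro i _ j _ h; exact Fin.ext h
  · intro b hb
    have := Finset.mem_range.1 hb
    exact ⟨⟨b, by omega⟩, by simpa using hb, rfl⟩
  · intros; rfl

/-- The extremal sequence lies in the region, so it has a realization, to which `sum_dg_le` applies.
Among sequences with the same sum and bounds it has the largest sums of its first and the smallest
sums of its last entries, which transfers the inequalities to `d`. -/
lemma exists_cornerBound {n S c₁ c₂ : ℕ} (h0 : 0 < c₂) (h1 : c₂ ≤ c₁) (h2 : c₁ < n)
    (hfull : IsFullyGraphic (simpleRegion n S c₁ c₂)) (d : Fin n → ℕ)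
    (hd : (⟨n, d⟩ : Seq) ∈ simpleRegion n S c₁ c₂) : ∃ m, CornerBound d c₁ c₂ m := by
  obtain ⟨⟨hpos, heven⟩, -, hb, hS⟩ := hd
  simp only at hpos heven hb hS
  have hlo : n * c₂ ≤ S := by
    rw [← hS]
    simpa using Finset.card_nsmul_le_sum Finset.univ d c₂ fun i _ => (hb i).1
  have hhi : S ≤ n * c₁ := by
    rw [← hS]
    simpa using Finset.sum_le_card_nsmul Finset.univ d c₁ fun i _ => (hb i).2
  obtain ⟨N, rfl⟩ : ∃ N, n = N + 1 := ⟨n - 1, by omega⟩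
  obtain ⟨m, a, hm, ha, ha', hSm⟩ := exists_extremal_parameters c₁ c₂ N S hlo hhi
  set D : ℕ → ℕ := extremal c₁ c₂ m a with hD
  have hDb : ∀ i, c₂ ≤ D i ∧ D i ≤ c₁ := by
    intro i
    simp only [hD, extremal]
    split_ifs <;> omega
  have hDS : ∑ i ∈ Finset.range (N + 1), D i = S := by
    rw [hD, sum_extremal_of_lt (by omega), hSm]
    simp
  have hDS' : ∑ i : Fin (N + 1), D i = S := by rw [Fin.sum_univ_eq_sum_range D, hDS]
  obtain ⟨G, hG⟩ : Nonempty (Realization (fun i : Fin (N + 1) => D i)) := by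
    apply hfull ⟨N + 1, fun i => D i⟩
    refine ⟨⟨fun i => ⟨by have := hDb i; simp only; omega, by have := hDb i; simp only; omega⟩, ?_⟩,
      rfl, fun i => hDb i, hDS'⟩
    simp only
    rw [hDS', ← hS]
    exact heven
  have hdg : ∀ i, dg G i = (D i : ℤ) := fun i => by rw [dg_eq_degree, hG]
  -- `sum_dg_le` for the first `s` and the last `t` vertices, written with initial sums only.
  have key : ∀ s t, s + t ≤ N + 1 → (∑ i ∈ Finset.range s, D i : ℕ) + (∑ i ∈ Finset.range (N + 1 - t), D i : ℕ)
      ≤ (S : ℤ) + s * ((N : ℤ) - t) := by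
    intro s t hst
    have hk := sum_dg_le G (Finset.univ.filter (fun i : Fin (N + 1) => (i : ℕ) < s))
      (Finset.univ.filter (fun i : Fin (N + 1) => ¬ (i : ℕ) < N + 1 - t)) (by
        rw [Finset.disjoint_filter]
        intro i _ hi
        omega)
    have hc1 : ∀ s, s ≤ N + 1 → (Finset.univ.filter (fun i : Fin (N + 1) => (i : ℕ) < s)).card = s := by
      intro s hs
      have := sum_fin_lt (N + 1) s hs (fun _ => 1)
      simpa using this
    have hc2 : (Finset.univ.filter (fun i : Fin (N + 1) => ¬ (i : ℕ) < N + 1 - t)).card = t := by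
      have := Finset.card_filter_add_card_filter_not (s := (Finset.univ : Finset (Fin (N + 1)))) (fun i => (i : ℕ) < N + 1 - t)
      rw [hc1 _ (by omega)] at this
      simp at this
      simp
      omega
    have hs2 := Finset.sum_filter_add_sum_filter_not (Finset.univ : Finset (Fin (N + 1))) (fun i => (i : ℕ) < N + 1 - t)
      (fun i => D i)
    rw [sum_fin_lt (N + 1) _ (by omega) D, hDS'] at hs2
    simp_rw [hdg] at hk
    rw [hc1 s (by omega), hc2, Fintype.card_fin] at hk
    have hs1 := sum_fin_lt (N + 1) s (by omega) D
    replace hs1 := congrArg (Nat.cast : ℕ → ℤ) hs1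
    replace hs2 := congrArg (Nat.cast : ℕ → ℤ) hs2
    simp only [Nat.cast_sum, Nat.cast_add] at hs1 hs2 hk ⊢
    rw [hs1] at hk
    push_cast at hk
    linarith
  have hsum : ∀ A : Finset (Fin (N + 1)), (∑ x ∈ A, (d x : ℤ)) + ∑ x ∈ Aᶜ, (d x : ℤ) = S := by
    intro A
    rw [Finset.sum_add_sum_compl, ← hS]
    push_cast
    rfl
  have hcompl : ∀ A : Finset (Fin (N + 1)), (Aᶜ.card : ℤ) = N + 1 - A.card := by
    intro A
    have := Finset.card_add_card_compl A
    rw [Fintype.card_fin] at this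
    omega
  refine ⟨m, h0, h2, fun i => (hb i).1, fun i => (hb i).2, ?_, ?_⟩
  · intro A t ht hAt
    have hk := key A.card t hAt
    have hbot : ∑ i ∈ Finset.range (N + 1 - t), D i = m * c₁ + a + (N - t - m) * c₂ := by
      rw [hD, sum_extremal_of_lt (by omega)]
      congr 2
      omega
    -- The entries on `A` are at most `c₁` each, and those off `A` at least `c₂` each. The extremal
    -- initial sum attains the first bound up to `m` entries and the second beyond.
    have htop : ∑ x ∈ A, (d x : ℤ) ≤ (∑ i ∈ Finset.range A.card, D i : ℕ) := by
      rcases le_or_gt A.card m with h | h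
      · rw [hD, sum_extremal_of_le h]
        have := Finset.sum_le_card_nsmul A d c₁ fun i _ => (hb i).2
        exact_mod_cast this
      · rw [hD, sum_extremal_of_lt h]
        have h3 := hsum A
        have h4 := Finset.card_nsmul_le_sum Aᶜ (fun i => (d i : ℤ)) c₂ fun i _ => by
          exact_mod_cast (hb i).1
        rw [nsmul_eq_mul, hcompl] at h4
        have h5 : A.card ≤ N + 1 := by omega
        rw [hSm] at h3
        push_cast [Nat.cast_sub hm, Nat.cast_sub (show m ≤ A.card - 1 by omega), Nat.cast_sub (show 1 ≤ A.card by omega)] at h3 ⊢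
        linarith
    rw [hbot, hSm] at hk
    rw [Finset.sum_sub_distrib]
    simp only [Finset.sum_const, nsmul_eq_mul]
    push_cast [Nat.cast_sub hm, Nat.cast_sub (show m ≤ N - t by omega), Nat.cast_sub (show t ≤ N by omega)] at hk htop ⊢
    linarith
  · intro B s hs hB
    have hk := key s B.card hB
    rw [hD, sum_extremal_of_le hs, ← hD] at hk
    have hbot : (S : ℤ) ≤ (∑ i ∈ Finset.range (N + 1 - B.card), D i : ℕ) + ∑ x ∈ B, (d x : ℤ) := by
      rcases le_or_gt (N + 1 - B.card) m with h | h
      · rw [hD, sum_extremal_of_le h]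
        have h3 := hsum B
        have h4 := Finset.sum_le_card_nsmul Bᶜ (fun i => (d i : ℤ)) c₁ fun i _ => by
          exact_mod_cast (hb i).2
        rw [nsmul_eq_mul, hcompl] at h4
        push_cast [Nat.cast_sub (show B.card ≤ N + 1 by omega)]
        linarith
      · rw [hD, sum_extremal_of_lt h]
        have h4 := Finset.card_nsmul_le_sum B (fun i => (d i : ℤ)) c₂ fun i _ => by
          exact_mod_cast (hb i).1
        rw [nsmul_eq_mul] at h4
        rw [hSm]
        push_cast [Nat.cast_sub hm, Nat.cast_sub (show m ≤ N + 1 - B.card - 1 by omega), Nat.cast_sub (show 1 ≤ N + 1 - B.card by omega), Nat.cast_sub (show B.card ≤ N + 1 by omega)]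
        linarith
    push_cast at hk hbot ⊢
    linarith

end
end FullyGraphic

namespace FullyGraphic
open scoped Classical
noncomputable section

/-! ### Alternating walks and vertices reached with both parities -/

section walks

variable {V : Type*} {G : SimpleGraph V}

/-- The pair `xy` may be the step number `k` of an alternating walk: an edge if `k` is even, a
non-edge if `k` is odd. -/
def Alt (G : SimpleGraph V) (k : ℕ) (x y : V) : Prop := x ≠ y ∧ (G.Adj x y ↔ Even k)

/-- `w 0, …, w L` is an alternating walk whose first step has the parity of `o`. -/
def AltWalk (G : SimpleGraph V) (o : ℕ) (w : ℕ → V) (L : ℕ) : Prop :=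
  ∀ t < L, Alt G (o + t) (w t) (w (t + 1))

/-- There is an alternating walk of length `k` from `v` to `x`, starting with an edge, that
avoids `X` except possibly at `x`. -/
def Reach (G : SimpleGraph V) (X : Set V) (v : V) (k : ℕ) (x : V) : Prop :=
  ∃ w : ℕ → V, w 0 = v ∧ w k = x ∧ AltWalk G 0 w k ∧ ∀ t < k, w t ∉ X

lemma Alt.symm {k : ℕ} {x y : V} (h : Alt G k x y) : Alt G k y x :=
  ⟨h.1.symm, by rw [G.adj_comm]; exact h.2⟩

lemma Alt.of_even_iff {k l : ℕ} {x y : V} (h : Alt G k x y) (hkl : Even k ↔ Even l) :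
    Alt G l x y := ⟨h.1, h.2.trans hkl⟩

lemma alt_of_adj {k : ℕ} {x y : V} (h : G.Adj x y) (hk : Even k) : Alt G k x y :=
  ⟨h.ne, by simp [h, hk]⟩

lemma alt_of_not_adj {k : ℕ} {x y : V} (hxy : x ≠ y) (h : ¬ G.Adj x y) (hk : ¬ Even k) :
    Alt G k x y := ⟨hxy, by simp [h, hk]⟩

/-- This is the use of a vertex reached with both parities: one of the two walks can be prolonged to
any prescribed vertex. -/
lemma alt_or_alt {a b : ℕ} {x y : V} (hxy : x ≠ y) (hab : ¬ (Even a ↔ Even b)) :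
    Alt G a x y ∨ Alt G b x y := by
  unfold Alt
  tauto

lemma reach_zero (X : Set V) (v : V) : Reach G X v 0 v :=
  ⟨fun _ => v, rfl, rfl, fun t ht => by omega, fun t ht => by omega⟩

lemma reach_zero_iff {X : Set V} {v x : V} : Reach G X v 0 x ↔ x = v := by
  constructor
  · rintro ⟨w, h0, h1, -⟩
    rw [← h1, h0]
  · rintro rfl
    exact reach_zero X x

lemma Reach.succ {X : Set V} {v x y : V} {k : ℕ} (h : Reach G X v k x) (hx : x ∉ X)
    (hxy : Alt G k x y) : Reach G X v (k + 1) y := by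
  obtain ⟨w, h0, hk, hw, hX⟩ := h
  refine ⟨fun t => if t ≤ k then w t else y, by simp [h0], by simp, ?_, ?_⟩
  · intro t ht
    rcases Nat.lt_succ_iff_lt_or_eq.1 ht with h | rfl
    · simpa [h.le, Nat.succ_le_of_lt h] using hw t h
    · simpa [hk] using hxy
  · intro t ht
    rcases Nat.lt_succ_iff_lt_or_eq.1 ht with h | rfl
    · simpa [h.le] using hX t h
    · simpa [hk] using hx

lemma Reach.exists_pred {X : Set V} {v y : V} {k : ℕ} (h : Reach G X v (k + 1) y) :
    ∃ x, Reach G X v k x ∧ x ∉ X ∧ Alt G k x y := by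
  obtain ⟨w, h0, hk, hw, hX⟩ := h
  refine ⟨w k, ⟨w, h0, rfl, fun t ht => hw t (by omega), fun t ht => hX t (by omega)⟩,
    hX k (by omega), ?_⟩
  simpa [hk] using hw k (by omega)

/-- Two alternating walks to the same vertex whose lengths have different parities close up. -/
lemma Reach.close {v x : V} {a b : ℕ} (ha : Reach G ∅ v a x) (hb : Reach G ∅ v b x)
    (hab : Odd (a + b)) : Reach G ∅ v (a + b) v := by
  induction b generalizing a x with
  | zero =>
    rw [reach_zero_iff] at hb
    subst hb
    exact ha
  | succ b ih =>
    obtain ⟨y, hy, -, hyx⟩ := hb.exists_pred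
    have h1 : Reach G ∅ v (a + 1) y := by
      refine ha.succ (by simp) (hyx.symm.of_even_iff ?_)
      rw [← add_assoc, Nat.odd_add_one, Nat.not_odd_iff_even, Nat.even_add] at hab
      exact hab.symm
    have := ih h1 hy (by convert hab using 1; ring)
    convert this using 1
    ring

/-- Either an alternating walk meets `X` before its last vertex, or it avoids `X`. -/
lemma Reach.hit_or_avoid (X : Set V) {v x : V} {k : ℕ} (h : Reach G ∅ v k x) :
    (∃ t < k, ∃ c ∈ X, Reach G X v t c) ∨ Reach G X v k x := by
  induction k generalizing x with
  | zero =>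
    right
    rw [reach_zero_iff] at h ⊢
    exact h
  | succ k ih =>
    obtain ⟨y, hy, -, hyx⟩ := h.exists_pred
    rcases ih hy with ⟨t, ht, c, hc, htc⟩ | h'
    · exact Or.inl ⟨t, by omega, c, hc, htc⟩
    · by_cases hyX : y ∈ X
      · exact Or.inl ⟨k, by omega, y, hyX, h'⟩
      · exact Or.inr (h'.succ hyX hyx)

end walks

/-- In a graph whose degrees are `d + e_v + ε e_z`, short alternating walks from `v` either reach
`z` with the parity given by `ε`, or reach some vertex with both parities. -/
lemma exists_reach_both {n : ℕ} {d : Fin n → ℕ} {c₁ c₂ m : ℕ} (hd : CornerBound d c₁ c₂ m)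
    (G : SimpleGraph (Fin n)) (v z : Fin n) (ε : ℤ) (hε : ε = 1 ∨ ε = -1)
    (hG : ∀ x, dg G x = d x + (if x = v then 1 else 0) + ε * (if x = z then 1 else 0)) :
    (∃ x a b, (a = 1 ∨ a = 3 ∨ a = 5) ∧ (b = 0 ∨ b = 2 ∨ b = 4) ∧ Reach G ∅ v a x ∧
      Reach G ∅ v b x) ∨
    (ε = 1 ∧ (Reach G ∅ v 1 z ∨ Reach G ∅ v 3 z)) ∨
    (ε = -1 ∧ (Reach G ∅ v 0 z ∨ Reach G ∅ v 2 z ∨ Reach G ∅ v 4 z)) := by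
  by_contra hcon
  push Not at hcon
  obtain ⟨hC, hz1, hz2⟩ := hcon
  let R : ℕ → Fin n → Prop := fun k x => Reach G ∅ v k x
  -- `S1`, `S2`, `S3` collect the vertices reached at odd times, `T1`, `T2` those reached at even
  -- times. By assumption `S3` and `T2` are disjoint.
  let S1 := Finset.univ.filter fun x => R 1 x
  let S2 := Finset.univ.filter fun x => R 1 x ∨ R 3 x
  let S3 := Finset.univ.filter fun x => R 1 x ∨ R 3 x ∨ R 5 x
  let T1 := Finset.univ.filter fun x => R 0 x ∨ R 2 x
  let T2 := Finset.univ.filter fun x => R 0 x ∨ R 2 x ∨ R 4 x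
  have hdisj : ∀ x, x ∈ S3 → x ∈ T2 → False := by
    intro x hx hy
    simp only [S3, T2, Finset.mem_filter, Finset.mem_univ, true_and] at hx hy
    rcases hx with h | h | h <;> rcases hy with h' | h' | h' <;>
      exact hC x _ _ (by norm_num) (by norm_num) h h'
  have S12 : S1 ⊆ S2 := by
    intro x hx
    simp only [S1, S2, Finset.mem_filter, Finset.mem_univ, true_and] at hx ⊢
    tauto
  have S23 : S2 ⊆ S3 := by
    intro x hx
    simp only [S3, S2, Finset.mem_filter, Finset.mem_univ, true_and] at hx ⊢
    tauto
  have T12 : T1 ⊆ T2 := by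
    intro x hx
    simp only [T1, T2, Finset.mem_filter, Finset.mem_univ, true_and] at hx ⊢
    tauto
  have even_step : ∀ k x y, Even k → R k x → G.Adj x y → R (k + 1) y := fun k x y hk hx hxy =>
    hx.succ (by simp) (alt_of_adj hxy hk)
  have odd_step : ∀ k x y, ¬ Even k → R k x → y ≠ x → ¬ G.Adj x y → R (k + 1) y :=
    fun k x y hk hx hne hxy => hx.succ (by simp) (alt_of_not_adj hne.symm hxy hk)
  have vT1 : v ∈ T1 := by
    simp only [T1, Finset.mem_filter, Finset.mem_univ, true_and]
    exact Or.inl (reach_zero _ _)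
  have NT1 : ∀ y ∈ T1, ∀ x, G.Adj y x → x ∈ S2 := by
    intro y hy x hyx
    simp only [T1, S2, Finset.mem_filter, Finset.mem_univ, true_and] at hy ⊢
    rcases hy with h | h
    · exact Or.inl (even_step 0 _ _ (by decide) h hyx)
    · exact Or.inr (even_step 2 _ _ (by decide) h hyx)
  have NT2 : ∀ y ∈ T2, ∀ x, G.Adj y x → x ∈ S3 := by
    intro y hy x hyx
    simp only [T2, S3, Finset.mem_filter, Finset.mem_univ, true_and] at hy ⊢
    rcases hy with h | h | h
    · exact Or.inl (even_step 0 _ _ (by decide) h hyx)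
    · exact Or.inr (Or.inl (even_step 2 _ _ (by decide) h hyx))
    · exact Or.inr (Or.inr (even_step 4 _ _ (by decide) h hyx))
  have NS1 : ∀ x ∈ S1, ∀ y, y ≠ x → ¬ G.Adj x y → y ∈ T1 := by
    intro x hx y hne hxy
    simp only [T1, S1, Finset.mem_filter, Finset.mem_univ, true_and] at hx ⊢
    exact Or.inr (odd_step 1 _ _ (by decide) hx hne hxy)
  have NS2 : ∀ x ∈ S2, ∀ y, y ≠ x → ¬ G.Adj x y → y ∈ T2 := by
    intro x hx y hne hxy
    simp only [T2, S2, Finset.mem_filter, Finset.mem_univ, true_and] at hx ⊢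
    rcases hx with h | h
    · exact Or.inr (Or.inl (odd_step 1 _ _ (by decide) h hne hxy))
    · exact Or.inr (Or.inr (odd_step 3 _ _ (by decide) h hne hxy))
  -- The perturbation at `z` lowers no degree in `T2` and raises none in `S2`, as `z` is not reached
  -- with the parity given by `ε`; the surplus at `v` counts for `T2`.
  have dgT : ∀ y ∈ T2, (d y : ℤ) + (if y = v then 1 else 0) ≤ dg G y := by
    intro y hy
    rw [hG y]
    rcases hε with rfl | rfl
    · split_ifs <;> simp
    · have : y ≠ z := by
        rintro rfl
        simp only [T2, Finset.mem_filter, Finset.mem_univ, true_and] at hy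
        have := hz2 rfl
        tauto
      simp [this]
  have dgS : ∀ x ∈ S2, dg G x ≤ d x := by
    intro x hx
    have hxv : x ≠ v := by
      rintro rfl
      exact hdisj _ (S23 hx) (T12 vT1)
    rw [hG x]
    rcases hε with rfl | rfl
    · have : x ≠ z := by
        rintro rfl
        simp only [S2, Finset.mem_filter, Finset.mem_univ, true_and] at hx
        have := hz1 rfl
        tauto
      simp [this, hxv]
    · simp only [hxv, if_false]
      split_ifs <;> simp
  have dgv : (c₂ : ℤ) + 1 ≤ dg G v := by
    have := dgT v (T12 vT1)
    have h2 := hd.lower v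
    simp only [if_true] at this
    have h3 : (c₂ : ℤ) ≤ d v := by exact_mod_cast h2
    linarith
  have cardS1 : (S1.card : ℤ) = dg G v := by
    have h1 : ∀ y, G.Adj v y → y ∈ S1 := by
      intro y hy
      simp only [S1, Finset.mem_filter, Finset.mem_univ, true_and]
      exact even_step 0 _ _ (by decide) (reach_zero _ _) hy
    rw [← sum_ind_eq_dg G h1]
    have h2 : ∀ y ∈ S1, ind G v y = 1 := by
      intro y hy
      simp only [S1, Finset.mem_filter, Finset.mem_univ, true_and] at hy
      obtain ⟨x, hx, -, hxy⟩ := Reach.exists_pred hy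
      rw [reach_zero_iff] at hx
      subst hx
      have : G.Adj x y := hxy.2.2 (by decide)
      simp [ind, this]
    rw [Finset.sum_congr rfl h2]
    simp
  have hcardle : S3.card + T2.card ≤ n := by
    rw [← Finset.card_union_of_disjoint (Finset.disjoint_left.2 fun x hx hy => hdisj x hx hy)]
    simpa using Finset.card_le_univ (S3 ∪ T2)
  have hS23 : S2.card ≤ S3.card := Finset.card_le_card S23
  -- In the second case `|S3| ≤ m`, because `S3` and `T2` are disjoint, so one of the two
  -- inequalities is always available.
  by_cases ht : T2.card + m + 1 ≤ n
  -- All non-neighbours of `S2` lie in `T2`. Vertices of `T1` have all neighbours in `S2`; those of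
  -- `T2 \ T1` are joined to all of `S1`, which has more than `c₂` elements. The extra unit at `v`
  -- contradicts `left`.
  · have hI := hd.left S2 T2.card ht (by omega)
    have hcount := card_mul_card_eq G S2 T2
    have h1 : ∑ x ∈ S2, ((n : ℤ) - 1 - d x) ≤ ∑ x ∈ S2, ∑ y ∈ T2, (1 - ind G x y) := by
      refine Finset.sum_le_sum fun x hx => ?_
      rw [sum_one_sub_ind_eq G (fun h => hdisj x (S23 hx) h) (NS2 x hx), Fintype.card_fin]
      linarith [dgS x hx]
    have h2 : ∑ y ∈ T2, ((c₂ : ℤ) + if y = v then 1 else 0) ≤ ∑ y ∈ T2, ∑ x ∈ S2, ind G y x := by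
      refine Finset.sum_le_sum fun y hy => ?_
      by_cases hy1 : y ∈ T1
      · rw [sum_ind_eq_dg G (NT1 y hy1)]
        have h2 : (c₂ : ℤ) ≤ d y := by exact_mod_cast hd.lower y
        linarith [dgT y hy]
      · have hyv : y ≠ v := by rintro rfl; exact hy1 vT1
        have h3 : ∑ x ∈ S1, ind G y x ≤ ∑ x ∈ S2, ind G y x :=
          Finset.sum_le_sum_of_subset_of_nonneg S12 fun _ _ _ => ind_nonneg G _ _
        have h4 : ∀ x ∈ S1, ind G y x = 1 := by
          intro x hx
          have hadj : G.Adj x y := by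
            by_contra hna
            refine hy1 (NS1 x hx y ?_ hna)
            rintro rfl
            exact hdisj y (S23 (S12 hx)) hy
          simp [ind, hadj.symm]
        rw [Finset.sum_congr rfl h4] at h3
        simp only [Finset.sum_const, nsmul_eq_mul, mul_one] at h3
        simp only [hyv, if_false]
        linarith
    rw [Finset.sum_add_distrib, Finset.sum_ite_eq' T2 v, if_pos (T12 vT1)] at h2
    simp only [Finset.sum_const, nsmul_eq_mul] at h2
    linarith
  -- Dually, vertices of `T2` have all neighbours in `S3`, and those of `S3 \ S2` have none in `T1`.
  -- The latter contains all non-neighbours of a vertex of `S1`, hence at least `n - 1 - c₁`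
  -- elements.
  · have hII := hd.right T2 S3.card (by omega) hcardle
    have hcount := card_mul_card_eq G S3 T2
    have h2 : ∑ y ∈ T2, ((d y : ℤ) + if y = v then 1 else 0) ≤ ∑ y ∈ T2, ∑ x ∈ S3, ind G y x := by
      refine Finset.sum_le_sum fun y hy => ?_
      rw [sum_ind_eq_dg G (NT2 y hy)]
      exact dgT y hy
    rw [Finset.sum_add_distrib, Finset.sum_ite_eq' T2 v, if_pos (T12 vT1)] at h2
    have hT1 : (n : ℤ) - 1 - c₁ ≤ T1.card := by
      obtain ⟨x, hx⟩ : S1.Nonempty := by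
        rw [← Finset.card_pos]
        have : (0 : ℤ) < S1.card := by rw [cardS1]; linarith
        exact_mod_cast this
      have h3 := sum_one_sub_ind_eq G (B := T1) (x := x)
        (fun h => hdisj x (S23 (S12 hx)) (T12 h)) (NS1 x hx)
      have h4 : ∑ y ∈ T1, (1 - ind G x y) ≤ ∑ y ∈ T1, (1 : ℤ) :=
        Finset.sum_le_sum fun y _ => by linarith [ind_nonneg G x y]
      have h5 : (d x : ℤ) ≤ c₁ := by exact_mod_cast hd.upper x
      have h6 := dgS x (S12 hx)
      rw [h3, Fintype.card_fin] at h4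
      simp only [Finset.sum_const, nsmul_eq_mul, mul_one] at h4
      linarith
    have h1 : ∑ x ∈ S3, ((n : ℤ) - 1 - c₁) ≤ ∑ x ∈ S3, ∑ y ∈ T2, (1 - ind G x y) := by
      refine Finset.sum_le_sum fun x hx => ?_
      by_cases hx2 : x ∈ S2
      · rw [sum_one_sub_ind_eq G (fun h => hdisj x hx h) (NS2 x hx2), Fintype.card_fin]
        have h5 : (d x : ℤ) ≤ c₁ := by exact_mod_cast hd.upper x
        linarith [dgS x hx2]
      · have h3 : ∑ y ∈ T1, (1 - ind G x y) ≤ ∑ y ∈ T2, (1 - ind G x y) :=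
          Finset.sum_le_sum_of_subset_of_nonneg T12 fun y _ _ => by linarith [ind_le_one G x y]
        have h4 : ∀ y ∈ T1, (1 - ind G x y) = 1 := by
          intro y hy
          have : ¬ G.Adj x y := fun h => hx2 (NT1 y hy x h.symm)
          simp [ind, this]
        rw [Finset.sum_congr rfl h4] at h3
        simp only [Finset.sum_const, nsmul_eq_mul, mul_one] at h3
        linarith
    simp only [Finset.sum_const, nsmul_eq_mul] at h1
    linarith

end
end FullyGraphic

namespace FullyGraphic
open scoped Classical symmDiff
noncomputable section

/-! ### Exchanging edges and non-edges along a walk -/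

section toggling

variable {V : Type*}

lemma symmDiff_adj (G H : SimpleGraph V) (a b : V) :
    (G ∆ H).Adj a b ↔ ¬ (G.Adj a b ↔ H.Adj a b) := by
  simp only [symmDiff_def, SimpleGraph.sup_adj, SimpleGraph.sdiff_adj]
  tauto

/-- The graph of the pairs `w t w (t+1)`, `t < L`, that occur an odd number of times. -/
def trailGraph (w : ℕ → V) : ℕ → SimpleGraph V
  | 0 => ⊥
  | L + 1 => trailGraph w L ∆ SimpleGraph.edge (w L) (w (L + 1))

lemma exists_of_trailGraph_adj {w : ℕ → V} {L : ℕ} {a b : V} (h : (trailGraph w L).Adj a b) :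
    ∃ t < L, s(w t, w (t + 1)) = s(a, b) := by
  induction L with
  | zero => simp [trailGraph] at h
  | succ L ih =>
    simp only [trailGraph, symmDiff_adj] at h
    by_cases h1 : (trailGraph w L).Adj a b
    · obtain ⟨t, ht, h2⟩ := ih h1
      exact ⟨t, by omega, h2⟩
    · have h2 : (SimpleGraph.edge (w L) (w (L + 1))).Adj a b := by tauto
      rw [SimpleGraph.edge_adj] at h2
      refine ⟨L, by omega, ?_⟩
      rw [Sym2.eq_iff]
      tauto

lemma trailGraph_congr {w w' : ℕ → V} {L : ℕ} (h : ∀ t ≤ L, w t = w' t) :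
    trailGraph w L = trailGraph w' L := by
  induction L with
  | zero => rfl
  | succ L ih =>
    rw [trailGraph, trailGraph, ih fun t ht => h t (by omega), h L (by omega), h (L + 1) le_rfl]

lemma trailGraph_add (w : ℕ → V) (K L : ℕ) :
    trailGraph w (K + L) = trailGraph w K ∆ trailGraph (fun t => w (K + t)) L := by
  induction L with
  | zero => simp [trailGraph]
  | succ L ih => rw [← add_assoc, trailGraph, ih, trailGraph, symmDiff_assoc]; rfl

lemma trailGraph_succ_left (w : ℕ → V) (L : ℕ) :
    trailGraph w (L + 1) = SimpleGraph.edge (w 0) (w 1) ∆ trailGraph (fun t => w (t + 1)) L := by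
  rw [add_comm, trailGraph_add]
  simp [trailGraph, add_comm]

lemma trailGraph_reverse (w : ℕ → V) (L : ℕ) :
    trailGraph (fun t => w (L - t)) L = trailGraph w L := by
  induction L with
  | zero => rfl
  | succ L ih =>
    rw [trailGraph_succ_left]
    simp only [Nat.add_sub_add_right, ih, trailGraph]
    rw [symmDiff_comm, SimpleGraph.edge_comm]
    rfl

/-- `SimpleGraph.edge a a` is empty, so a walk may be padded by its last vertex. This brings all
walks to the common length `11`. -/
lemma trailGraph_of_const {w : ℕ → V} {K : ℕ} (hw : ∀ t, K ≤ t → w t = w K) {L : ℕ} (h : K ≤ L) :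
    trailGraph w L = trailGraph w K := by
  induction L, h using Nat.le_induction with
  | base => rfl
  | succ L hL ih =>
    rw [trailGraph, ih, hw L hL, hw (L + 1) (by omega)]
    simp

variable [Fintype V] [DecidableEq V]

lemma dg_symmDiff_edge (G : SimpleGraph V) {a b : V} (hab : a ≠ b) (x : V) :
    dg (G ∆ SimpleGraph.edge a b) x
      = dg G x + (if G.Adj a b then -1 else 1) * ((if x = a then 1 else 0) + if x = b then 1 else 0) := by
  have key : ∀ y, ind (G ∆ SimpleGraph.edge a b) x y = ind G x y +
      (if G.Adj a b then -1 else 1) * ((if x = a then (if y = b then 1 else 0) else 0) +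
        if x = b then (if y = a then 1 else 0) else 0) := by
    intro y
    unfold ind
    simp only [symmDiff_adj, SimpleGraph.edge_adj]
    by_cases h1 : x = a
    · subst h1
      by_cases h2 : y = b
      · subst h2
        by_cases h3 : G.Adj x y <;> simp [h3, hab]
      · simp [h2, hab]
    · by_cases h2 : x = b
      · subst h2
        by_cases h4 : y = a
        · subst h4
          by_cases h3 : G.Adj y x <;> simp [h3, hab, hab.symm, G.adj_comm x y]
        · simp [h1, h4]
      · simp [h1, h2]
  unfold dg
  simp_rw [key]
  rw [Finset.sum_add_distrib, ← Finset.mul_sum, Finset.sum_add_distrib]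
  congr 3
  · split_ifs <;> simp
  · split_ifs <;> simp

/-- Exchanging edges and non-edges along an alternating trail changes only the degrees of the
two ends. -/
lemma dg_symmDiff_trailGraph (G : SimpleGraph V) (o : ℕ) (w : ℕ → V) (L : ℕ)
    (hw : AltWalk G o w L)
    (hinj : ∀ s t, s < t → t < L → s(w s, w (s + 1)) ≠ s(w t, w (t + 1))) (x : V) :
    dg (G ∆ trailGraph w L) x = dg G x - (-1) ^ o * (if x = w 0 then 1 else 0)
      + (-1) ^ (o + L) * (if x = w L then 1 else 0) := by
  induction L with
  | zero => simp [trailGraph]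
  | succ L ih =>
    have h1 := ih (fun t ht => hw t (by omega)) (fun s t hst ht => hinj s t hst (by omega))
    obtain ⟨hne, hadj⟩ := hw L (by omega)
    rw [trailGraph, ← symmDiff_assoc, dg_symmDiff_edge _ hne, h1]
    -- The new pair has not been exchanged before, so it still has its status in `G`.
    have h2 : (G ∆ trailGraph w L).Adj (w L) (w (L + 1)) ↔ G.Adj (w L) (w (L + 1)) := by
      rw [symmDiff_adj]
      have : ¬ (trailGraph w L).Adj (w L) (w (L + 1)) := by
        intro h
        obtain ⟨t, ht, h3⟩ := exists_of_trailGraph_adj h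
        exact hinj t L ht (by omega) h3
      tauto
    have h3 : (if (G ∆ trailGraph w L).Adj (w L) (w (L + 1)) then (-1 : ℤ) else 1)
        = - (-1) ^ (o + L) := by
      rw [h2, hadj]
      split_ifs with h
      · rw [h.neg_one_pow]
      · rw [(Nat.not_even_iff_odd.1 h).neg_one_pow, neg_neg]
    rw [h3, ← add_assoc, pow_succ]
    ring

end toggling

/-! ### Alternating walks that are trails -/

section distinct

variable {V : Type*} {G : SimpleGraph V}

/-- Consecutive pairs have opposite status in `G`, so an alternating walk cannot turn back. -/
lemma AltWalk.pairs_ne {o L : ℕ} {w : ℕ → V} (hw : AltWalk G o w L) {s : ℕ} (hs : s + 1 < L) :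
    w s ≠ w (s + 2) := by
  intro h
  have h1 := hw s (by omega)
  have h2 := (hw (s + 1) hs).symm
  rw [show s + 1 + 1 = s + 2 from rfl, ← h] at h2
  have := h1.2.symm.trans h2.2
  rw [← add_assoc, Nat.even_add_one] at this
  tauto

lemma AltWalk.pairs_injective_of_cycle {o L : ℕ} {w : ℕ → V} (hw : AltWalk G o w L)
    (h : ∀ a b, a < b → b ≤ L → w a = w b → a = 0 ∧ b = L) :
    ∀ s t, s < t → t < L → s(w s, w (s + 1)) ≠ s(w t, w (t + 1)) := by
  intro s t hst ht heq
  rw [Sym2.eq_iff] at heq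
  rcases heq with ⟨h1, h2⟩ | ⟨h1, h2⟩
  · have := h s t hst ht.le h1
    omega
  · rcases Nat.lt_or_ge (s + 1) t with h3 | h3
    · have := h (s + 1) t h3 ht.le h2
      omega
    · obtain rfl : t = s + 1 := by omega
      exact hw.pairs_ne ht h1

/-- Two equal pairs at distance two or more would force two vertex repetitions with different end
points, at most one of which is the last but one vertex. -/
lemma AltWalk.pairs_injective_of_shortest {o L : ℕ} {w : ℕ → V} (hw : AltWalk G o w L)
    (h : ∀ a b, a < b → b ≤ L → w a = w b → b + 1 = L) :
    ∀ s t, s < t → t < L → s(w s, w (s + 1)) ≠ s(w t, w (t + 1)) := by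
  intro s t hst ht heq
  rw [Sym2.eq_iff] at heq
  rcases heq with ⟨h1, h2⟩ | ⟨h1, h2⟩
  · have := h (s + 1) (t + 1) (by omega) (by omega) h2
    have := h s t hst ht.le h1
    omega
  · rcases Nat.lt_or_ge (s + 1) t with h3 | h3
    · have h4 := h (s + 1) t h3 ht.le h2
      have := h s (t + 1) (by omega) (by omega) h1
      omega
    · obtain rfl : t = s + 1 := by omega
      exact hw.pairs_ne ht h1

/-- Alternating walks of length `3` are trails. -/
lemma AltWalk.pairs_injective_three {w : ℕ → V} {L : ℕ} (hL : L ≤ 3) (hw : AltWalk G 0 w L) :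
    ∀ s t, s < t → t < L → s(w s, w (s + 1)) ≠ s(w t, w (t + 1)) := by
  intro s t hst ht heq
  rw [Sym2.eq_iff] at heq
  by_cases h3 : t = s + 1
  · subst h3
    rcases heq with ⟨h1, h2⟩ | ⟨h1, h2⟩
    · exact (hw s (by omega)).1 h1
    · exact hw.pairs_ne ht h1
  · obtain ⟨rfl, rfl⟩ : s = 0 ∧ t = 2 := by omega
    rcases heq with ⟨h1, h2⟩ | ⟨h1, h2⟩
    · exact hw.pairs_ne (by omega) h1
    · exact (hw 1 (by omega)).1 h2

/-- Alternating walks of length `5` between vertices that are distinct and not adjacent are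
trails. -/
lemma AltWalk.pairs_injective_five {w : ℕ → V} (hw : AltWalk G 0 w 5) (hne : w 0 ≠ w 5)
    (hadj : ¬ G.Adj (w 0) (w 5)) :
    ∀ s t, s < t → t < 5 → s(w s, w (s + 1)) ≠ s(w t, w (t + 1)) := by
  intro s t hst ht heq
  -- Equal pairs are both edges or both non-edges, which leaves only the distances `2` and `4`.
  have hpar : Even s ↔ Even t := by
    have h1 := (hw s (by omega)).2
    have h2 := (hw t (by omega)).2
    rw [zero_add] at h1 h2
    rw [← h1, ← h2, ← SimpleGraph.mem_edgeSet, ← SimpleGraph.mem_edgeSet, heq]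
  rw [Sym2.eq_iff] at heq
  by_cases h2 : t = s + 2
  · subst h2
    rcases heq with ⟨h1, h2⟩ | ⟨h1, h2⟩
    · exact hw.pairs_ne (by omega) h1
    · exact (hw (s + 1) (by omega)).1 h2
  · obtain ⟨rfl, rfl⟩ : s = 0 ∧ t = 4 := by
      rw [Nat.even_iff, Nat.even_iff] at hpar
      omega
    rcases heq with ⟨h1, h2⟩ | ⟨h1, h2⟩
    · have := (hw 0 (by omega)).2.2 (by decide)
      rw [zero_add] at h2
      rw [zero_add, h2] at this
      exact hadj this
    · exact hne h1

end distinct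

end
end FullyGraphic

namespace FullyGraphic
open scoped Classical symmDiff
noncomputable section

/-! ### Shortest alternating walks -/

section shortest

variable {V : Type*} {G : SimpleGraph V}

lemma AltWalk.reverse {w : ℕ → V} {L : ℕ} (hw : AltWalk G 0 w L) (hL : Odd L) :
    AltWalk G 0 (fun t => w (L - t)) L := by
  intro t ht
  have h := (hw (L - (t + 1)) (by omega)).symm
  rw [show L - (t + 1) + 1 = L - t by omega] at h
  refine h.of_even_iff ?_
  rw [Nat.even_iff, Nat.even_iff]
  rw [Nat.odd_iff] at hL
  omega

lemma Reach.reverse {u v : V} {L : ℕ} (h : Reach G ∅ u L v) (hL : Odd L) : Reach G ∅ v L u := by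
  obtain ⟨w, h0, hk, hw, -⟩ := h
  exact ⟨fun t => w (L - t), by simp [hk], by simp [h0], hw.reverse hL, by simp⟩

/-- Whoever reaches `q b` with the parity of `b` may continue along `q`; used to cut out loops. -/
lemma Reach.tail {X : Set V} {v : V} {q : ℕ → V} {k : ℕ} (hw : AltWalk G 0 q k)
    (hX : ∀ t < k, q t ∉ X) {a b : ℕ} (h : Reach G X v a (q b)) (hab : Even a ↔ Even b) (s : ℕ)
    (hs : b + s ≤ k) : Reach G X v (a + s) (q (b + s)) := by
  induction s with
  | zero => simpa using h
  | succ s ih =>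
    refine (ih (by omega)).succ (hX _ (by omega)) ((hw (b + s) (by omega)).of_even_iff ?_)
    rw [Nat.even_iff, Nat.even_iff] at *
    omega

/-- A shortest alternating walk to a given vertex, of either parity, repeats at most its last but
one vertex. -/
lemma Reach.exists_shortest {X : Set V} {v x : V} {k : ℕ} (hx : x ∈ X) (h : Reach G X v k x) :
    ∃ k' ≤ k, ∃ q : ℕ → V, q 0 = v ∧ q k' = x ∧ AltWalk G 0 q k' ∧ (∀ t < k', q t ∉ X) ∧
      ∀ a b, a < b → b ≤ k' → q a = q b → b + 1 = k' := by
  have hex : ∃ k, Reach G X v k x := ⟨k, h⟩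
  refine ⟨Nat.find hex, Nat.find_min' hex h, ?_⟩
  have hmin : ∀ l, Reach G X v l x → Nat.find hex ≤ l := fun l hl => Nat.find_min' hex hl
  obtain ⟨q, h0, hk, hw, hX⟩ := Nat.find_spec hex
  refine ⟨q, h0, hk, hw, hX, ?_⟩
  intro a b hab hb heq
  generalize Nat.find hex = K at *
  rcases Nat.lt_or_ge b K with hbK | hbK
  · have ha : Reach G X v a (q a) :=
      ⟨q, h0, rfl, fun t ht => hw t (by omega), fun t ht => hX t (by omega)⟩
    have hb' : Reach G X v b (q b) :=
      ⟨q, h0, rfl, fun t ht => hw t (by omega), fun t ht => hX t (by omega)⟩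
    -- Equal parities allow the loop to be cut out. Otherwise `q a` is reached with both parities,
    -- so one of the two visits can step to `x` at once, and minimality leaves only `b + 1 = K`.
    by_cases hpar : Even a ↔ Even b
    · rw [heq] at ha
      have h1 := Reach.tail hw hX ha hpar (K - b) (by omega)
      rw [show b + (K - b) = K by omega, hk] at h1
      have := hmin _ h1
      omega
    · have hne : q a ≠ x := by
        rintro hq
        exact hX a (by omega) (hq ▸ hx)
      rcases alt_or_alt (G := G) hne hpar with h1 | h1
      · have := hmin _ (ha.succ (hX a (by omega)) h1)
        omega
      · rw [heq] at h1
        have := hmin _ (hb'.succ (hX b hbK) h1)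
        omega
  · obtain rfl : b = K := by omega
    exact absurd hx (by rw [← hk, ← heq]; exact hX a hab)

/-- In a shortest closed alternating walk of odd length only opposite vertices may agree. -/
lemma Reach.exists_shortest_closed {u : V} {l : ℕ} (hl : Odd l) (h : Reach G ∅ u l u) :
    ∃ k ≤ l, Odd k ∧ ∃ w : ℕ → V, w 0 = u ∧ w k = u ∧ AltWalk G 0 w k ∧
      ∀ a b, a < b → b ≤ k → w a = w b → a + b = k := by
  have hex : ∃ k, Odd k ∧ Reach G ∅ u k u := ⟨l, hl, h⟩
  refine ⟨Nat.find hex, Nat.find_min' hex ⟨hl, h⟩, (Nat.find_spec hex).1, ?_⟩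
  have hmin : ∀ l, Odd l → Reach G ∅ u l u → Nat.find hex ≤ l :=
    fun l h1 h2 => Nat.find_min' hex ⟨h1, h2⟩
  obtain ⟨hodd, w, h0, hk, hw, -⟩ := Nat.find_spec hex
  refine ⟨w, h0, hk, hw, ?_⟩
  intro a b hab hb heq
  generalize Nat.find hex = K at *
  have hr : ∀ a ≤ K, Reach G ∅ u a (w a) := fun a ha =>
    ⟨w, h0, rfl, fun t ht => hw t (by omega), by simp⟩
  have hr' : ∀ a ≤ K, Reach G ∅ u (K - a) (w a) := fun a ha =>
    ⟨fun t => w (K - t), by simp [hk], by simp only; congr 1; omega,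
      fun t ht => hw.reverse hodd t (by omega), by simp⟩
  have ha := hr a (by omega)
  have ha' := hr' a (by omega)
  have hb1 := hr b hb
  have hb2 := hr' b hb
  rw [← heq] at hb1 hb2
  rw [Nat.odd_iff] at hodd
  -- The repeated vertex is reached from `u` in `a`, `b`, `K - a` and `K - b` steps. If `a + b` is
  -- even, `a` and `K - b` close up to a shorter odd walk. Otherwise `a + b` and `2 * K - a - b` are
  -- lengths of odd closed walks, so neither is below `K`.
  by_cases hpar : (a + b) % 2 = 0
  · have h1 : Odd (a + (K - b)) := by rw [Nat.odd_iff]; omega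
    have := hmin _ h1 (ha.close hb2 h1)
    omega
  · have h1 : Odd (a + b) := by rw [Nat.odd_iff]; omega
    have h2 : Odd ((K - a) + (K - b)) := by rw [Nat.odd_iff]; omega
    have := hmin _ h1 (ha.close hb1 h1)
    have := hmin _ h2 (ha'.close hb2 h2)
    omega

end shortest

end
end FullyGraphic

namespace FullyGraphic
open scoped Classical symmDiff
noncomputable section

/-! ### Removing the surplus at two vertices -/

section stability

variable {V : Type*} [Fintype V] [DecidableEq V] {G : SimpleGraph V}

/-- An alternating trail of odd length at most `11` from `u` to `v`, read backwards and padded. -/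
lemma exists_trail_of_walk {u v : V} {w : ℕ → V} {L : ℕ} (hL : L ≤ 11) (hodd : Odd L)
    (h0 : w 0 = u) (h1 : w L = v) (hw : AltWalk G 0 w L)
    (hinj : ∀ s t, s < t → t < L → s(w s, w (s + 1)) ≠ s(w t, w (t + 1))) :
    ∃ W : ℕ → V, W 0 = v ∧ W 11 = u ∧ ∀ x, dg (G ∆ trailGraph W 11) x
      = dg G x - (if x = u then 1 else 0) - (if x = v then 1 else 0) := by
  -- Truncated subtraction keeps the reversed walk at `u` from time `L` on.
  refine ⟨fun t => w (L - t), by simp [h1], by simp [show L - 11 = 0 by omega, h0], ?_⟩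
  intro x
  rw [trailGraph_of_const (K := L) (fun t ht => by simp [show L - t = 0 by omega]) hL,
    trailGraph_reverse, dg_symmDiff_trailGraph G 0 w L hw hinj, h0, h1, zero_add,
    hodd.neg_one_pow]
  ring

/-- Given a closed alternating walk `w` from `u`, of odd length `l`, whose first `i` steps are
retraced at its end, and a trail `q` from `v` to a later vertex `w j` of it, in the graph with the
first `i` steps of `w` exchanged, the three parts together relieve `u` and `v`. -/
lemma exists_trail_of_cycle {u v : V} {w q : ℕ → V} {l i j k : ℕ} (hi : i ≤ j)
    (hjl : j + i ≤ l) (hil : 2 * i < l) (hkj : k + j ≤ 11) (hodd : Odd (k + j))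
    (h0 : w 0 = u) (hw : AltWalk G 0 w l)
    (hwinj : ∀ a b, a < b → b ≤ l → w a = w b → a + b = l)
    (hstem : ∀ a, i < a → 2 * a < l → w a ≠ w (l - a))
    (hq0 : q 0 = v) (hqk : q k = w j) (hq : AltWalk (G ∆ trailGraph w i) 0 q k)
    (havoid : ∀ t < k, ∀ s, i ≤ s → s + i ≤ l → q t ≠ w s)
    (hqinj : ∀ a b, a < b → b ≤ k → q a = q b → b + 1 = k) :
    ∃ W : ℕ → V, W 0 = v ∧ W 11 = u ∧ ∀ x, dg (G ∆ trailGraph W 11) x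
      = dg G x - (if x = u then 1 else 0) - (if x = v then 1 else 0) := by
  set W : ℕ → V := fun t => if t ≤ k then q t else w (j - (t - k)) with hW
  have hWq : ∀ t ≤ k, W t = q t := fun t ht => by simp [hW, ht]
  have hWw : ∀ t, W (k + t) = w (j - t) := by
    intro t
    rcases Nat.eq_zero_or_pos t with rfl | ht
    · simp [hW, hqk]
    · simp [hW, show ¬ t = 0 by omega]
  have hW11 : W 11 = u := by
    have := hWw (11 - k)
    rw [show k + (11 - k) = 11 by omega, show j - (11 - k) = 0 by omega, h0] at this
    exact this
  refine ⟨W, by rw [hWq 0 (by omega), hq0], hW11, ?_⟩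
  have hconst : ∀ t, k + j ≤ t → W t = W (k + j) := by
    intro t ht
    have := hWw (t - k)
    rw [show k + (t - k) = t by omega, show j - (t - k) = 0 by omega] at this
    rw [this, hWw j]
    simp
  have htr : trailGraph W 11 = trailGraph q k ∆ (trailGraph w i ∆ trailGraph (fun t => w (i + t)) (j - i)) := by
    rw [trailGraph_of_const hconst hkj, trailGraph_add, trailGraph_congr hWq]
    congr 1
    rw [trailGraph_congr (w' := fun t => w (j - t)) (fun t _ => hWw t), trailGraph_reverse,
      ← trailGraph_add]
    congr 1
    omega
  -- The exchange is made in three rounds: the stem, `q`, and the arc of the cycle from `w i` to `w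
  -- j`. Each is an alternating trail in the graph left by the previous rounds. `W` itself need not
  -- be a trail: a pair used by both `q` and the stem cancels.
  have hG : G ∆ trailGraph W 11
      = ((G ∆ trailGraph w i) ∆ trailGraph q k) ∆ trailGraph (fun t => w (i + t)) (j - i) := by
    rw [htr, symmDiff_left_comm, ← symmDiff_assoc, ← symmDiff_assoc]
    congr 1
    rw [symmDiff_assoc, symmDiff_assoc, symmDiff_comm (trailGraph q k), symmDiff_assoc]
  have hwi : AltWalk G 0 w i := fun t ht => hw t (by omega)
  have hseg : AltWalk ((G ∆ trailGraph w i) ∆ trailGraph q k) i (fun t => w (i + t)) (j - i) := by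
    intro t ht
    have h1 := hw (i + t) (by omega)
    rw [zero_add] at h1
    refine ⟨h1.1, Iff.trans ?_ h1.2⟩
    have h2 : ¬ (trailGraph w i).Adj (w (i + t)) (w (i + t + 1)) := by
      intro h
      obtain ⟨s, hs, heq⟩ := exists_of_trailGraph_adj h
      rw [Sym2.eq_iff] at heq
      rcases heq with ⟨h3, -⟩ | ⟨h3, -⟩
      · have := hwinj s (i + t) (by omega) (by omega) h3
        omega
      · have := hwinj s (i + t + 1) (by omega) (by omega) h3
        omega
    have h3 : ¬ (trailGraph q k).Adj (w (i + t)) (w (i + t + 1)) := by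
      intro h
      obtain ⟨s, hs, heq⟩ := exists_of_trailGraph_adj h
      rw [Sym2.eq_iff] at heq
      rcases heq with ⟨h3, -⟩ | ⟨h3, -⟩
      · exact havoid s hs _ (by omega) (by omega) h3
      · exact havoid s hs _ (by omega) (by omega) h3
    simp only [← add_assoc]
    rw [symmDiff_adj, symmDiff_adj]
    tauto
  intro x
  rw [hG, dg_symmDiff_trailGraph _ i _ _ hseg, dg_symmDiff_trailGraph _ 0 _ _ hq
    (hq.pairs_injective_of_shortest hqinj), dg_symmDiff_trailGraph _ 0 _ _ hwi]
  · rw [hq0, hqk, h0]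
    simp only [add_zero, zero_add, show i + (j - i) = j by omega]
    -- As `k + j` is odd, the contributions of `q` and of the arc at `w j` cancel; those of the stem
    -- and of the arc at `w i` always do.
    have : (-1 : ℤ) ^ k = - (-1) ^ j := by
      have h1 : (-1 : ℤ) ^ k * (-1) ^ j = -1 := by rw [← pow_add, hodd.neg_one_pow]
      rcases neg_one_pow_eq_or ℤ j with h2 | h2 <;> rw [h2] at h1 ⊢ <;> linarith
    rw [this]
    ring
  · refine hwi.pairs_injective_of_cycle ?_
    intro a b hab hb heq
    have := hwinj a b hab (by omega) heq
    omega
  · refine hseg.pairs_injective_of_cycle ?_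
    intro a b hab hb heq
    have h1 := hwinj (i + a) (i + b) (by omega) (by omega) heq
    by_cases ha : a = 0
    · exact ⟨ha, by omega⟩
    · exfalso
      refine hstem (i + a) (by omega) (by omega) ?_
      rw [show l - (i + a) = i + b by omega]
      exact heq

end stability

/-- Each realization of `d + e_u + e_v` can be turned into a realization of `d` by exchanges
along an alternating walk of length at most `11`. -/
theorem exists_trail {n : ℕ} {d : Fin n → ℕ} {c₁ c₂ m : ℕ} (hd : CornerBound d c₁ c₂ m)
    (G : SimpleGraph (Fin n)) (u v : Fin n)
    (hG : ∀ x, dg G x = d x + (if x = u then 1 else 0) + (if x = v then 1 else 0)) :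
    ∃ W : ℕ → Fin n, W 0 = v ∧ W 11 = u ∧ ∀ x, dg (G ∆ trailGraph W 11) x = d x := by
  have hfin : ∀ W : ℕ → Fin n, (∀ x, dg (G ∆ trailGraph W 11) x
      = dg G x - (if x = u then 1 else 0) - (if x = v then 1 else 0)) →
      ∀ x, dg (G ∆ trailGraph W 11) x = d x := by
    intro W h x
    rw [h x, hG x]
    ring
  suffices h : ∃ W : ℕ → Fin n, W 0 = v ∧ W 11 = u ∧ ∀ x, dg (G ∆ trailGraph W 11) x
      = dg G x - (if x = u then 1 else 0) - (if x = v then 1 else 0) by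
    obtain ⟨W, h1, h2, h3⟩ := h
    exact ⟨W, h1, h2, hfin W h3⟩
  -- walks of length at most three, and of length five if `u ≠ v`, are trails
  by_cases hshort : Reach G ∅ u 1 v ∨ Reach G ∅ u 3 v
  · rcases hshort with ⟨w, h0, h1, hw, -⟩ | ⟨w, h0, h1, hw, -⟩
    · exact exists_trail_of_walk (by norm_num) (by decide) h0 h1 hw
        (hw.pairs_injective_three (by norm_num))
    · exact exists_trail_of_walk (by norm_num) (by decide) h0 h1 hw
        (hw.pairs_injective_three (by norm_num))
  push Not at hshort
  by_cases hfive : u ≠ v ∧ Reach G ∅ u 5 v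
  · obtain ⟨huv, w, h0, h1, hw, -⟩ := hfive
    refine exists_trail_of_walk (by norm_num) (by decide) h0 h1 hw
      (hw.pairs_injective_five (by rwa [h0, h1]) ?_)
    rw [h0, h1]
    intro hadj
    exact hshort.1 ((reach_zero ∅ u).succ (by simp) (alt_of_adj hadj (by decide)))
  -- a shortest closed walk from `u`
  obtain ⟨l₀, hl₀, hl₀odd, hclosed⟩ : ∃ l ≤ 9, Odd l ∧ Reach G ∅ u l u := by
    rcases exists_reach_both hd G u v 1 (Or.inl rfl) (by simpa using hG) with
      ⟨x, a, b, ha, hb, hax, hbx⟩ | ⟨-, h⟩ | ⟨h, -⟩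
    · have hodd : Odd (a + b) := by rw [Nat.odd_iff]; omega
      exact ⟨a + b, by omega, hodd, hax.close hbx hodd⟩
    · exact absurd h (by tauto)
    · norm_num at h
  obtain ⟨l, hl, hlodd, w, h0, hwl, hw, hwinj⟩ := hclosed.exists_shortest_closed hl₀odd
  have hl9 : l ≤ 9 := hl.trans hl₀
  clear hl hl₀ hl₀odd hclosed l₀
  have hlmod := Nat.odd_iff.1 hlodd
  -- The largest `i` with `w i = w (l - i)` ends the stem; the remaining `l - 2 * i` steps form a
  -- cycle without repetitions. The value `0` is admissible because `w` is closed.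
  obtain ⟨i, hil, hwi, hstem⟩ : ∃ i, 2 * i < l ∧ w i = w (l - i) ∧
      ∀ a, i < a → 2 * a < l → w a ≠ w (l - a) := by
    let i := Nat.findGreatest (fun i => w i = w (l - i)) (l / 2)
    have h1 : i ≤ l / 2 := Nat.findGreatest_le _
    refine ⟨i, by omega, ?_, ?_⟩
    · exact Nat.findGreatest_spec (P := fun i => w i = w (l - i)) (m := 0) (by omega) (by simp [h0, hwl])
    · intro a ha hal
      exact Nat.findGreatest_is_greatest (P := fun i => w i = w (l - i)) ha (by omega)
  set C : Set (Fin n) := {x | ∃ s, i ≤ s ∧ s + i ≤ l ∧ x = w s} with hC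
  set G₁ := G ∆ trailGraph w i with hG₁
  have hCmem : ∀ s, i ≤ s → s + i ≤ l → w s ∈ C := fun s h1 h2 => ⟨s, h1, h2, rfl⟩
  -- It suffices to walk from `v` to the cycle `C` in `G₁`. As `l` is odd, `s` and `l - s` have
  -- different parities, so one direction round the cycle makes the total length odd.
  suffices hclaim : ∃ s k, i ≤ s ∧ s + i ≤ l ∧ Reach G₁ C v k (w s) ∧
      ∀ k' ≤ k, ∀ j, (j = s ∨ j = l - s) → Odd (k' + j) → k' + j ≤ 11 by
    obtain ⟨s, k, hs1, hs2, hreach, hbound⟩ := hclaim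
    obtain ⟨k', hk', q, hq0, hqk, hq, hqC, hqinj⟩ := hreach.exists_shortest (hCmem s hs1 hs2)
    by_cases hpar : Odd (k' + s)
    · refine exists_trail_of_cycle hs1 hs2 hil (hbound k' hk' s (Or.inl rfl) hpar) hpar h0 hw
        hwinj hstem hq0 hqk hq ?_ hqinj
      rintro t ht s' hs1' hs2' heq
      exact hqC t ht ⟨s', hs1', hs2', heq⟩
    · have hpar' : Odd (k' + (l - s)) := by
        rw [Nat.odd_iff] at *
        omega
      have hw' := hw.reverse hlodd
      -- The reversed walk is not known to begin with the same stem. Therefore `w'` takes the stem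
      -- from `w` and only the rest from the reversal, so that `G₁` stays the same.
      set w' : ℕ → Fin n := fun t => if t ≤ i then w t else w (l - t) with hw'def
      have hle : ∀ t, t ≤ i → w' t = w t := fun t ht => by simp [hw'def, ht]
      have hge : ∀ t, i ≤ t → w' t = w (l - t) := by
        intro t ht
        rcases ht.eq_or_lt with rfl | ht
        · rw [hle _ le_rfl, hwi]
        · simp [hw'def, show ¬ t ≤ i by omega]
      refine exists_trail_of_cycle (w := w') (q := q) (i := i) (by omega) (by omega) hil
        (hbound k' hk' (l - s) (Or.inr rfl) hpar') hpar' ?_ ?_ ?_ ?_ hq0 ?_ ?_ ?_ hqinj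
      · rw [hle 0 (by omega), h0]
      · intro t ht
        rcases Nat.lt_or_ge t i with h | h
        · rw [hle t (by omega), hle (t + 1) (by omega)]
          exact hw t ht
        · rw [hge t (by omega), hge (t + 1) (by omega)]
          exact hw' t ht
      · intro a b hab hb heq
        rcases Nat.lt_or_ge i b with h | h
        · rw [hge b h.le] at heq
          rcases Nat.lt_or_ge i a with h' | h'
          · rw [hge a h'.le] at heq
            have := hwinj (l - b) (l - a) (by omega) (by omega) heq.symm
            omega
          · rw [hle a h'] at heq
            rcases lt_trichotomy a (l - b) with h2 | h2 | h2
            · have := hwinj a (l - b) h2 (by omega) heq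
              omega
            · omega
            · have := hwinj (l - b) a h2 (by omega) heq.symm
              omega
        · rw [hle a (by omega), hle b h] at heq
          exact hwinj a b hab hb heq
      · intro a ha hal
        rw [hge a (by omega), hge (l - a) (by omega), show l - (l - a) = a by omega]
        exact (hstem a ha hal).symm
      · rw [hge (l - s) (by omega), show l - (l - s) = s by omega, hqk]
      · rw [trailGraph_congr hle]
        exact hq
      · rintro t ht s' hs1' hs2' heq
        refine hqC t ht ⟨l - s', by omega, by omega, ?_⟩
        rw [heq, hge s' hs1']
  -- Here `j ≤ l - i ≤ 9`. An odd `k' + j` above `11` requires `k' = 4`, `j = 9` and `i = 0`; then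
  -- `s` is `0` or `l`, and the vertex hit is `u`.
  have near : ∀ t ≤ 4, ∀ c ∈ C, Reach G₁ C v t c → (t = 4 → i = 0 → c ≠ u) →
      ∃ s k, i ≤ s ∧ s + i ≤ l ∧ Reach G₁ C v k (w s) ∧
      ∀ k' ≤ k, ∀ j, (j = s ∨ j = l - s) → Odd (k' + j) → k' + j ≤ 11 := by
    rintro t ht c ⟨s, hs1, hs2, rfl⟩ hreach hne
    refine ⟨s, t, hs1, hs2, hreach, ?_⟩
    intro k' hk' j hj hodd
    rw [Nat.odd_iff] at hodd
    by_contra hlt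
    have h4 : t = 4 := by omega
    have hi0 : i = 0 := by omega
    refine hne h4 hi0 ?_
    have h9 : s = 0 ∨ s = l := by omega
    rcases h9 with rfl | rfl
    · exact h0
    · exact hwl
  have hdeg : ∀ x, dg G₁ x = d x + (if x = v then 1 else 0) + (-1) ^ i * (if x = w i then 1 else 0) := by
    intro x
    have hwi' : AltWalk G 0 w i := fun t ht => hw t (by omega)
    rw [hG₁, dg_symmDiff_trailGraph G 0 w i hwi' (hwi'.pairs_injective_of_cycle ?_) x, hG x, h0]
    · simp only [pow_zero, zero_add]
      ring
    · intro a b hab hb heq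
      have := hwinj a b hab (by omega) heq
      omega
  have hzC : w i ∈ C := hCmem i le_rfl (by omega)
  by_cases hvC : v ∈ C
  · exact near 0 (by norm_num) v hvC (reach_zero _ _) (by norm_num)
  -- For `i = 0` nothing has been exchanged, and the reverse of such a walk would be one of those
  -- excluded above.
  have hnotu : i = 0 → ∀ a, (a = 1 ∨ a = 3 ∨ a = 5) → ¬ Reach G₁ ∅ v a u := by
    rintro hi0 a ha hreach
    have hG₁G : G₁ = G := by rw [hG₁, hi0]; simp [trailGraph]
    rw [hG₁G] at hreach
    have hrev := hreach.reverse (by rcases ha with rfl | rfl | rfl <;> decide)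
    have huv : u ≠ v := by
      rintro rfl
      rw [hi0, h0] at hzC
      exact hvC hzC
    rcases ha with rfl | rfl | rfl
    · exact hshort.1 hrev
    · exact hshort.2 hrev
    · exact hfive ⟨huv, hrev⟩
  -- Exchanging the stem has moved the perturbation from `u` to `w i`, with sign `(-1) ^ i`, so the
  -- counting argument applies again from `v`.
  rcases exists_reach_both hd G₁ v (w i) ((-1) ^ i) (neg_one_pow_eq_or ℤ i) hdeg with
    ⟨x, a, b, ha, hb, hax, hbx⟩ | ⟨-, h⟩ | ⟨hi, h⟩
  · rcases hbx.hit_or_avoid C with ⟨t, ht, c, hc, hr⟩ | hbx'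
    · exact near t (by omega) c hc hr (by omega)
    by_cases hxC : x ∈ C
    · refine near b (by omega) x hxC hbx' ?_
      rintro - hi0 rfl
      exact hnotu hi0 a ha hax
    obtain ⟨a', rfl⟩ : ∃ a', a = a' + 1 := ⟨a - 1, by omega⟩
    obtain ⟨y, hy, -, hyx⟩ := hax.exists_pred
    rcases hy.hit_or_avoid C with ⟨t, ht, c, hc, hr⟩ | hy'
    · exact near t (by omega) c hc hr (by omega)
    by_cases hyC : y ∈ C
    · refine near a' (by omega) y hyC hy' ?_
      rintro - hi0 rfl
      refine hnotu hi0 (b + 1) (by omega) (hbx.succ (by simp) (hyx.symm.of_even_iff ?_))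
      rw [Nat.even_iff, Nat.even_iff]
      omega
    have hax' := hy'.succ hyC hyx
    -- Now `x` is off `C` and reached with both parities by walks that avoid `C`, so it can step to
    -- any vertex of `C`. The middle one needs at most `5` further steps either way, and `6 + 5 =
    -- 11`.
    have hmid : w (l / 2) ∈ C := hCmem _ (by omega) (by omega)
    have hxne : x ≠ w (l / 2) := by
      rintro rfl
      exact hxC hmid
    have hpar : ¬ (Even (a' + 1) ↔ Even b) := by
      rw [Nat.even_iff, Nat.even_iff]
      omega
    obtain ⟨k, hk, hr⟩ : ∃ k ≤ 6, Reach G₁ C v k (w (l / 2)) := by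
      rcases alt_or_alt (G := G₁) hxne hpar with h1 | h1
      · exact ⟨a' + 1 + 1, by omega, hax'.succ hxC h1⟩
      · exact ⟨b + 1, by omega, hbx'.succ hxC h1⟩
    exact ⟨l / 2, k, by omega, by omega, hr, by intros; omega⟩
  · have : ∃ a ≤ 3, Reach G₁ ∅ v a (w i) := by
      rcases h with h | h
      · exact ⟨1, by norm_num, h⟩
      · exact ⟨3, by norm_num, h⟩
    obtain ⟨a, ha, h⟩ := this
    rcases h.hit_or_avoid C with ⟨t, ht, c, hc, hr⟩ | h'
    · exact near t (by omega) c hc hr (by omega)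
    · exact near a (by omega) _ hzC h' (by omega)
  · have hi0 : i ≠ 0 := by
      rintro rfl
      norm_num at hi
    have : ∃ a ≤ 4, Reach G₁ ∅ v a (w i) := by
      rcases h with h | h | h
      · exact ⟨0, by norm_num, h⟩
      · exact ⟨2, by norm_num, h⟩
      · exact ⟨4, by norm_num, h⟩
    obtain ⟨a, ha, h⟩ := this
    rcases h.hit_or_avoid C with ⟨t, ht, c, hc, hr⟩ | h'
    · exact near t (by omega) c hc hr (fun _ h => absurd h hi0)
    · exact near a (by omega) _ hzC h' (fun _ h => absurd h hi0)

end
end FullyGraphic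

/-! ### The stability bound -/

namespace FullyGraphic
open scoped Classical symmDiff
noncomputable section

lemma exists_cornerBound_of_mem {s : Seq} (hs : s ∈ maxFullyGraphicRegion) :
    ∃ c₁ c₂ m, CornerBound s.2 c₁ c₂ m := by
  obtain ⟨R, ⟨n, S, c₁, c₂, h0, h1, h2, rfl, hfull⟩, hmem⟩ := hs
  obtain ⟨n', d⟩ := s
  obtain rfl : n' = n := hmem.2.1
  obtain ⟨m, hm⟩ := exists_cornerBound h0 h1 h2 hfull d hmem
  exact ⟨c₁, c₂, m, hm⟩

lemma realization_dg {n : ℕ} {d : Fin n → ℕ} (G : Realization d) (x : Fin n) :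
    dg G.1 x = d x := by
  rw [dg_eq_degree, G.2 x]

/-- A graph with the right degrees, as a realization. -/
def Realization.mk' {n : ℕ} {d : Fin n → ℕ} (G : SimpleGraph (Fin n)) (h : ∀ x, dg G x = d x) :
    Realization d :=
  ⟨G, fun x => by have := h x; rw [dg_eq_degree] at this; exact_mod_cast this⟩

/-- A perturbed realization is sent to the repaired one together with the `12` vertices of the walk.
Exchanging again along the walk recovers it, and the ends of the walk are the perturbed indices, so
the map is injective. -/
lemma sum_numRealizations_le {n : ℕ} {d : Fin n → ℕ} {c₁ c₂ m : ℕ} (hd : CornerBound d c₁ c₂ m) :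
    ∑ p : Fin n × Fin n, numRealizations (d + Pi.single p.1 1 + Pi.single p.2 1)
      ≤ numRealizations d * n ^ 12 := by
  have key : ∀ a : (Σ p : Fin n × Fin n, Realization (d + Pi.single p.1 1 + Pi.single p.2 1)),
      ∃ W : ℕ → Fin n, W 0 = a.1.2 ∧ W 11 = a.1.1 ∧
        ∀ x, dg (a.2.1 ∆ trailGraph W 11) x = d x := by
    rintro ⟨⟨i, j⟩, G⟩
    refine exists_trail hd G.1 i j ?_
    intro x
    rw [realization_dg]
    simp [Pi.single_apply]
  choose W hW0 hW11 hW using key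
  have hcard : Fintype.card (Realization d × (Fin 12 → Fin n)) = numRealizations d * n ^ 12 := by
    rw [Fintype.card_prod, Fintype.card_fun, Fintype.card_fin, Fintype.card_fin]
    rfl
  rw [← hcard]
  have hsum : ∑ p : Fin n × Fin n, numRealizations (d + Pi.single p.1 1 + Pi.single p.2 1)
      = Fintype.card (Σ p : Fin n × Fin n, Realization (d + Pi.single p.1 1 + Pi.single p.2 1)) := by
    rw [Fintype.card_sigma]
    rfl
  rw [hsum]
  refine Fintype.card_le_of_injective
    (fun a => (Realization.mk' (a.2.1 ∆ trailGraph (W a) 11) (hW a), fun t => W a t)) ?_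
  intro a b hab
  obtain ⟨h1, h2⟩ := Prod.ext_iff.1 hab
  have hWeq : ∀ t ≤ 11, W a t = W b t := fun t ht => congrFun h2 ⟨t, by omega⟩
  have h3 : a.2.1 = b.2.1 := by
    have h4 := congrArg Subtype.val h1
    simp only [Realization.mk'] at h4
    rw [trailGraph_congr hWeq] at h4
    exact symmDiff_left_injective _ h4
  have h5 : a.1 = b.1 := by
    ext1
    · rw [← hW11 a, ← hW11 b, hWeq 11 le_rfl]
    · rw [← hW0 a, ← hW0 b, hWeq 0 (by omega)]
  obtain ⟨p, G, hG⟩ := a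
  obtain ⟨p', G', hG'⟩ := b
  simp only at h3 h5
  subst h5
  subst h3
  rfl

theorem isStable_maxFullyGraphicRegion : IsStable (3 * Polynomial.X ^ 13) maxFullyGraphicRegion := by
  intro s hs hgr
  obtain ⟨c₁, c₂, m, hd⟩ := exists_cornerBound_of_mem hs
  obtain ⟨n, d⟩ := s
  have hpos : 0 < numRealizations d := Fintype.card_pos_iff.2 hgr
  have hn : 1 ≤ n := by have := hd.lt; simp only at this; omega
  have hle : perturbationRatio ⟨n, d⟩ ≤ (n : ℝ) ^ 12 := by
    unfold perturbationRatio
    simp only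
    calc ∑ i : Fin n, ∑ j ∈ Finset.Ici i,
        (numRealizations (d + Pi.single i 1 + Pi.single j 1) : ℝ) / (numRealizations d : ℝ)
        ≤ ∑ i : Fin n, ∑ j : Fin n,
        (numRealizations (d + Pi.single i 1 + Pi.single j 1) : ℝ) / (numRealizations d : ℝ) := by
          refine Finset.sum_le_sum fun i _ => ?_
          exact Finset.sum_le_sum_of_subset_of_nonneg (Finset.subset_univ _)
            fun _ _ _ => by positivity
      _ = (∑ p : Fin n × Fin n, (numRealizations (d + Pi.single p.1 1 + Pi.single p.2 1) : ℝ))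
          / (numRealizations d : ℝ) := by
          rw [Finset.sum_div, Fintype.sum_prod_type]
      _ ≤ (n : ℝ) ^ 12 := by
          rw [div_le_iff₀ (by exact_mod_cast hpos), mul_comm]
          exact_mod_cast sum_numRealizations_le hd
  refine hle.trans ?_
  have h1 : (1 : ℝ) ≤ n := by exact_mod_cast hn
  simp only [Polynomial.eval_mul, Polynomial.eval_pow, Polynomial.eval_X, Polynomial.eval_ofNat]
  have h2 : (0 : ℝ) ≤ (n : ℝ) ^ 12 := by positivity
  nlinarith [mul_nonneg h2 (sub_nonneg.2 h1)]

/-- For `c₁ = c₂ = n - 1` the only member is the degree sequence of the complete graph. -/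
lemma infinite_maxFullyGraphicRegion : maxFullyGraphicRegion.Infinite := by
  refine Set.infinite_of_injective_forall_mem
    (f := fun k : ℕ => (⟨k + 2, fun _ => k + 1⟩ : Seq)) ?_ ?_
  · intro a b hab
    have := congrArg Sigma.fst hab
    simpa using this
  · intro k
    refine ⟨simpleRegion (k + 2) ((k + 2) * (k + 1)) (k + 1) (k + 1),
      ⟨k + 2, (k + 2) * (k + 1), k + 1, k + 1, by omega, le_rfl, by omega, rfl, ?_⟩, ?_⟩
    · rintro ⟨n, d⟩ ⟨-, hn, hd, -⟩
      simp only at hn hd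
      subst hn
      refine ⟨⊤, fun i : Fin (k + 2) => ?_⟩
      simp only
      rw [le_antisymm (hd i).2 (hd i).1]
      have h : (⊤ : SimpleGraph (Fin (k + 2))).degree i = Fintype.card (Fin (k + 2)) - 1 := by
        convert SimpleGraph.complete_graph_degree i
      rw [Fintype.card_fin, show k + 2 - 1 = k + 1 from rfl] at h
      convert h
    · refine ⟨⟨fun i => by simp, ?_⟩, rfl, fun i => by simp, by simp⟩
      simp only [Finset.sum_const, Finset.card_univ, Fintype.card_fin, smul_eq_mul]
      rw [mul_comm]
      exact Nat.even_mul_succ_self (k + 1)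

end
end FullyGraphic

namespace FullyGraphic
open scoped Classical symmDiff
noncomputable section

/-- The adjacency relation of a graph as a function on pairs. -/
def adjFun {V : Type*} (G : SimpleGraph V) : V × V → Prop := fun p => G.Adj p.1 p.2

/-! ### Hamming balls and the distance of two graphs -/

section ball

variable {X Y : Type*} [Fintype X] [Fintype Y] [DecidableEq Y]

/-- The number of functions that differ from `f` at `c` points at most. -/
lemma card_hamming_ball_le (f : X → Y) (c : ℕ) :
    (Finset.univ.filter fun g : X → Y => hammingDist f g ≤ c).card
      ≤ (Fintype.card X * Fintype.card Y + 1) ^ c := by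
  induction c with
  | zero =>
    simp only [nonpos_iff_eq_zero, hammingDist_eq_zero, pow_zero]
    rw [Finset.card_le_one]
    intro a ha b hb
    simp only [Finset.mem_filter, Finset.mem_univ, true_and] at ha hb
    rw [← ha, ← hb]
  | succ c ih =>
    let φ : (X → Y) × Option (X × Y) → (X → Y) := fun p =>
      match p.2 with
      | none => p.1
      | some q => Function.update p.1 q.1 q.2
    have hsub : (Finset.univ.filter fun g : X → Y => hammingDist f g ≤ c + 1) ⊆
        ((Finset.univ.filter fun g : X → Y => hammingDist f g ≤ c) ×ˢ Finset.univ).image φ := by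
      intro g hg
      simp only [Finset.mem_filter, Finset.mem_univ, true_and] at hg
      simp only [Finset.mem_image, Finset.mem_product, Finset.mem_filter, Finset.mem_univ,
        true_and, and_true, Prod.exists]
      by_cases hfg : f = g
      · exact ⟨g, none, by simp [hfg], rfl⟩
      · obtain ⟨x, hx⟩ := Function.ne_iff.1 hfg
        -- Resetting `g` to `f` at one point of disagreement brings it closer to `f`; the point and
        -- the old value restore `g`.
        refine ⟨Function.update g x (f x), some (x, g x), ?_, by simp [φ]⟩
        have : (Finset.univ.filter fun i => f i ≠ Function.update g x (f x) i) ⊂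
            Finset.univ.filter fun i => f i ≠ g i := by
          rw [Finset.ssubset_iff_of_subset]
          · exact ⟨x, by simpa using hx, by simp⟩
          · intro y hy
            simp only [Finset.mem_filter, Finset.mem_univ, true_and] at hy ⊢
            by_cases hyx : y = x
            · subst hyx; exact hx
            · rwa [Function.update_of_ne hyx] at hy
        have := Finset.card_lt_card this
        unfold hammingDist at *
        omega
    refine (Finset.card_le_card hsub).trans (Finset.card_image_le.trans ?_)
    rw [Finset.card_product, Finset.card_univ, Fintype.card_option, Fintype.card_prod, pow_succ]
    exact Nat.mul_le_mul_right _ ih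

lemma card_le_of_hammingDist_le (f : X → Y) (c : ℕ) (s : Finset (X → Y))
    (hs : ∀ g ∈ s, hammingDist f g ≤ c) :
    s.card ≤ (Fintype.card X * Fintype.card Y + 1) ^ c := by
  refine (Finset.card_le_card fun g hg => ?_).trans (card_hamming_ball_le f c)
  rw [Finset.mem_filter]
  exact ⟨Finset.mem_univ _, hs g hg⟩

end ball

section graphDist

variable {V : Type*}

lemma adjFun_injective : Function.Injective (adjFun : SimpleGraph V → V × V → Prop) := by
  intro G H h
  ext a b
  exact iff_of_eq (congrFun h (a, b))

variable [Fintype V]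

/-- The number of ordered pairs on which two graphs differ. -/
def gdist (G H : SimpleGraph V) : ℕ := hammingDist (adjFun G) (adjFun H)

lemma gdist_eq_zero {G H : SimpleGraph V} : gdist G H = 0 ↔ G = H := by
  unfold gdist
  rw [hammingDist_eq_zero, adjFun_injective.eq_iff]

lemma gdist_comm (G H : SimpleGraph V) : gdist G H = gdist H G := hammingDist_comm _ _

lemma gdist_triangle (G H K : SimpleGraph V) : gdist G K ≤ gdist G H + gdist H K :=
  hammingDist_triangle _ _ _

lemma card_gdist_ball_le (G : SimpleGraph V) (c : ℕ) (s : Finset (SimpleGraph V))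
    (hs : ∀ H ∈ s, gdist G H ≤ c) :
    s.card ≤ (2 * Fintype.card V ^ 2 + 1) ^ c := by
  have h := card_le_of_hammingDist_le (adjFun G) c (s.image adjFun) (by
    intro g hg
    obtain ⟨H, hH, rfl⟩ := Finset.mem_image.1 hg
    exact hs H hH)
  rw [Finset.card_image_of_injective s adjFun_injective, Fintype.card_prod, Fintype.card_prop] at h
  rw [sq, mul_comm 2]
  exact h

lemma gdist_edge_le (G : SimpleGraph V) (a b : V) : gdist G (G ∆ SimpleGraph.edge a b) ≤ 2 := by
  have : (Finset.univ.filter fun p : V × V => adjFun G p ≠ adjFun (G ∆ SimpleGraph.edge a b) p)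
      ⊆ {(a, b), (b, a)} := by
    rintro ⟨x, y⟩ hp
    simp only [Finset.mem_filter, Finset.mem_univ, true_and, adjFun, ne_eq, eq_iff_iff,
      symmDiff_adj, SimpleGraph.edge_adj] at hp
    simp only [Finset.mem_insert, Finset.mem_singleton, Prod.mk.injEq]
    by_contra hcon
    apply hp
    tauto
  exact (Finset.card_le_card this).trans Finset.card_le_two

lemma gdist_trailGraph_le (G : SimpleGraph V) (w : ℕ → V) (L : ℕ) :
    gdist G (G ∆ trailGraph w L) ≤ 2 * L := by
  induction L with
  | zero => simp [trailGraph, gdist]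
  | succ L ih =>
    rw [trailGraph, ← symmDiff_assoc]
    have := gdist_triangle G (G ∆ trailGraph w L)
      ((G ∆ trailGraph w L) ∆ SimpleGraph.edge (w L) (w (L + 1)))
    have := gdist_edge_le (G ∆ trailGraph w L) (w L) (w (L + 1))
    omega

end graphDist

end
end FullyGraphic

/-! ### Switches bring two graphs with equal degrees closer -/

namespace FullyGraphic
open scoped Classical symmDiff
noncomputable section

lemma trailGraph_adj_iff {V : Type*} {w : ℕ → V} {L : ℕ}
    (hinj : ∀ s t, s < t → t < L → s(w s, w (s + 1)) ≠ s(w t, w (t + 1))) (a b : V) :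
    (trailGraph w L).Adj a b ↔ a ≠ b ∧ ∃ t < L, s(w t, w (t + 1)) = s(a, b) := by
  induction L with
  | zero => simp [trailGraph]
  | succ L ih =>
    rw [trailGraph, symmDiff_adj, ih fun s t hst ht => hinj s t hst (by omega),
      SimpleGraph.edge_adj]
    have h1 : (a = w L ∧ b = w (L + 1) ∨ a = w (L + 1) ∧ b = w L) ↔
        s(w L, w (L + 1)) = s(a, b) := by rw [eq_comm (a := s(w L, w (L + 1))), Sym2.eq_iff]
    rw [h1]
    by_cases hab : a = b
    · simp [hab]
    · simp only [hab, ne_eq, not_false_eq_true, true_and, and_true]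
      constructor
      · intro h
        by_cases h2 : ∃ t < L, s(w t, w (t + 1)) = s(a, b)
        · obtain ⟨t, ht, h3⟩ := h2
          exact ⟨t, by omega, h3⟩
        · exact ⟨L, by omega, by tauto⟩
      · rintro ⟨t, ht, h3⟩ h4
        rcases Nat.lt_succ_iff_lt_or_eq.1 ht with h5 | rfl
        · exact hinj t L h5 (by omega) (h3.trans (h4.1 ⟨t, h5, h3⟩).symm)
        · obtain ⟨t', ht', h6⟩ := h4.2 h3
          exact hinj t' t ht' (by omega) (h6.trans h3.symm)

section switches

variable {n : ℕ}

lemma IsSwitch.symm {G H : SimpleGraph (Fin n)} (h : IsSwitch G H) : IsSwitch H G := by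
  obtain ⟨v₁, w₁, v₂, w₂, h1, h2, h3, h4, h5, h6, h7⟩ := h
  have hmem : ∀ x y, H.Adj x y ↔ (G.Adj x y ∧ s(x, y) ≠ s(v₁, w₁) ∧ s(x, y) ≠ s(v₂, w₂)) ∨
      s(x, y) = s(v₁, w₂) ∨ s(x, y) = s(v₂, w₁) := by
    intro x y
    rw [← SimpleGraph.mem_edgeSet, h7]
    simp only [Set.mem_union, Set.mem_sdiff, SimpleGraph.mem_edgeSet, Set.mem_insert_iff,
      Set.mem_singleton_iff, not_or]
  have e1 : ∀ x y, s(x, y) = s(v₁, w₂) → ¬ G.Adj x y := by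
    intro x y h
    rw [← SimpleGraph.mem_edgeSet, h]
    exact h5
  have e2 : ∀ x y, s(x, y) = s(v₂, w₁) → ¬ G.Adj x y := by
    intro x y h
    rw [← SimpleGraph.mem_edgeSet, h]
    exact h6
  have e3 : ∀ x y, s(x, y) = s(v₁, w₁) → G.Adj x y := by
    intro x y h
    rw [← SimpleGraph.mem_edgeSet, h]
    exact h1
  have e4 : ∀ x y, s(x, y) = s(v₂, w₂) → G.Adj x y := by
    intro x y h
    rw [← SimpleGraph.mem_edgeSet, h]
    exact h2
  refine ⟨v₁, w₂, v₂, w₁, (hmem _ _).2 (by simp), (hmem _ _).2 (by simp), h1.ne, h2.ne, ?_, ?_, ?_⟩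
  · rw [hmem]
    have := e1 v₁ w₁
    have := e2 v₁ w₁
    tauto
  · rw [hmem]
    have := e1 v₂ w₂
    have := e2 v₂ w₂
    tauto
  · ext e
    induction e using Sym2.ind with
    | _ x y =>
      simp only [Set.mem_union, Set.mem_sdiff, SimpleGraph.mem_edgeSet, Set.mem_insert_iff,
        Set.mem_singleton_iff, not_or, hmem]
      have := e1 x y
      have := e2 x y
      have := e3 x y
      have := e4 x y
      tauto

lemma IsSwitch.gdist_le {G H : SimpleGraph (Fin n)} (h : IsSwitch G H) : gdist G H ≤ 8 := by
  obtain ⟨v₁, w₁, v₂, w₂, h1, h2, h3, h4, h5, h6, h7⟩ := h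
  let s : Finset (Fin n × Fin n) := {(v₁, w₁), (w₁, v₁), (v₂, w₂), (w₂, v₂), (v₁, w₂), (w₂, v₁), (v₂, w₁), (w₁, v₂)}
  have hs : s.card ≤ 8 := (Finset.card_insert_le _ _).trans
    (Nat.succ_le_succ ((Finset.card_insert_le _ _).trans (Nat.succ_le_succ Finset.card_le_six)))
  refine le_trans (Finset.card_le_card ?_) hs
  rintro ⟨x, y⟩ hp
  have hH : H.Adj x y ↔ s(x, y) ∈ (G.edgeSet \ {s(v₁, w₁), s(v₂, w₂)}) ∪ {s(v₁, w₂), s(v₂, w₁)} := by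
    rw [← h7, SimpleGraph.mem_edgeSet]
  simp only [Finset.mem_filter, Finset.mem_univ, true_and, adjFun, ne_eq, eq_iff_iff, hH] at hp
  by_contra hcon
  have hne : ∀ a b : Fin n, (a, b) ∈ s → (b, a) ∈ s → s(x, y) ≠ s(a, b) := by
    intro a b h h' heq
    rcases Sym2.eq_iff.1 heq with ⟨rfl, rfl⟩ | ⟨rfl, rfl⟩
    · exact hcon h
    · exact hcon h'
  apply hp
  simp only [Set.mem_union, Set.mem_sdiff, SimpleGraph.mem_edgeSet, Set.mem_insert_iff,
    Set.mem_singleton_iff, hne v₁ w₁ (by simp [s]) (by simp [s]), hne v₂ w₂ (by simp [s]) (by simp [s]),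
    hne v₁ w₂ (by simp [s]) (by simp [s]), hne v₂ w₁ (by simp [s]) (by simp [s]),
    or_self, not_false_eq_true, and_true, or_false]

/-- Exchanging the edges and non-edges of an alternating `4`-cycle. -/
lemma exists_switch (G : SimpleGraph (Fin n)) {a b c e : Fin n} (hab : G.Adj a b)
    (hbc : ¬ G.Adj b c) (hce : G.Adj c e) (hea : ¬ G.Adj e a) (hbc' : b ≠ c) (hea' : e ≠ a) :
    ∃ K, IsSwitch G K ∧ (∀ x, dg K x = dg G x) ∧
      ∀ x y, K.Adj x y ↔ ¬ (G.Adj x y ↔ (s(x, y) = s(a, b) ∨ s(x, y) = s(b, c) ∨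
        s(x, y) = s(c, e) ∨ s(x, y) = s(e, a))) := by
  have hac : a ≠ c := by rintro rfl; exact hbc hab.symm
  have hbe : b ≠ e := by rintro rfl; exact hea hab.symm
  let w : ℕ → Fin n := fun t => match t with
    | 0 => a
    | 1 => b
    | 2 => c
    | 3 => e
    | _ => a
  have hw : AltWalk G 0 w 4 := by
    intro t ht
    interval_cases t
    · exact alt_of_adj hab (by decide)
    · exact alt_of_not_adj hbc' hbc (by decide)
    · exact alt_of_adj hce (by decide)
    · exact alt_of_not_adj hea' hea (by decide)
  have hinj := hw.pairs_injective_of_cycle (by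
    intro i j hij hj heq
    have hi : i < 4 := by omega
    interval_cases j <;> interval_cases i <;> simp only [w] at heq <;>
      first
        | exact ⟨rfl, rfl⟩
        | exact absurd heq (by first | exact hab.ne | exact hac | exact hbc' | exact hea'.symm | exact hbe | exact hce.ne | exact hab.ne' | exact hac.symm | exact hea'))
  have hadj : ∀ x y, (G ∆ trailGraph w 4).Adj x y ↔ ¬ (G.Adj x y ↔ (s(x, y) = s(a, b) ∨
      s(x, y) = s(b, c) ∨ s(x, y) = s(c, e) ∨ s(x, y) = s(e, a))) := by
    intro x y
    rw [symmDiff_adj, trailGraph_adj_iff hinj]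
    have : (x ≠ y ∧ ∃ t < 4, s(w t, w (t + 1)) = s(x, y)) ↔ (s(x, y) = s(a, b) ∨
      s(x, y) = s(b, c) ∨ s(x, y) = s(c, e) ∨ s(x, y) = s(e, a)) := by
      constructor
      · rintro ⟨-, t, ht, h⟩
        interval_cases t
        · exact Or.inl h.symm
        · exact Or.inr (Or.inl h.symm)
        · exact Or.inr (Or.inr (Or.inl h.symm))
        · exact Or.inr (Or.inr (Or.inr h.symm))
      · intro h
        refine ⟨?_, ?_⟩
        · rintro rfl
          have h1 := hab.ne
          have h2 := hce.ne
          simp only [Sym2.eq_iff] at h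
          rcases h with h | h | h | h <;> rcases h with ⟨h, h'⟩ | ⟨h, h'⟩ <;> subst h <;> simp_all
        · rcases h with h | h | h | h
          · exact ⟨0, by omega, h.symm⟩
          · exact ⟨1, by omega, h.symm⟩
          · exact ⟨2, by omega, h.symm⟩
          · exact ⟨3, by omega, h.symm⟩
    rw [this]
  refine ⟨G ∆ trailGraph w 4, ⟨a, b, c, e, hab, hce, hea'.symm, hbc'.symm, ?_, ?_, ?_⟩, ?_, hadj⟩
  · rwa [G.adj_comm]
  · rwa [G.adj_comm]
  · ext z
    induction z using Sym2.ind with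
    | _ x y =>
      simp only [Set.mem_union, Set.mem_sdiff, SimpleGraph.mem_edgeSet, Set.mem_insert_iff,
        Set.mem_singleton_iff, not_or, hadj]
      have e1 : s(x, y) = s(b, c) → ¬ G.Adj x y := by
        intro h
        rw [← SimpleGraph.mem_edgeSet, h]
        exact hbc
      have e2 : s(x, y) = s(e, a) → ¬ G.Adj x y := by
        intro h
        rw [← SimpleGraph.mem_edgeSet, h]
        exact hea
      have e3 : s(x, y) = s(a, b) → G.Adj x y := by
        intro h
        rw [← SimpleGraph.mem_edgeSet, h]
        exact hab
      have e4 : s(x, y) = s(c, e) → G.Adj x y := by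
        intro h
        rw [← SimpleGraph.mem_edgeSet, h]
        exact hce
      rw [Sym2.eq_swap (a := a) (b := e), Sym2.eq_swap (a := c) (b := b)]
      tauto
  · intro x
    rw [dg_symmDiff_trailGraph G 0 w 4 hw hinj, show w 0 = a from rfl, show w 4 = a from rfl]
    norm_num

/-- Three elements leave and at most two enter. -/
lemma card_lt_of_exchange {α : Type*} {D D' : Finset α} {p q r x y : α} (hp : p ∈ D)
    (hq : q ∈ D) (hr : r ∈ D) (hpq : p ≠ q) (hpr : p ≠ r) (hqr : q ≠ r)
    (h : ∀ z ∈ D', (z ∈ D ∧ z ≠ p ∧ z ≠ q ∧ z ≠ r) ∨ z = x ∨ z = y) : D'.card < D.card := by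
  have h1 : D' ⊆ (((D.erase p).erase q).erase r) ∪ {x, y} := by
    intro z hz
    simp only [Finset.mem_union, Finset.mem_erase, Finset.mem_insert, Finset.mem_singleton]
    have := h z hz
    tauto
  have h2 := (Finset.card_le_card h1).trans (Finset.card_union_le _ _)
  have h3 : ({x, y} : Finset α).card ≤ 2 := Finset.card_le_two
  rw [Finset.card_erase_of_mem, Finset.card_erase_of_mem, Finset.card_erase_of_mem hp] at h2
  · have h4 : ({p, q, r} : Finset α).card = 3 := Finset.card_eq_three.2 ⟨p, q, r, hpq, hpr, hqr, rfl⟩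
    have h5 : ({p, q, r} : Finset α) ⊆ D := by
      intro z hz
      simp only [Finset.mem_insert, Finset.mem_singleton] at hz
      rcases hz with rfl | rfl | rfl <;> assumption
    have := Finset.card_le_card h5
    omega
  · simp [hpq.symm, hq]
  · simp [hpr.symm, hqr.symm, hr]

/-- The three pairs of the path are repaired; only `(a, e)` and `(e, a)` can be newly spoiled. -/
lemma gdist_lt_of_exchange {A B K : SimpleGraph (Fin n)} {a b c e : Fin n} (hab : a ≠ b)
    (hac : a ≠ c) (hbc : b ≠ c) (h1 : ¬ (A.Adj a b ↔ B.Adj a b)) (h2 : ¬ (A.Adj b c ↔ B.Adj b c))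
    (h3 : ¬ (A.Adj c e ↔ B.Adj c e))
    (hK : ∀ x y, (s(x, y) = s(a, b) ∨ s(x, y) = s(b, c) ∨ s(x, y) = s(c, e)) →
      (K.Adj x y ↔ ¬ A.Adj x y))
    (hK' : ∀ x y, s(x, y) ≠ s(a, b) → s(x, y) ≠ s(b, c) → s(x, y) ≠ s(c, e) → s(x, y) ≠ s(e, a) →
      (K.Adj x y ↔ A.Adj x y)) : gdist K B < gdist A B := by
  have mem : ∀ (A B : SimpleGraph (Fin n)) x y, (x, y) ∈ (Finset.univ.filter fun p : Fin n × Fin n =>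
      adjFun A p ≠ adjFun B p) ↔ ¬ (A.Adj x y ↔ B.Adj x y) := by
    intro A B x y
    simp [adjFun]
  refine card_lt_of_exchange (p := (a, b)) (q := (b, c)) (r := (c, e)) (x := (a, e)) (y := (e, a))
    ((mem _ _ _ _).2 h1) ((mem _ _ _ _).2 h2) ((mem _ _ _ _).2 h3)
    (by simp [hab]) (by simp [hac]) (by simp [hbc]) ?_
  rintro ⟨x, y⟩ hz
  rw [mem] at hz
  rw [mem]
  by_cases h4 : s(x, y) = s(e, a)
  · right
    rcases Sym2.eq_iff.1 h4 with ⟨rfl, rfl⟩ | ⟨rfl, rfl⟩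
    · exact Or.inr rfl
    · exact Or.inl rfl
  left
  have key : ∀ p q, ¬ (A.Adj p q ↔ B.Adj p q) → (s(p, q) = s(a, b) ∨ s(p, q) = s(b, c) ∨
      s(p, q) = s(c, e)) → s(x, y) ≠ s(p, q) := by
    intro p q hpq hmem heq
    have hA : A.Adj x y ↔ A.Adj p q := by
      rw [← SimpleGraph.mem_edgeSet, heq, SimpleGraph.mem_edgeSet]
    have hB : B.Adj x y ↔ B.Adj p q := by
      rw [← SimpleGraph.mem_edgeSet, heq, SimpleGraph.mem_edgeSet]
    have hKA := hK x y (by rw [heq]; exact hmem)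
    rw [hKA, hA, hB] at hz
    clear * - hz hpq
    tauto
  have k1 := key a b h1 (Or.inl rfl)
  have k2 := key b c h2 (Or.inr (Or.inl rfl))
  have k3 := key c e h3 (Or.inr (Or.inr rfl))
  rw [hK' x y k1 k2 k3 h4] at hz
  exact ⟨hz, by rintro ⟨⟩; exact k1 rfl, by rintro ⟨⟩; exact k2 rfl, by rintro ⟨⟩; exact k3 rfl⟩

/-- A switch along three consecutive pairs that alternately belong to exactly one of `G`, `H`. -/
lemma exists_switch_of_path {G H : SimpleGraph (Fin n)} {a b c e : Fin n}
    (hab : G.Adj a b ∧ ¬ H.Adj a b) (hbc : H.Adj b c ∧ ¬ G.Adj b c)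
    (hce : G.Adj c e ∧ ¬ H.Adj c e) (hae : a ≠ e) (hgood : ¬ (G.Adj a e ∧ ¬ H.Adj a e)) :
    ∃ K, (IsSwitch G K ∧ (∀ x, dg K x = dg G x) ∧ gdist K H < gdist G H) ∨
      (IsSwitch H K ∧ (∀ x, dg K x = dg H x) ∧ gdist G K < gdist G H) := by
  have hac : a ≠ c := by rintro rfl; exact hbc.2 hab.1.symm
  have hbc' := hbc.1.ne
  -- If `ae` is not in `G`, the cycle `abce` alternates in `G`. If `ae` lies in both graphs, the
  -- cycle alternates in `H`.
  by_cases hG : G.Adj a e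
  · have hH : H.Adj a e := by
      by_contra h
      exact hgood ⟨hG, h⟩
    obtain ⟨K, hK, hdeg, hadj⟩ := exists_switch H (a := b) (b := c) (c := e) (e := a) hbc.1
      hce.2 hH.symm hab.2 hce.1.ne hab.1.ne
    refine ⟨K, Or.inr ⟨hK, hdeg, ?_⟩⟩
    rw [gdist_comm G, gdist_comm G]
    refine gdist_lt_of_exchange (a := a) (b := b) (c := c) (e := e) hab.1.ne hac hbc'
      (by simp [hab]) (by simp [hbc]) (by simp [hce]) ?_ ?_
    · rintro x y (h | h | h) <;> rw [hadj] <;> simp only [h, true_or, or_true, iff_true]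
    · intro x y k1 k2 k3 k4
      rw [hadj]
      simp only [k1, k2, k3, k4, or_self, iff_false, not_not]
  · obtain ⟨K, hK, hdeg, hadj⟩ := exists_switch G (a := a) (b := b) (c := c) (e := e) hab.1
      hbc.2 hce.1 (by rwa [G.adj_comm]) hbc' hae.symm
    refine ⟨K, Or.inl ⟨hK, hdeg, ?_⟩⟩
    refine gdist_lt_of_exchange (a := a) (b := b) (c := c) (e := e) hab.1.ne hac hbc'
      (by simp [hab]) (by simp [hbc]) (by simp [hce]) ?_ ?_
    · rintro x y (h | h | h) <;> rw [hadj] <;> simp only [h, true_or, or_true, iff_true]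
    · intro x y k1 k2 k3 k4
      rw [hadj]
      simp only [k1, k2, k3, k4, or_self, iff_false, not_not]

/-- The number of neighbours of `x` in `G` but not in `H`. -/
def surplus (G H : SimpleGraph (Fin n)) (x : Fin n) : ℕ :=
  (Finset.univ.filter fun y => G.Adj x y ∧ ¬ H.Adj x y).card

lemma surplus_comm {G H : SimpleGraph (Fin n)} (h : ∀ x, dg G x = dg H x) (x : Fin n) :
    surplus G H x = surplus H G x := by
  have h1 : (surplus G H x : ℤ) - surplus H G x = dg G x - dg H x := by
    unfold surplus dg
    rw [Finset.card_filter, Finset.card_filter]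
    push_cast
    rw [← Finset.sum_sub_distrib, ← Finset.sum_sub_distrib]
    refine Finset.sum_congr rfl fun y _ => ?_
    unfold ind
    by_cases h1 : G.Adj x y <;> by_cases h2 : H.Adj x y <;> simp [h1, h2]
  have := h x
  omega

/-- By `hbad` each vertex other than `x` that counts for `z` counts for `x`; if `x` counts for `z`,
then `z` counts for `x`. In addition `y` counts for `x` only. -/
lemma surplus_lt {G H : SimpleGraph (Fin n)} {x y z : Fin n}
    (hbad : ∀ a b c e, (G.Adj a b ∧ ¬ H.Adj a b) → (H.Adj b c ∧ ¬ G.Adj b c) →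
      (G.Adj c e ∧ ¬ H.Adj c e) → a ≠ e → (G.Adj a e ∧ ¬ H.Adj a e))
    (hxy : G.Adj x y ∧ ¬ H.Adj x y) (hyz : H.Adj y z ∧ ¬ G.Adj y z) :
    surplus G H z < surplus G H x := by
  have hy : y ∈ Finset.univ.filter fun y => G.Adj x y ∧ ¬ H.Adj x y := by simpa using hxy
  unfold surplus
  rw [← Finset.card_erase_add_one hy, Nat.lt_succ_iff]
  refine Finset.card_le_card_of_injOn (fun t => if t = x then z else t) ?_ ?_
  · intro t ht
    simp only [Finset.coe_filter, Finset.mem_univ, true_and, Set.mem_ofPred_eq] at ht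
    simp only [Finset.coe_erase, Finset.coe_filter, Finset.mem_univ, true_and, Set.mem_sdiff,
      Set.mem_ofPred_eq, Set.mem_singleton_iff]
    split_ifs with h
    · subst h
      refine ⟨?_, hyz.1.ne'⟩
      rw [G.adj_comm, H.adj_comm]
      exact ht
    · refine ⟨hbad x y z t hxy hyz ht (Ne.symm h), ?_⟩
      rintro rfl
      exact hyz.2 ht.1.symm
  · intro t ht t' ht' heq
    simp only [Finset.coe_filter, Finset.mem_univ, true_and, Set.mem_ofPred_eq] at ht ht'
    simp only at heq
    split_ifs at heq with h1 h2 h2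
    · rw [h1, h2]
    · subst heq
      exact absurd ht'.1 (G.irrefl)
    · subst heq
      exact absurd ht.1 (G.irrefl)
    · exact heq

/-- Two graphs with the same degrees can be brought closer by a switch in one of them. -/
theorem exists_switch_closer {G H : SimpleGraph (Fin n)} (hdeg : ∀ x, dg G x = dg H x)
    (hne : G ≠ H) :
    ∃ K, (IsSwitch G K ∧ (∀ x, dg K x = dg G x) ∧ gdist K H < gdist G H) ∨
      (IsSwitch H K ∧ (∀ x, dg K x = dg H x) ∧ gdist G K < gdist G H) := by
  by_contra hcon
  have hbad1 : ∀ a b c e, (G.Adj a b ∧ ¬ H.Adj a b) → (H.Adj b c ∧ ¬ G.Adj b c) →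
      (G.Adj c e ∧ ¬ H.Adj c e) → a ≠ e → (G.Adj a e ∧ ¬ H.Adj a e) := by
    intro a b c e h1 h2 h3 h4
    by_contra h5
    exact hcon (exists_switch_of_path h1 h2 h3 h4 h5)
  have hbad2 : ∀ a b c e, (H.Adj a b ∧ ¬ G.Adj a b) → (G.Adj b c ∧ ¬ H.Adj b c) →
      (H.Adj c e ∧ ¬ G.Adj c e) → a ≠ e → (H.Adj a e ∧ ¬ G.Adj a e) := by
    intro a b c e h1 h2 h3 h4
    by_contra h5
    obtain ⟨K, hK⟩ := exists_switch_of_path h1 h2 h3 h4 h5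
    rw [gdist_comm K, gdist_comm H, gdist_comm H] at hK
    exact hcon ⟨K, hK.symm⟩
  have pos : ∀ {A B : SimpleGraph (Fin n)} x, 0 < surplus A B x ↔ ∃ y, A.Adj x y ∧ ¬ B.Adj x y := by
    intro A B x
    unfold surplus
    rw [Finset.card_pos]
    simp [Finset.Nonempty]
  obtain ⟨x, hx⟩ : ∃ x, 0 < surplus G H x := by
    by_contra hno
    push Not at hno
    apply hne
    ext x y
    have h1 := (pos (A := G) (B := H) x).not.1 (by have := hno x; omega)
    have h2 := (pos (A := H) (B := G) x).not.1 (by have := hno x; rw [← surplus_comm hdeg]; omega)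
    push Not at h1 h2
    exact ⟨h1 y, h2 y⟩
  obtain ⟨y, hxy⟩ := (pos x).1 hx
  have hy : 0 < surplus G H y := (pos y).2 ⟨x, by rw [G.adj_comm, H.adj_comm]; exact hxy⟩
  rw [surplus_comm hdeg] at hy
  obtain ⟨z, hyz⟩ := (pos y).1 hy
  -- If no switch helps, the surplus decreases from `x` to `z`, and, with `G` and `H` interchanged,
  -- from `z` to `x`. Both surpluses agree as the degrees do.
  have h1 := surplus_lt hbad1 hxy hyz
  have h2 := surplus_lt (x := z) (y := y) (z := x) hbad2 (by rw [G.adj_comm, H.adj_comm]; exact hyz)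
    (by rw [G.adj_comm, H.adj_comm]; exact hxy)
  rw [← surplus_comm hdeg, ← surplus_comm hdeg] at h2
  omega

end switches

end
end FullyGraphic

namespace FullyGraphic
open scoped Classical symmDiff
noncomputable section

/-! ### Comparing close pairs of realizations with switches -/

section comparison

variable {n : ℕ} {d : Fin n → ℕ}

/-- The sum of the squared differences of `f` over all ordered pairs related by `r`. -/
def pairSum {Ω : Type*} [Fintype Ω] (r : Ω → Ω → Prop) (f : Ω → ℝ) : ℝ :=
  ∑ x, ∑ y, if r x y then (f x - f y) ^ 2 else 0

lemma pairSum_nonneg {Ω : Type*} [Fintype Ω] (r : Ω → Ω → Prop) (f : Ω → ℝ) : 0 ≤ pairSum r f :=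
  Finset.sum_nonneg fun x _ => Finset.sum_nonneg fun y _ => by split_ifs <;> positivity

/-- A composition of a relation `r` with a relation `s` to few elements. -/
lemma sum_comp_le {Ω : Type*} [Fintype Ω] (r s : Ω → Ω → Prop) (f : Ω → ℝ) (N : ℕ)
    (hN : ∀ x, (Finset.univ.filter fun z => s x z).card ≤ N) :
    ∑ x, ∑ y, ∑ z, (if r x y ∧ s x z then (f x - f y) ^ 2 else 0) ≤ N * pairSum r f := by
  unfold pairSum
  rw [Finset.mul_sum]
  refine Finset.sum_le_sum fun x _ => ?_
  rw [Finset.mul_sum]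
  refine Finset.sum_le_sum fun y _ => ?_
  by_cases h : r x y
  · simp only [h, true_and, if_true]
    rw [← Finset.sum_filter, Finset.sum_const, nsmul_eq_mul]
    exact mul_le_mul_of_nonneg_right (by exact_mod_cast hN x) (sq_nonneg _)
  · simp [h]

/-- The relation between realizations that are a switch apart. -/
def switchRel (G H : Realization d) : Prop := IsSwitch G.1 H.1

/-- The relation between realizations that differ on at most `c` ordered pairs. -/
def nearRel (c : ℕ) (G H : Realization d) : Prop := gdist G.1 H.1 ≤ c

lemma card_nearRel_le (c : ℕ) (G : Realization d) :
    (Finset.univ.filter fun H => nearRel c G H).card ≤ (2 * n ^ 2 + 1) ^ c := by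
  have h := card_gdist_ball_le G.1 c ((Finset.univ.filter fun H => nearRel c G H).image Subtype.val) (by
    intro H hH
    obtain ⟨K, hK, rfl⟩ := Finset.mem_image.1 hH
    exact (Finset.mem_filter.1 hK).2)
  rwa [Finset.card_image_of_injective _ Subtype.val_injective, Fintype.card_fin] at h

lemma card_switchRel_le (G : Realization d) :
    (Finset.univ.filter fun H => switchRel G H).card ≤ (2 * n ^ 2 + 1) ^ 8 := by
  refine le_trans (Finset.card_le_card ?_) (card_nearRel_le 8 G)
  intro H hH
  rw [Finset.mem_filter] at *
  exact ⟨Finset.mem_univ _, IsSwitch.gdist_le hH.2⟩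

/-- A pair at distance at most `c + 1` splits, at one of its ends, into a switch and a pair at
distance at most `c`. A switch serves at most a ball of pairs, and a close pair at most as many as
there are switches; the rest is `(a + b)² ≤ 2a² + 2b²`. -/
lemma pairSum_near_succ_le (c : ℕ) (f : Realization d → ℝ) :
    pairSum (nearRel (c + 1)) f ≤ 4 * (2 * n ^ 2 + 1 : ℕ) ^ (c + 1) * pairSum switchRel f
      + 4 * (2 * n ^ 2 + 1 : ℕ) ^ 8 * pairSum (nearRel c) f := by
  -- `S` carries the switch and `T` the shorter pair; the third argument remembers the remaining end
  -- of the original pair.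
  let S : Realization d → Realization d → Realization d → ℝ := fun x y z =>
    (if switchRel x y ∧ nearRel (c + 1) x z then (f x - f y) ^ 2 else 0)
  let T : Realization d → Realization d → Realization d → ℝ := fun x y z =>
    (if nearRel c x y ∧ switchRel x z then (f x - f y) ^ 2 else 0)
  have hS0 : ∀ x y z, 0 ≤ S x y z := fun x y z => by simp only [S]; split_ifs <;> positivity
  have hT0 : ∀ x y z, 0 ≤ T x y z := fun x y z => by simp only [T]; split_ifs <;> positivity
  have hcomm : ∀ (c : ℕ) (x y : Realization d), nearRel c x y → nearRel c y x := by
    intro c x y h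
    unfold nearRel at *
    rwa [gdist_comm]
  have hS := sum_comp_le switchRel (nearRel (c + 1)) f _ (card_nearRel_le (d := d) (c + 1))
  have hT := sum_comp_le (nearRel c) switchRel f _ (card_switchRel_le (d := d))
  have key : ∀ G H : Realization d, (if nearRel (c + 1) G H then (f G - f H) ^ 2 else 0)
      ≤ ∑ K, (2 * S G K H + 2 * T K H G + 2 * S H K G + 2 * T K G H) := by
    intro G H
    have hnn : ∀ K, 0 ≤ 2 * S G K H + 2 * T K H G + 2 * S H K G + 2 * T K G H := by
      intro K
      have := hS0 G K H
      have := hT0 K H G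
      have := hS0 H K G
      have := hT0 K G H
      linarith
    split_ifs with h
    · by_cases hne : G = H
      · subst hne
        simpa using Finset.sum_nonneg fun K (_ : K ∈ Finset.univ) => hnn K
      · obtain ⟨K, hK⟩ := exists_switch_closer (G := G.1) (H := H.1)
          (fun x => by rw [realization_dg, realization_dg]) (fun h => hne (Subtype.ext h))
        have hKdeg : ∀ x, dg K x = d x := by
          intro x
          rcases hK with ⟨-, hK, -⟩ | ⟨-, hK, -⟩ <;> rw [hK, realization_dg]
        let K' : Realization d := Realization.mk' K hKdeg
        refine le_trans ?_ (Finset.single_le_sum (fun K _ => hnn K) (Finset.mem_univ K'))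
        have h1 := hS0 G K' H
        have h2 := hT0 K' H G
        have h3 := hS0 H K' G
        have h4 := hT0 K' G H
        unfold nearRel at h
        rcases hK with ⟨hsw, -, hlt⟩ | ⟨hsw, -, hlt⟩
        · have e1 : S G K' H = (f G - f K') ^ 2 := if_pos ⟨hsw, h⟩
          have e2 : T K' H G = (f K' - f H) ^ 2 :=
            if_pos ⟨show gdist K H.1 ≤ c by omega, hsw.symm⟩
          rw [e1, e2]
          nlinarith [sq_nonneg ((f G - f K') - (f K' - f H))]
        · have e1 : S H K' G = (f H - f K') ^ 2 := if_pos ⟨hsw, hcomm _ _ _ h⟩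
          have e2 : T K' G H = (f K' - f G) ^ 2 :=
            if_pos ⟨show gdist K G.1 ≤ c by rw [gdist_comm]; omega, hsw.symm⟩
          rw [e1, e2]
          nlinarith [sq_nonneg ((f H - f K') - (f K' - f G))]
    · exact Finset.sum_nonneg fun K _ => hnn K
  have hsum : pairSum (nearRel (c + 1)) f ≤
      ∑ G, ∑ H, ∑ K, (2 * S G K H + 2 * T K H G + 2 * S H K G + 2 * T K G H) :=
    Finset.sum_le_sum fun G _ => Finset.sum_le_sum fun H _ => key G H
  simp only [Finset.sum_add_distrib, ← Finset.mul_sum] at hsum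
  have r1 : ∑ G, ∑ H, ∑ K, S G K H = ∑ G, ∑ K, ∑ H, S G K H :=
    Finset.sum_congr rfl fun G _ => Finset.sum_comm
  have r2 : ∑ G, ∑ H, ∑ K, T K H G = ∑ K, ∑ H, ∑ G, T K H G := by
    rw [Finset.sum_comm]
    rw [Finset.sum_congr rfl fun H _ => Finset.sum_comm]
    rw [Finset.sum_comm]
  have r3 : ∑ G, ∑ H, ∑ K, S H K G = ∑ H, ∑ K, ∑ G, S H K G := by
    rw [Finset.sum_comm]
    exact Finset.sum_congr rfl fun H _ => Finset.sum_comm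
  have r4 : ∑ G, ∑ H, ∑ K, T K G H = ∑ K, ∑ G, ∑ H, T K G H := by
    rw [Finset.sum_congr rfl fun G _ => Finset.sum_comm]
    rw [Finset.sum_comm]
  rw [r1, r2, r3, r4] at hsum
  push_cast at hS hT ⊢
  simp only [S, T] at hsum
  linarith

/-- Sums over pairs of close realizations are dominated by the sum over switches. -/
theorem pairSum_near_le (c : ℕ) (f : Realization d → ℝ) :
    pairSum (nearRel c) f ≤ (8 * (2 * n ^ 2 + 1) ^ 8 : ℕ) ^ c * pairSum switchRel f := by
  induction c with
  | zero =>
    have : pairSum (nearRel 0) f = 0 := by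
      unfold pairSum
      refine Finset.sum_eq_zero fun G _ => Finset.sum_eq_zero fun H _ => ?_
      split_ifs with h
      · unfold nearRel at h
        rw [Nat.le_zero, gdist_eq_zero] at h
        rw [Subtype.ext h]
        simp
      · rfl
    rw [this]
    have := pairSum_nonneg (switchRel (d := d)) f
    positivity
  | succ c ih =>
    refine (pairSum_near_succ_le c f).trans ?_
    have h0 := pairSum_nonneg (switchRel (d := d)) f
    set b : ℝ := ((2 * n ^ 2 + 1 : ℕ) : ℝ) with hb
    have hb1 : 1 ≤ b := by
      rw [hb]
      exact_mod_cast Nat.le_add_left 1 _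
    have e : ((8 * (2 * n ^ 2 + 1) ^ 8 : ℕ) : ℝ) = 8 * b ^ 8 := by rw [hb]; push_cast; ring
    rw [e] at ih ⊢
    have h1 : b ^ (c + 1) ≤ b ^ 8 * (8 * b ^ 8) ^ c := by
      have h2 : b ^ c ≤ (8 * b ^ 8) ^ c := by
        refine pow_le_pow_left₀ (by positivity) ?_ c
        have : b ^ 1 ≤ b ^ 8 := pow_le_pow_right₀ hb1 (by norm_num)
        nlinarith
      have h3 : b ≤ b ^ 8 := by
        have : b ^ 1 ≤ b ^ 8 := pow_le_pow_right₀ hb1 (by norm_num)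
        simpa using this
      calc b ^ (c + 1) = b * b ^ c := by ring
        _ ≤ b ^ 8 * (8 * b ^ 8) ^ c := by gcongr
    have h4 : b ^ (c + 1) * pairSum switchRel f ≤ b ^ 8 * (8 * b ^ 8) ^ c * pairSum switchRel f :=
      mul_le_mul_of_nonneg_right h1 h0
    have h5 : b ^ 8 * pairSum (nearRel c) f ≤ b ^ 8 * ((8 * b ^ 8) ^ c * pairSum switchRel f) :=
      mul_le_mul_of_nonneg_left ih (by positivity)
    have h6 : (8 * b ^ 8) ^ (c + 1) = 8 * (b ^ 8 * (8 * b ^ 8) ^ c) := by ring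
    rw [h6]
    linarith

end comparison

end
end FullyGraphic

namespace FullyGraphic
open scoped Classical symmDiff
noncomputable section

/-! ### Exchanging two perfect matchings component by component -/

section matchings

variable {X : Type*}

/-- A matching along a relation `Γ`, as an involution whose fixed points are the unmatched
elements. -/
def IsMatching (Γ : X → X → Prop) (m : X → X) : Prop :=
  (∀ x, m (m x) = x) ∧ ∀ x, m x ≠ x → Γ x (m x)

lemma hammingDist_le_three [Fintype X] [DecidableEq X] {f g : X → X} {a b c : X}
    (h : ∀ x, x ≠ a → x ≠ b → x ≠ c → f x = g x) : hammingDist f g ≤ 3 := by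
  have : (Finset.univ.filter fun x => f x ≠ g x) ⊆ {a, b, c} := by
    intro x hx
    simp only [Finset.mem_filter, Finset.mem_univ, true_and] at hx
    simp only [Finset.mem_insert, Finset.mem_singleton]
    by_contra! hcon
    exact hx (h x hcon.1 hcon.2.1 hcon.2.2)
  exact (Finset.card_le_card this).trans Finset.card_le_three

/-- The function that agrees with `M'` on `A` and with `M` elsewhere. -/
def mix (A : Set X) (M M' : X → X) (x : X) : X := if x ∈ A then M' x else M x

lemma mix_mix (A : Set X) (M M' : X → X) : mix A (mix A M M') (mix A M' M) = M := by
  funext x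
  unfold mix
  split_ifs <;> rfl

lemma IsMatching.mix {Γ : X → X → Prop} {M M' : X → X} (hM : IsMatching Γ M)
    (hM' : IsMatching Γ M') {A : Set X} (hA : ∀ x ∈ A, M x ∈ A) (hA' : ∀ x ∈ A, M' x ∈ A) :
    IsMatching Γ (mix A M M') := by
  refine ⟨fun x => ?_, fun x => ?_⟩
  · unfold FullyGraphic.mix
    by_cases hx : x ∈ A
    · rw [if_pos hx, if_pos (hA' x hx), hM'.1]
    · have : M x ∉ A := fun h => hx (by simpa [hM.1] using hA _ h)
      rw [if_neg hx, if_neg this, hM.1]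
  · unfold FullyGraphic.mix
    split_ifs
    · exact hM'.2 x
    · exact hM.2 x

/-- Elements connected by steps along `M` or `M'`. -/
def orb (M M' : X → X) : X → X → Prop := Relation.ReflTransGen fun p q => q = M p ∨ q = M' p

/-- At each element the two matchings are at most interchanged. So a mixed pair has the old
components, and with `mix_mix` mixing on some of them is an involution on pairs. -/
lemma orb_mix (A : Set X) (M M' : X → X) : orb (mix A M M') (mix A M' M) = orb M M' := by
  unfold orb
  congr 1
  funext p q
  unfold mix
  split_ifs
  · exact propext or_comm
  · rfl

lemma orb_left {M M' : X → X} {x y : X} (h : orb M M' x y) : orb M M' x (M y) :=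
  Relation.ReflTransGen.tail h (Or.inl rfl)

lemma orb_right {M M' : X → X} {x y : X} (h : orb M M' x y) : orb M M' x (M' y) :=
  Relation.ReflTransGen.tail h (Or.inr rfl)

lemma orb_symm {M M' : X → X} (hM : ∀ x, M (M x) = x) (hM' : ∀ x, M' (M' x) = x) {x y : X}
    (h : orb M M' x y) : orb M M' y x := by
  induction h with
  | refl => exact Relation.ReflTransGen.refl
  | tail _ hs ih =>
    refine Relation.ReflTransGen.head ?_ ih
    rcases hs with rfl | rfl
    · exact Or.inl (hM _).symm
    · exact Or.inr (hM' _).symm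

/-- The elements that are connected to one of the first `t` elements. -/
def initialOrb [Fintype X] (M M' : X → X) (t : ℕ) : Set X :=
  {y | ∃ s, (Fintype.equivFin X s).val < t ∧ orb M M' s y}

lemma initialOrb_mix [Fintype X] (A : Set X) (M M' : X → X) (t : ℕ) :
    initialOrb (mix A M M') (mix A M' M) t = initialOrb M M' t := by
  unfold initialOrb
  rw [orb_mix]

section perfect

variable [Fintype X]

/-- The perfect matchings along `Γ`. -/
def perfectMatchings (Γ : X → X → Prop) : Finset (X → X) :=
  Finset.univ.filter fun m => IsMatching Γ m ∧ ∀ x, m x ≠ x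

/-- The matchings along `Γ` that are perfect or leave exactly two elements unmatched. -/
def nearPerfectMatchings (Γ : X → X → Prop) : Finset (X → X) :=
  Finset.univ.filter fun m => IsMatching Γ m ∧
    ((∀ x, m x ≠ x) ∨ ∃ a b, a ≠ b ∧ ∀ x, m x = x ↔ x = a ∨ x = b)

lemma mem_perfectMatchings {Γ : X → X → Prop} {m : X → X} :
    m ∈ perfectMatchings Γ ↔ IsMatching Γ m ∧ ∀ x, m x ≠ x := by
  simp [perfectMatchings]

lemma mem_nearPerfectMatchings {Γ : X → X → Prop} {m : X → X} :
    m ∈ nearPerfectMatchings Γ ↔ IsMatching Γ m ∧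
      ((∀ x, m x ≠ x) ∨ ∃ a b, a ≠ b ∧ ∀ x, m x = x ↔ x = a ∨ x = b) := by
  simp [nearPerfectMatchings]

lemma perfectMatchings_subset (Γ : X → X → Prop) :
    perfectMatchings Γ ⊆ nearPerfectMatchings Γ := by
  intro m hm
  rw [mem_perfectMatchings] at hm
  exact mem_nearPerfectMatchings.2 ⟨hm.1, Or.inl hm.2⟩

variable {Γ : X → X → Prop}

lemma mix_mem_perfectMatchings {M M' : X → X} (hM : M ∈ perfectMatchings Γ)
    (hM' : M' ∈ perfectMatchings Γ) {A : Set X} (hA : ∀ x ∈ A, M x ∈ A)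
    (hA' : ∀ x ∈ A, M' x ∈ A) : mix A M M' ∈ perfectMatchings Γ := by
  rw [mem_perfectMatchings] at *
  refine ⟨hM.1.mix hM'.1 hA hA', fun x => ?_⟩
  unfold mix
  split_ifs
  · exact hM'.2 x
  · exact hM.2 x

lemma initialOrb_left {M M' : X → X} {t : ℕ} {x : X} (h : x ∈ initialOrb M M' t) :
    M x ∈ initialOrb M M' t := by
  obtain ⟨s, hs, h⟩ := h
  exact ⟨s, hs, orb_left h⟩

lemma initialOrb_right {M M' : X → X} {t : ℕ} {x : X} (h : x ∈ initialOrb M M' t) :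
    M' x ∈ initialOrb M M' t := by
  obtain ⟨s, hs, h⟩ := h
  exact ⟨s, hs, orb_right h⟩

/-- Exchanging two perfect matchings on one component. -/
def swapOrb (M M' : X → X) (x : X) : X → X := mix {y | orb M M' x y} M M'

/-- The next element lies in a component that has already been exchanged, or opens a new one. -/
lemma mix_initialOrb_succ {M M' : X → X} (hM : ∀ x, M (M x) = x) (hM' : ∀ x, M' (M' x) = x)
    {t : ℕ} (ht : t < Fintype.card X) :
    mix (initialOrb M M' (t + 1)) M M' = mix (initialOrb M M' t) M M' ∨
    mix (initialOrb M M' (t + 1)) M M' =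
      swapOrb (mix (initialOrb M M' t) M M') (mix (initialOrb M M' t) M' M)
        ((Fintype.equivFin X).symm ⟨t, ht⟩) := by
  set x := (Fintype.equivFin X).symm ⟨t, ht⟩ with hx
  have hsucc : ∀ y, y ∈ initialOrb M M' (t + 1) ↔ y ∈ initialOrb M M' t ∨ orb M M' x y := by
    intro y
    constructor
    · rintro ⟨s, hs, h⟩
      rcases Nat.lt_succ_iff_lt_or_eq.1 hs with hs | hs
      · exact Or.inl ⟨s, hs, h⟩
      · right
        have : s = x := by
          rw [hx, Equiv.eq_symm_apply]
          exact Fin.ext hs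
        rwa [← this]
    · rintro (⟨s, hs, h⟩ | h)
      · exact ⟨s, by omega, h⟩
      · exact ⟨x, by simp [hx], h⟩
  by_cases hxt : x ∈ initialOrb M M' t
  · left
    congr 1
    ext y
    rw [hsucc]
    refine ⟨?_, Or.inl⟩
    rintro (h | h)
    · exact h
    · obtain ⟨s, hs, hsx⟩ := hxt
      exact ⟨s, hs, Relation.ReflTransGen.trans hsx h⟩
  · right
    funext y
    unfold swapOrb
    rw [orb_mix]
    have hd : orb M M' x y → y ∉ initialOrb M M' t := by
      rintro h ⟨s, hs, hsy⟩
      exact hxt ⟨s, hs, Relation.ReflTransGen.trans hsy (orb_symm hM hM' h)⟩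
    have := hsucc y
    by_cases h1 : orb M M' x y
    · have h2 := hd h1
      have h3 := this.2 (Or.inr h1)
      simp [mix, h1, h2, h3]
    · by_cases h2 : y ∈ initialOrb M M' t
      · have h3 := this.2 (Or.inl h2)
        simp [mix, h1, h2, h3]
      · have h3 : y ∉ initialOrb M M' (t + 1) := fun h => (this.1 h).elim h2 h1
        simp [mix, h1, h2, h3]

/-- Differences between perfect matchings are controlled by exchanges on single components. -/
lemma sum_perfect_sq_le (F : (X → X) → ℝ) :
    ∑ p ∈ perfectMatchings Γ ×ˢ perfectMatchings Γ, (F p.1 - F p.2) ^ 2 ≤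
      (Fintype.card X : ℝ) ^ 2 * ∑ x, ∑ p ∈ perfectMatchings Γ ×ˢ perfectMatchings Γ,
        (F p.1 - F (swapOrb p.1 p.2 x)) ^ 2 := by
  set N := Fintype.card X with hN
  set S := ∑ x, ∑ p ∈ perfectMatchings Γ ×ˢ perfectMatchings Γ,
        (F p.1 - F (swapOrb p.1 p.2 x)) ^ 2 with hS
  have htel : ∀ p : (X → X) × (X → X), (F p.1 - F p.2) ^ 2 ≤ N * ∑ t ∈ Finset.range N,
      (F (mix (initialOrb p.1 p.2 t) p.1 p.2) - F (mix (initialOrb p.1 p.2 (t + 1)) p.1 p.2)) ^ 2 := by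
    rintro ⟨M, M'⟩
    have h0 : mix (initialOrb M M' 0) M M' = M := by
      funext x
      simp [mix, initialOrb]
    have h1 : mix (initialOrb M M' N) M M' = M' := by
      funext x
      have : x ∈ initialOrb M M' N := ⟨x, Fin.is_lt _, Relation.ReflTransGen.refl⟩
      simp [mix, this]
    have h2 := Finset.sum_range_sub' (fun t => F (mix (initialOrb M M' t) M M')) N
    rw [h0, h1] at h2
    have h3 := sq_sum_le_card_mul_sum_sq (s := Finset.range N) (f := fun t =>
      F (mix (initialOrb M M' t) M M') - F (mix (initialOrb M M' (t + 1)) M M'))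
    rw [h2, Finset.card_range] at h3
    exact h3
  have hstep : ∀ t ∈ Finset.range N, ∑ p ∈ perfectMatchings Γ ×ˢ perfectMatchings Γ,
      (F (mix (initialOrb p.1 p.2 t) p.1 p.2) - F (mix (initialOrb p.1 p.2 (t + 1)) p.1 p.2)) ^ 2
        ≤ S := by
    intro t ht
    rw [Finset.mem_range] at ht
    let x := (Fintype.equivFin X).symm ⟨t, ht⟩
    have hb : ∑ p ∈ perfectMatchings Γ ×ˢ perfectMatchings Γ,
        (F (mix (initialOrb p.1 p.2 t) p.1 p.2) - F (mix (initialOrb p.1 p.2 (t + 1)) p.1 p.2)) ^ 2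
        ≤ ∑ p ∈ perfectMatchings Γ ×ˢ perfectMatchings Γ,
          (F (mix (initialOrb p.1 p.2 t) p.1 p.2) - F (swapOrb (mix (initialOrb p.1 p.2 t) p.1 p.2)
            (mix (initialOrb p.1 p.2 t) p.2 p.1) x)) ^ 2 := by
      refine Finset.sum_le_sum fun p hp => ?_
      rw [Finset.mem_product, mem_perfectMatchings, mem_perfectMatchings] at hp
      rcases mix_initialOrb_succ hp.1.1.1 hp.2.1.1 ht with h | h
      · rw [h, sub_self, zero_pow two_ne_zero]
        positivity
      · rw [h]
    refine hb.trans ?_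
    -- For fixed `t` the passage to the intermediate pair is an involution on pairs of perfect
    -- matchings. So step `t`, summed over all pairs, costs no more than exchanging one component of
    -- the original pair.
    let φ : (X → X) × (X → X) → (X → X) × (X → X) := fun p =>
      (mix (initialOrb p.1 p.2 t) p.1 p.2, mix (initialOrb p.1 p.2 t) p.2 p.1)
    have hφφ : ∀ p, φ (φ p) = p := by
      rintro ⟨M, M'⟩
      simp only [φ, initialOrb_mix, mix_mix]
    have hφm : ∀ p ∈ perfectMatchings Γ ×ˢ perfectMatchings Γ,
        φ p ∈ perfectMatchings Γ ×ˢ perfectMatchings Γ := by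
      intro p hp
      rw [Finset.mem_product] at hp ⊢
      exact ⟨mix_mem_perfectMatchings hp.1 hp.2 (fun _ => initialOrb_left)
        (fun _ => initialOrb_right), mix_mem_perfectMatchings hp.2 hp.1
        (fun _ => initialOrb_right) (fun _ => initialOrb_left)⟩
    have he : ∑ p ∈ perfectMatchings Γ ×ˢ perfectMatchings Γ,
          (F (mix (initialOrb p.1 p.2 t) p.1 p.2) - F (swapOrb (mix (initialOrb p.1 p.2 t) p.1 p.2)
            (mix (initialOrb p.1 p.2 t) p.2 p.1) x)) ^ 2 =
        ∑ p ∈ perfectMatchings Γ ×ˢ perfectMatchings Γ, (F p.1 - F (swapOrb p.1 p.2 x)) ^ 2 :=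
      Finset.sum_nbij' φ φ hφm hφm (fun p _ => hφφ p) (fun p _ => hφφ p) (fun p _ => rfl)
    rw [he]
    exact Finset.single_le_sum (f := fun x => ∑ p ∈ perfectMatchings Γ ×ˢ perfectMatchings Γ,
      (F p.1 - F (swapOrb p.1 p.2 x)) ^ 2) (fun x _ => Finset.sum_nonneg fun p _ => sq_nonneg _)
      (Finset.mem_univ x)
  calc _ ≤ ∑ p ∈ perfectMatchings Γ ×ˢ perfectMatchings Γ, (N : ℝ) * ∑ t ∈ Finset.range N,
      (F (mix (initialOrb p.1 p.2 t) p.1 p.2) - F (mix (initialOrb p.1 p.2 (t + 1)) p.1 p.2)) ^ 2 :=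
        Finset.sum_le_sum fun p _ => htel p
    _ = N * ∑ t ∈ Finset.range N, ∑ p ∈ perfectMatchings Γ ×ˢ perfectMatchings Γ,
      (F (mix (initialOrb p.1 p.2 t) p.1 p.2) - F (mix (initialOrb p.1 p.2 (t + 1)) p.1 p.2)) ^ 2 := by
        rw [← Finset.mul_sum, Finset.sum_comm]
    _ ≤ N * (N * S) := by
        refine mul_le_mul_of_nonneg_left ?_ (Nat.cast_nonneg _)
        refine (Finset.sum_le_sum hstep).trans ?_
        simp
    _ = N ^ 2 * S := by ring

end perfect

end matchings

end
end FullyGraphic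

namespace FullyGraphic
open scoped Classical symmDiff
noncomputable section

/-! ### Alternating cycles and paths of two perfect matchings -/

section alternating

variable {X : Type*}

/-- The sequence obtained from `x` by applying `f` and `g` alternately, starting with `f`. -/
def altIter (f g : X → X) (x : X) : ℕ → X
  | 0 => x
  | t + 1 => if Even t then f (altIter f g x t) else g (altIter f g x t)

lemma altIter_succ_even {f g : X → X} {x : X} {t : ℕ} (h : Even t) :
    altIter f g x (t + 1) = f (altIter f g x t) := by
  rw [altIter, if_pos h]

lemma altIter_succ_odd {f g : X → X} {x : X} {t : ℕ} (h : ¬ Even t) :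
    altIter f g x (t + 1) = g (altIter f g x t) := by
  rw [altIter, if_neg h]

variable {M M' : X → X} {x : X}

lemma apply_left_altIter (hM : ∀ x, M (M x) = x) {t : ℕ} (h : Even t) :
    M (altIter M M' x (t + 1)) = altIter M M' x t := by
  rw [altIter_succ_even h, hM]

lemma apply_right_altIter (hM' : ∀ x, M' (M' x) = x) {t : ℕ} (h : ¬ Even t) :
    M' (altIter M M' x (t + 1)) = altIter M M' x t := by
  rw [altIter_succ_odd h, hM']

/-- Since `c` is even, both elements arose from the same involution, which takes the coincidence one
step back. -/
lemma altIter_eq_of_add (hM : ∀ x, M (M x) = x) (hM' : ∀ x, M' (M' x) = x) {a c : ℕ}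
    (hc : Even c) (h : altIter M M' x a = altIter M M' x (a + c)) :
    altIter M M' x 0 = altIter M M' x c := by
  induction a with
  | zero => simpa using h
  | succ a ih =>
    apply ih
    rw [show a + 1 + c = a + c + 1 by ring] at h
    by_cases ha : Even a
    · have hac : Even (a + c) := ha.add hc
      rw [← apply_left_altIter (x := x) (M' := M') hM ha, h, apply_left_altIter hM hac]
    · have hac : ¬ Even (a + c) := by
        rw [Nat.even_add]
        tauto
      rw [← apply_right_altIter (x := x) (M := M) hM' ha, h, apply_right_altIter hM' hac]

/-- A coincidence at odd distance shrinks by one step at both ends until it becomes a fixed point of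
`M` or `M'`. -/
lemma altIter_ne_of_odd (hM : ∀ x, M (M x) = x) (hM' : ∀ x, M' (M' x) = x)
    (hf : ∀ x, M x ≠ x) (hf' : ∀ x, M' x ≠ x) (r : ℕ) (a : ℕ) :
    altIter M M' x a ≠ altIter M M' x (a + (2 * r + 1)) := by
  induction r generalizing a with
  | zero =>
    by_cases ha : Even a
    · rw [Nat.mul_zero, Nat.zero_add, altIter_succ_even ha]
      exact (hf _).symm
    · rw [Nat.mul_zero, Nat.zero_add, altIter_succ_odd ha]
      exact (hf' _).symm
  | succ r ih =>
    intro h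
    apply ih (a + 1)
    rw [show a + 1 + (2 * r + 1) = a + 2 * (r + 1) by ring]
    rw [show a + (2 * (r + 1) + 1) = a + 2 * (r + 1) + 1 by ring] at h
    by_cases ha : Even a
    · have hb : Even (a + 2 * (r + 1)) := ha.add (even_two_mul _)
      rw [altIter_succ_even ha, h, apply_left_altIter hM hb]
    · have hb : ¬ Even (a + 2 * (r + 1)) := by
        rw [Nat.even_add]
        have := even_two_mul (r + 1)
        tauto
      rw [altIter_succ_odd ha, h, apply_right_altIter hM' hb]

lemma exists_altIter_period [Finite X] (hM : ∀ x, M (M x) = x) (hM' : ∀ x, M' (M' x) = x) :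
    ∃ k, 0 < k ∧ altIter M M' x 0 = altIter M M' x (2 * k) := by
  obtain ⟨a, b, hab, h⟩ := Finite.exists_ne_map_eq_of_infinite fun t => altIter M M' x (2 * t)
  wlog hlt : a < b generalizing a b
  · exact this b a hab.symm h.symm (by omega)
  · refine ⟨b - a, by omega, altIter_eq_of_add (a := 2 * a) hM hM' (even_two_mul _) ?_⟩
    rw [show 2 * a + 2 * (b - a) = 2 * b by omega]
    exact h

/-- Half the length of the alternating cycle through `x`. -/
def halfPeriod (M M' : X → X) (x : X) : ℕ :=
  if h : ∃ k, 0 < k ∧ altIter M M' x 0 = altIter M M' x (2 * k) then Nat.find h else 0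

section period

variable [Finite X]

lemma halfPeriod_spec (hM : ∀ x, M (M x) = x) (hM' : ∀ x, M' (M' x) = x) :
    0 < halfPeriod M M' x ∧ altIter M M' x 0 = altIter M M' x (2 * halfPeriod M M' x) := by
  have h := exists_altIter_period (x := x) hM hM'
  unfold halfPeriod
  rw [dif_pos h]
  exact Nat.find_spec h

lemma halfPeriod_min (hM : ∀ x, M (M x) = x) (hM' : ∀ x, M' (M' x) = x) {k : ℕ} (hk : 0 < k)
    (h : altIter M M' x 0 = altIter M M' x (2 * k)) : halfPeriod M M' x ≤ k := by
  have h' := exists_altIter_period (x := x) hM hM'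
  unfold halfPeriod
  rw [dif_pos h']
  exact Nat.find_min' h' ⟨hk, h⟩

lemma altIter_injOn (hM : ∀ x, M (M x) = x) (hM' : ∀ x, M' (M' x) = x)
    (hf : ∀ x, M x ≠ x) (hf' : ∀ x, M' x ≠ x) {a b : ℕ} (ha : a < 2 * halfPeriod M M' x)
    (hb : b < 2 * halfPeriod M M' x) (h : altIter M M' x a = altIter M M' x b) : a = b := by
  wlog hab : a ≤ b generalizing a b
  · exact (this hb ha h.symm (by omega)).symm
  · by_contra hne
    obtain ⟨c, rfl⟩ := Nat.exists_eq_add_of_le hab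
    rcases Nat.even_or_odd' c with ⟨r, rfl | rfl⟩
    · have := altIter_eq_of_add hM hM' (even_two_mul r) h
      have := halfPeriod_min hM hM' (by omega) this
      omega
    · exact altIter_ne_of_odd hM hM' hf hf' r a h

lemma halfPeriod_le {X : Type*} [Fintype X] {M M' : X → X} {x : X} (hM : ∀ x, M (M x) = x)
    (hM' : ∀ x, M' (M' x) = x) (hf : ∀ x, M x ≠ x) (hf' : ∀ x, M' x ≠ x) :
    halfPeriod M M' x ≤ Fintype.card X := by
  have := Finset.card_le_card_of_injOn (s := Finset.range (halfPeriod M M' x))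
    (t := (Finset.univ : Finset X)) (fun t => altIter M M' x (2 * t)) (by simp) (by
      intro a ha b hb h
      rw [Finset.coe_range, Set.mem_Iio] at ha hb
      have := altIter_injOn hM hM' hf hf' (by omega) (by omega) h
      omega)
  simpa using this

end period

/-- The inner part `x₁, …, x₂ⱼ` of the alternating path. -/
def innerPath (M M' : X → X) (x : X) (j : ℕ) : Set X :=
  {y | ∃ t, 1 ≤ t ∧ t ≤ 2 * j ∧ altIter M M' x t = y}

/-- The alternating path `x₀, …, x₂ⱼ₊₁`. -/
def outerPath (M M' : X → X) (x : X) (j : ℕ) : Set X :=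
  {y | ∃ t, t ≤ 2 * j + 1 ∧ altIter M M' x t = y}

lemma innerPath_closed (hM' : ∀ x, M' (M' x) = x) {j : ℕ} {y : X}
    (hy : y ∈ innerPath M M' x j) : M' y ∈ innerPath M M' x j := by
  obtain ⟨t, h1, h2, rfl⟩ := hy
  rcases Nat.even_or_odd' t with ⟨r, rfl | rfl⟩
  · obtain ⟨s, rfl⟩ : ∃ s, r = s + 1 := ⟨r - 1, by omega⟩
    have : ¬ Even (2 * s + 1) := by simp
    exact ⟨2 * s + 1, by omega, by omega, (apply_right_altIter hM' this).symm⟩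
  · have : ¬ Even (2 * r + 1) := by simp
    exact ⟨2 * r + 1 + 1, by omega, by omega, altIter_succ_odd this⟩

lemma outerPath_closed (hM : ∀ x, M (M x) = x) {j : ℕ} {y : X}
    (hy : y ∈ outerPath M M' x j) : M y ∈ outerPath M M' x j := by
  obtain ⟨t, h2, rfl⟩ := hy
  rcases Nat.even_or_odd' t with ⟨r, rfl | rfl⟩
  · exact ⟨2 * r + 1, by omega, altIter_succ_even (even_two_mul r)⟩
  · exact ⟨2 * r, by omega, (apply_left_altIter hM (even_two_mul r)).symm⟩

lemma innerPath_subset (M M' : X → X) (x : X) (j : ℕ) :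
    innerPath M M' x j ⊆ outerPath M M' x j := by
  rintro y ⟨t, -, h2, h⟩
  exact ⟨t, by omega, h⟩

lemma mem_outerPath {j : ℕ} {y : X} : y ∈ outerPath M M' x j ↔
    y ∈ innerPath M M' x j ∨ y = x ∨ y = altIter M M' x (2 * j + 1) := by
  constructor
  · rintro ⟨t, h, rfl⟩
    by_cases h0 : t = 0
    · subst h0
      exact Or.inr (Or.inl rfl)
    · by_cases h1 : t = 2 * j + 1
      · subst h1
        exact Or.inr (Or.inr rfl)
      · exact Or.inl ⟨t, by omega, by omega, rfl⟩
  · rintro (h | rfl | rfl)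
    · exact innerPath_subset _ _ _ _ h
    · exact ⟨0, by omega, rfl⟩
    · exact ⟨2 * j + 1, le_rfl, rfl⟩

/-- Use `M'` on `A` and `M` off `B`, and leave `B \ A` unmatched. -/
def innerMix (A B : Set X) (M M' : X → X) (x : X) : X :=
  if x ∈ A then M' x else if x ∈ B then x else M x

/-- Use `M` inside `A` and `M'` off `A`. -/
def outerMix (A : Set X) (M M' : X → X) (x : X) : X :=
  if x ∈ A then if M x ∈ A then M x else x else M' x

section

variable {Γ : X → X → Prop} {A B : Set X} {p q : X}

lemma innerMix_mem [Fintype X] (hM : M ∈ perfectMatchings Γ) (hM' : M' ∈ perfectMatchings Γ)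
    (hA : ∀ x ∈ A, M' x ∈ A) (hB : ∀ x ∈ B, M x ∈ B) (hAB : ∀ x, x ∈ B ↔ x ∈ A ∨ x = p ∨ x = q)
    (hp : p ∉ A) (hq : q ∉ A) (hpq : p ≠ q) : innerMix A B M M' ∈ nearPerfectMatchings Γ := by
  rw [mem_perfectMatchings] at hM hM'
  rw [mem_nearPerfectMatchings]
  refine ⟨⟨fun x => ?_, fun x => ?_⟩, Or.inr ⟨p, q, hpq, fun x => ?_⟩⟩
  · unfold innerMix
    by_cases h1 : x ∈ A
    · rw [if_pos h1, if_pos (hA x h1), hM'.1.1]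
    · by_cases h2 : x ∈ B
      · simp only [h1, h2, if_true, if_false]
      · have h3 : M x ∉ B := fun h => h2 (by simpa [hM.1.1] using hB _ h)
        have h4 : M x ∉ A := fun h => h3 ((hAB _).2 (Or.inl h))
        simp only [h1, h2, h3, h4, if_false, hM.1.1]
  · unfold innerMix
    split_ifs
    · exact hM'.1.2 x
    · simp
    · exact hM.1.2 x
  · unfold innerMix
    have := hAB x
    by_cases h1 : x ∈ A
    · simp only [h1, if_true, hM'.2, false_iff]
      rintro (rfl | rfl)
      · exact hp h1
      · exact hq h1
    · by_cases h2 : x ∈ B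
      · simp only [h1, h2, if_true, if_false, true_iff]
        simpa [h1] using this.1 h2
      · simp only [h1, h2, if_false, hM.2, false_iff]
        exact fun h => h2 (this.2 (Or.inr h))

/-- The elements left unmatched are the partners of `p` and `q` under `M`, unless `M p = q`. In that
case the result is perfect, which is why `nearPerfectMatchings` includes the perfect ones. -/
lemma outerMix_mem [Fintype X] (hM : M ∈ perfectMatchings Γ) (hM' : M' ∈ perfectMatchings Γ)
    (hA : ∀ x ∈ A, M' x ∈ A) (hB : ∀ x ∈ B, M x ∈ B) (hAB : ∀ x, x ∈ B ↔ x ∈ A ∨ x = p ∨ x = q)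
    (hp : p ∉ A) (hq : q ∉ A) (hpq : p ≠ q) : outerMix A M M' ∈ nearPerfectMatchings Γ := by
  rw [mem_perfectMatchings] at hM hM'
  rw [mem_nearPerfectMatchings]
  have hfix : ∀ x, outerMix A M M' x = x ↔ x ∈ A ∧ M x ∉ A := by
    intro x
    unfold outerMix
    by_cases h1 : x ∈ A
    · by_cases h2 : M x ∈ A
      · simp [h1, h2, hM.2]
      · simp [h1, h2]
    · simp [h1, hM'.2]
  refine ⟨⟨fun x => ?_, fun x => ?_⟩, ?_⟩
  · unfold outerMix
    by_cases h1 : x ∈ A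
    · by_cases h2 : M x ∈ A
      · simp only [h1, h2, if_true, hM.1.1]
      · simp only [h1, h2, if_true, if_false]
    · have h3 : M' x ∉ A := fun h => h1 (by simpa [hM'.1.1] using hA _ h)
      simp only [h1, h3, if_false, hM'.1.1]
  · unfold outerMix
    split_ifs
    · exact hM.1.2 x
    · simp
    · exact hM'.1.2 x
  · have hMp : M p ∈ A ∨ M p = q := by
      have := (hAB (M p)).1 (hB p ((hAB p).2 (by simp)))
      have := hM.2 p
      tauto
    have hMq : M q ∈ A ∨ M q = p := by
      have := (hAB (M q)).1 (hB q ((hAB q).2 (by simp)))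
      have := hM.2 q
      tauto
    have hout : ∀ x, x ∈ A → M x ∉ A → x = M p ∨ x = M q := by
      intro x h1 h2
      have h3 := (hAB (M x)).1 (hB x ((hAB x).2 (Or.inl h1)))
      rcases h3 with h3 | h3 | h3
      · exact absurd h3 h2
      · left
        rw [← h3, hM.1.1]
      · right
        rw [← h3, hM.1.1]
    by_cases h : M p = q
    · left
      intro x hx
      rw [hfix] at hx
      rcases hout x hx.1 hx.2 with rfl | rfl
      · exact hq (h ▸ hx.1)
      · apply hp
        have := hx.1
        rwa [← h, hM.1.1] at this
    · right
      have hp' : M p ∈ A := hMp.resolve_right h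
      have hq' : M q ∈ A := hMq.resolve_right fun h' => h (by rw [← h', hM.1.1])
      refine ⟨M p, M q, fun h => hpq (by rw [← hM.1.1 p, h, hM.1.1]), fun x => ?_⟩
      rw [hfix]
      constructor
      · exact fun hx => hout x hx.1 hx.2
      · rintro (rfl | rfl)
        · exact ⟨hp', by rwa [hM.1.1]⟩
        · exact ⟨hq', by rwa [hM.1.1]⟩

/-- The two matchings are determined by the mixed ones and the ends of the path. -/
lemma eq_of_innerMix_eq {N N' : X → X} (hM : ∀ x, M (M x) = x) (hN : ∀ x, N (N x) = x)
    (hB : ∀ x ∈ B, M x ∈ B) (hB' : ∀ x ∈ B, N x ∈ B)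
    (hAB : ∀ x, x ∈ B ↔ x ∈ A ∨ x = p ∨ x = q)
    (hZ : innerMix A B M M' = innerMix A B N N') (hL : outerMix A M M' = outerMix A N N')
    (hpM : M p = N p) (hqM : M q = N q) : M = N ∧ M' = N' := by
  constructor
  · funext x
    have h1 := congrFun hZ x
    have h2 := congrFun hL x
    by_cases hxB : x ∈ B
    · rcases (hAB x).1 hxB with hxA | rfl | rfl
      -- Inside `A` the matching `M` is read off `outerMix` unless it leads to `p` or `q`, whose
      -- partners are given.
      · rcases (hAB _).1 (hB x hxB) with h | h | h
        · by_cases h' : N x ∈ A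
          · simpa [outerMix, hxA, h, h'] using h2
          · rcases (hAB _).1 (hB' x hxB) with h'' | h'' | h''
            · exact absurd h'' h'
            · have : x = M p := by rw [hpM, ← h'', hN]
              rw [h'', this, hM]
            · have : x = M q := by rw [hqM, ← h'', hN]
              rw [h'', this, hM]
        · rw [h, eq_comm, ← hN p, ← hpM, ← h, hM]
        · rw [h, eq_comm, ← hN q, ← hqM, ← h, hM]
      · exact hpM
      · exact hqM
    · have hxA : x ∉ A := fun h => hxB ((hAB x).2 (Or.inl h))
      simpa [innerMix, hxA, hxB] using h1
  · funext x
    have h1 := congrFun hZ x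
    have h2 := congrFun hL x
    by_cases hxA : x ∈ A
    · simpa [innerMix, hxA] using h1
    · simpa [outerMix, hxA] using h2

end

end alternating
end
end FullyGraphic

namespace FullyGraphic
open scoped Classical symmDiff
noncomputable section

/-! ### Interpolating matchings and their encoding -/

section interpolation

variable {X : Type*} [Fintype X] {Γ : X → X → Prop} {M M' : X → X} {x : X} {j : ℕ}

/-- The interpolating matchings on the way from `M` to the exchange of `M` and `M'` along the
alternating cycle through `x`. -/
def interp (M M' : X → X) (x : X) (j : ℕ) : X → X :=
  innerMix (innerPath M M' x j) (outerPath M M' x j) M M'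

/-- The matchings complementary to the interpolating ones. -/
def coInterp (M M' : X → X) (x : X) (j : ℕ) : X → X := outerMix (innerPath M M' x j) M M'

lemma path_ends (hM : M ∈ perfectMatchings Γ) (hM' : M' ∈ perfectMatchings Γ)
    (hj : j < halfPeriod M M' x) : x ∉ innerPath M M' x j ∧
      altIter M M' x (2 * j + 1) ∉ innerPath M M' x j ∧ x ≠ altIter M M' x (2 * j + 1) := by
  rw [mem_perfectMatchings] at hM hM'
  have hinj := fun a b => altIter_injOn (x := x) hM.1.1 hM'.1.1 hM.2 hM'.2 (a := a) (b := b)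
  refine ⟨?_, ?_, ?_⟩
  · rintro ⟨t, h1, h2, h⟩
    have := hinj t 0 (by omega) (by omega) h
    omega
  · rintro ⟨t, h1, h2, h⟩
    have := hinj t (2 * j + 1) (by omega) (by omega) h
    omega
  · intro h
    have := hinj 0 (2 * j + 1) (by omega) (by omega) h
    omega

lemma interp_mem (hM : M ∈ perfectMatchings Γ) (hM' : M' ∈ perfectMatchings Γ)
    (hj : j < halfPeriod M M' x) : interp M M' x j ∈ nearPerfectMatchings Γ := by
  obtain ⟨h1, h2, h3⟩ := path_ends hM hM' hj
  exact innerMix_mem hM hM' (fun y => innerPath_closed (mem_perfectMatchings.1 hM').1.1)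
    (fun y => outerPath_closed (mem_perfectMatchings.1 hM).1.1) (fun y => mem_outerPath) h1 h2 h3

lemma coInterp_mem (hM : M ∈ perfectMatchings Γ) (hM' : M' ∈ perfectMatchings Γ)
    (hj : j < halfPeriod M M' x) : coInterp M M' x j ∈ nearPerfectMatchings Γ := by
  obtain ⟨h1, h2, h3⟩ := path_ends hM hM' hj
  exact outerMix_mem hM hM' (fun y => innerPath_closed (mem_perfectMatchings.1 hM').1.1)
    (fun y => outerPath_closed (mem_perfectMatchings.1 hM).1.1) (fun y => mem_outerPath) h1 h2 h3

lemma hammingDist_interp_zero : hammingDist (interp M M' x 0) M ≤ 3 := by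
  refine hammingDist_le_three (a := x) (b := altIter M M' x 1) (c := x) fun y h1 h2 _ => ?_
  have h3 : y ∉ innerPath M M' x 0 := by
    rintro ⟨t, h3, h4, -⟩
    omega
  have h4 : y ∉ outerPath M M' x 0 := by
    rw [mem_outerPath]
    tauto
  simp [interp, innerMix, h3, h4]

lemma hammingDist_interp_succ : hammingDist (interp M M' x j) (interp M M' x (j + 1)) ≤ 3 := by
  refine hammingDist_le_three (a := altIter M M' x (2 * j + 1)) (b := altIter M M' x (2 * j + 2))
    (c := altIter M M' x (2 * j + 3)) fun y h1 h2 h3 => ?_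
  have hA : y ∈ innerPath M M' x (j + 1) ↔ y ∈ innerPath M M' x j := by
    constructor
    · rintro ⟨t, ht1, ht2, rfl⟩
      have : t ≠ 2 * j + 1 := fun h => h1 (h ▸ rfl)
      have : t ≠ 2 * j + 2 := fun h => h2 (h ▸ rfl)
      exact ⟨t, ht1, by omega, rfl⟩
    · rintro ⟨t, ht1, ht2, rfl⟩
      exact ⟨t, ht1, by omega, rfl⟩
  have hB : y ∈ outerPath M M' x (j + 1) ↔ y ∈ outerPath M M' x j := by
    rw [mem_outerPath, mem_outerPath, hA, show 2 * (j + 1) + 1 = 2 * j + 3 by ring]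
    tauto
  simp only [interp, innerMix, hA, hB]

/-- At the last position the outer path is the whole component, and only its two ends await their
partners under `M'`. -/
lemma hammingDist_interp_swapOrb (hM : ∀ x, M (M x) = x) (hM' : ∀ x, M' (M' x) = x)
    (hj : j + 1 = halfPeriod M M' x) : hammingDist (interp M M' x j) (swapOrb M M' x) ≤ 3 := by
  refine hammingDist_le_three (a := x) (b := altIter M M' x (2 * j + 1)) (c := x)
    fun y h1 h2 h0 => ?_
  clear h0
  have hper := (halfPeriod_spec (x := x) hM hM').2
  rw [← hj] at hper
  have horb : orb M M' x y ↔ y ∈ outerPath M M' x j := by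
    clear h1 h2
    constructor
    · intro h
      induction h with
      | refl => exact ⟨0, by omega, rfl⟩
      | @tail b c _ hs ih =>
        rcases hs with rfl | rfl
        · exact outerPath_closed hM ih
        · rcases mem_outerPath.1 ih with h | h | h
          · exact innerPath_subset _ _ _ _ (innerPath_closed hM' h)
          · have : ¬ Even (2 * j + 1) := by simp
            refine ⟨2 * j + 1, le_rfl, ?_⟩
            rw [h, ← apply_right_altIter (M := M) (x := x) hM' this,
              show 2 * j + 1 + 1 = 2 * (j + 1) by ring, ← hper]
            rfl
          · have : ¬ Even (2 * j + 1) := by simp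
            refine ⟨0, by omega, ?_⟩
            rw [h, ← altIter_succ_odd (f := M) (g := M') (x := x) this,
              show 2 * j + 1 + 1 = 2 * (j + 1) by ring, ← hper]
    · rintro ⟨t, -, rfl⟩
      induction t with
      | zero => exact Relation.ReflTransGen.refl
      | succ t ih =>
        by_cases ht : Even t
        · rw [altIter_succ_even ht]
          exact orb_left ih
        · rw [altIter_succ_odd ht]
          exact orb_right ih
  have hB := mem_outerPath (M := M) (M' := M') (x := x) (j := j) (y := y)
  simp only [swapOrb, mix, interp, innerMix, Set.mem_ofPred_eq, horb]
  by_cases hA : y ∈ innerPath M M' x j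
  · have := hB.2 (Or.inl hA)
    simp [hA, this]
  · have : y ∉ outerPath M M' x j := by
      rw [hB]
      tauto
    simp [hA, this]

/-- The inner path is recovered from the mixed matchings. -/
lemma innerPath_eq {X : Type*} (M M' : X → X) (x : X) (j : ℕ) :
    innerPath M M' x j =
      {y | ∃ t, t < 2 * j ∧ altIter (interp M M' x j) (coInterp M M' x j) (M x) t = y} := by
  -- Along the inner path `interp` acts as `M'` and `coInterp` as `M`, so from `M x` they trace it
  -- without knowing `M` and `M'`.
  have key : ∀ t, t < 2 * j → altIter (interp M M' x j) (coInterp M M' x j) (M x) t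
      = altIter M M' x (t + 1) := by
    intro t
    induction t with
    | zero => intro _; rfl
    | succ t ih =>
      intro ht
      have ih := ih (by omega)
      have hmem : altIter M M' x (t + 1) ∈ innerPath M M' x j := ⟨t + 1, by omega, by omega, rfl⟩
      by_cases he : Even t
      · have ho : ¬ Even (t + 1) := by rwa [Nat.even_add_one, not_not]
        rw [altIter_succ_even he, ih, altIter_succ_odd ho, interp, innerMix, if_pos hmem]
      · have ho : Even (t + 1) := by rwa [Nat.even_add_one]
        have hmem' : M (altIter M M' x (t + 1)) ∈ innerPath M M' x j :=
          ⟨t + 1 + 1, by omega, by omega, altIter_succ_even ho⟩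
        rw [altIter_succ_odd he, ih, altIter_succ_even ho, coInterp, outerMix, if_pos hmem,
          if_pos hmem']
  ext y
  constructor
  · rintro ⟨t, h1, h2, rfl⟩
    refine ⟨t - 1, by omega, ?_⟩
    rw [key _ (by omega), Nat.sub_add_cancel h1]
  · rintro ⟨t, h1, rfl⟩
    rw [key t h1]
    exact ⟨t + 1, by omega, by omega, rfl⟩

/-- The code of a pair of matchings at a position of the alternating path. -/
def pathCode (x : X) (j : ℕ) (p : (X → X) × (X → X)) : (X → X) × (X → X) × X × X × X :=
  (interp p.1 p.2 x j, coInterp p.1 p.2 x j, p.1 x, altIter p.1 p.2 x (2 * j + 1),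
    p.1 (altIter p.1 p.2 x (2 * j + 1)))

/-- The code yields the inner path by `innerPath_eq`, then the outer path by adding the ends, then
both matchings by `eq_of_innerMix_eq`. -/
lemma pathCode_injOn {p q : (X → X) × (X → X)}
    (hp : p ∈ perfectMatchings Γ ×ˢ perfectMatchings Γ)
    (hq : q ∈ perfectMatchings Γ ×ˢ perfectMatchings Γ)
    (h : pathCode x j p = pathCode x j q) : p = q := by
  obtain ⟨M, M'⟩ := p
  obtain ⟨N, N'⟩ := q
  rw [Finset.mem_product, mem_perfectMatchings, mem_perfectMatchings] at hp hq
  dsimp only at hp hq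
  simp only [pathCode, Prod.mk.injEq] at h
  obtain ⟨hZ, hL, hx, hend, hMend⟩ := h
  have hA : innerPath M M' x j = innerPath N N' x j := by
    rw [innerPath_eq M, innerPath_eq N, hZ, hL, hx]
  have hB : outerPath M M' x j = outerPath N N' x j := by
    ext y
    rw [mem_outerPath, mem_outerPath, hA, hend]
  unfold interp at hZ
  unfold coInterp at hL
  rw [← hA, ← hB] at hZ
  rw [← hA] at hL
  rw [← hend] at hMend
  obtain ⟨h1, h2⟩ := eq_of_innerMix_eq (p := x) (q := altIter M M' x (2 * j + 1)) hp.1.1.1 hq.1.1.1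
    (fun y => outerPath_closed hp.1.1.1)
    (by rw [hB]; exact fun y => outerPath_closed hq.1.1.1) (fun y => mem_outerPath) hZ hL hx hMend
  rw [h1, h2]

/-- The sum of the squared differences of `F` over the near-perfect matchings close to `Z`. -/
def localSum (Γ : X → X → Prop) (F : (X → X) → ℝ) (Z : X → X) : ℝ :=
  ∑ Z' ∈ (nearPerfectMatchings Γ).filter fun Z' => hammingDist Z Z' ≤ 3, (F Z - F Z') ^ 2

lemma localSum_nonneg (F : (X → X) → ℝ) (Z : X → X) : 0 ≤ localSum Γ F Z :=
  Finset.sum_nonneg fun _ _ => sq_nonneg _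

lemma sq_le_localSum (F : (X → X) → ℝ) {Z Z' : X → X} (hZ' : Z' ∈ nearPerfectMatchings Γ)
    (h : hammingDist Z Z' ≤ 3) : (F Z - F Z') ^ 2 ≤ localSum Γ F Z :=
  Finset.single_le_sum (f := fun Z' => (F Z - F Z') ^ 2) (fun _ _ => sq_nonneg _)
    (Finset.mem_filter.2 ⟨hZ', h⟩)

/-- Telescoping from `M` through the interpolating matchings to `swapOrb M M' x`, where each step
changes at most three values, and Cauchy–Schwarz. The cutoff gives the sum a range independent of
the pair. -/
lemma sq_swapOrb_le (F : (X → X) → ℝ) (hM : M ∈ perfectMatchings Γ)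
    (hM' : M' ∈ perfectMatchings Γ) :
    (F M - F (swapOrb M M' x)) ^ 2 ≤ 3 * (Fintype.card X + 2) *
      ∑ j ∈ Finset.range (Fintype.card X),
        if j < halfPeriod M M' x then localSum Γ F (interp M M' x j) else 0 := by
  have hM1 := mem_perfectMatchings.1 hM
  have hM1' := mem_perfectMatchings.1 hM'
  set k := halfPeriod M M' x with hk
  have hk0 : 0 < k := (halfPeriod_spec hM1.1.1 hM1'.1.1).1
  have hkN : k ≤ Fintype.card X := halfPeriod_le hM1.1.1 hM1'.1.1 hM1.2 hM1'.2
  have hsum : ∑ j ∈ Finset.range (Fintype.card X),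
      (if j < k then localSum Γ F (interp M M' x j) else 0)
        = ∑ j ∈ Finset.range k, localSum Γ F (interp M M' x j) := by
    rw [← Finset.sum_filter]
    congr 1
    ext j
    simp only [Finset.mem_filter, Finset.mem_range]
    omega
  rw [hsum]
  set S := ∑ j ∈ Finset.range k, localSum Γ F (interp M M' x j) with hS
  have hloc : ∀ j < k, localSum Γ F (interp M M' x j) ≤ S := fun j hj =>
    Finset.single_le_sum (f := fun j => localSum Γ F (interp M M' x j))
      (fun _ _ => localSum_nonneg F _) (Finset.mem_range.2 hj)
  have hS0 : 0 ≤ S := Finset.sum_nonneg fun _ _ => localSum_nonneg F _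
  have hsw : swapOrb M M' x ∈ nearPerfectMatchings Γ :=
    perfectMatchings_subset Γ (mix_mem_perfectMatchings hM hM' (fun _ => orb_left)
      (fun _ => orb_right))
  have h1 : (F (interp M M' x 0) - F M) ^ 2 ≤ S :=
    (sq_le_localSum F (perfectMatchings_subset Γ hM) hammingDist_interp_zero).trans (hloc 0 hk0)
  obtain ⟨l, hl⟩ : ∃ l, k = l + 1 := ⟨k - 1, by omega⟩
  have h3 : (F (interp M M' x l) - F (swapOrb M M' x)) ^ 2 ≤ S :=
    (sq_le_localSum F hsw (hammingDist_interp_swapOrb hM1.1.1 hM1'.1.1 (by omega))).trans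
      (hloc l (by omega))
  have h2 : (F (interp M M' x 0) - F (interp M M' x l)) ^ 2 ≤ Fintype.card X * S := by
    have e := Finset.sum_range_sub' (fun t => F (interp M M' x t)) l
    have e2 := sq_sum_le_card_mul_sum_sq (s := Finset.range l) (f := fun t =>
      F (interp M M' x t) - F (interp M M' x (t + 1)))
    rw [e, Finset.card_range] at e2
    refine e2.trans ?_
    have e3 : ∑ t ∈ Finset.range l, (F (interp M M' x t) - F (interp M M' x (t + 1))) ^ 2 ≤ S := by
      refine (Finset.sum_le_sum fun t ht => ?_).trans (Finset.sum_le_sum_of_subset_of_nonneg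
        (Finset.range_mono (show l ≤ k by omega)) fun t _ _ => localSum_nonneg F _)
      rw [Finset.mem_range] at ht
      exact sq_le_localSum F (interp_mem hM hM' (by omega)) hammingDist_interp_succ
    have : (l : ℝ) ≤ Fintype.card X := by exact_mod_cast (by omega : l ≤ Fintype.card X)
    gcongr
  have hN : (1 : ℝ) ≤ Fintype.card X := by exact_mod_cast (by omega : 1 ≤ Fintype.card X)
  have h4 : ∀ a b c e : ℝ, (a - e) ^ 2 ≤ 3 * ((b - a) ^ 2 + (b - c) ^ 2 + (c - e) ^ 2) := by
    intro a b c e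
    nlinarith [sq_nonneg ((a - b) - (b - c)), sq_nonneg ((b - c) - (c - e)),
      sq_nonneg ((a - b) - (c - e))]
  have h5 := h4 (F M) (F (interp M M' x 0)) (F (interp M M' x l)) (F (swapOrb M M' x))
  nlinarith

/-- Exchanges on single components are controlled by local changes of near-perfect matchings. -/
lemma sum_swapOrb_sq_le (F : (X → X) → ℝ) (x : X) :
    ∑ p ∈ perfectMatchings Γ ×ˢ perfectMatchings Γ, (F p.1 - F (swapOrb p.1 p.2 x)) ^ 2 ≤
      3 * (Fintype.card X + 2) * Fintype.card X ^ 4 * (nearPerfectMatchings Γ).card *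
        ∑ Z ∈ nearPerfectMatchings Γ, localSum Γ F Z := by
  set N := Fintype.card X with hN
  -- By injectivity of the code, a near-perfect matching occurs at position `j` for at most as many
  -- pairs as there are complementary matchings and triples of elements.
  have hj : ∀ j ∈ Finset.range N, ∑ p ∈ perfectMatchings Γ ×ˢ perfectMatchings Γ,
      (if j < halfPeriod p.1 p.2 x then localSum Γ F (interp p.1 p.2 x j) else 0) ≤
      (N : ℝ) ^ 3 * (nearPerfectMatchings Γ).card * ∑ Z ∈ nearPerfectMatchings Γ, localSum Γ F Z := by
    intro j _
    rw [← Finset.sum_filter]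
    set T := (perfectMatchings Γ ×ˢ perfectMatchings Γ).filter
      fun p => j < halfPeriod p.1 p.2 x with hT
    have hinj : Set.InjOn (pathCode x j) T := by
      intro p hp q hq h
      exact pathCode_injOn (Finset.mem_filter.1 hp).1 (Finset.mem_filter.1 hq).1 h
    have e1 : ∑ p ∈ T, localSum Γ F (interp p.1 p.2 x j) =
        ∑ c ∈ T.image (pathCode x j), localSum Γ F c.1 := by
      rw [Finset.sum_image hinj]
      rfl
    rw [e1]
    have hsub : T.image (pathCode x j) ⊆ nearPerfectMatchings Γ ×ˢ nearPerfectMatchings Γ ×ˢ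
        (Finset.univ : Finset (X × X × X)) := by
      intro c hc
      obtain ⟨p, hp, rfl⟩ := Finset.mem_image.1 hc
      obtain ⟨hp, hlt⟩ := Finset.mem_filter.1 hp
      rw [Finset.mem_product] at hp
      simp only [pathCode, Finset.mem_product, Finset.mem_univ, and_true]
      exact ⟨interp_mem hp.1 hp.2 hlt, coInterp_mem hp.1 hp.2 hlt⟩
    refine (Finset.sum_le_sum_of_subset_of_nonneg hsub fun c _ _ => localSum_nonneg F _).trans ?_
    rw [Finset.sum_product]
    simp only [Finset.sum_const, Finset.card_product, Finset.card_univ, Fintype.card_prod,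
      nsmul_eq_mul, ← Finset.mul_sum, ← hN]
    apply le_of_eq
    push_cast
    ring
  calc _ ≤ ∑ p ∈ perfectMatchings Γ ×ˢ perfectMatchings Γ, 3 * ((N : ℝ) + 2) *
      ∑ j ∈ Finset.range N,
        if j < halfPeriod p.1 p.2 x then localSum Γ F (interp p.1 p.2 x j) else 0 := by
        refine Finset.sum_le_sum fun p hp => ?_
        rw [Finset.mem_product] at hp
        exact sq_swapOrb_le F hp.1 hp.2
    _ = 3 * ((N : ℝ) + 2) * ∑ j ∈ Finset.range N, ∑ p ∈ perfectMatchings Γ ×ˢ perfectMatchings Γ,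
        (if j < halfPeriod p.1 p.2 x then localSum Γ F (interp p.1 p.2 x j) else 0) := by
        rw [← Finset.mul_sum, Finset.sum_comm]
    _ ≤ 3 * ((N : ℝ) + 2) * (N * ((N : ℝ) ^ 3 * (nearPerfectMatchings Γ).card *
          ∑ Z ∈ nearPerfectMatchings Γ, localSum Γ F Z)) := by
        refine mul_le_mul_of_nonneg_left ?_ (by positivity)
        refine (Finset.sum_le_sum hj).trans ?_
        simp
    _ = _ := by ring

/-- A Poincaré-type inequality for perfect matchings in terms of near-perfect ones. -/
theorem sum_perfect_sq_le_localSum (Γ : X → X → Prop) (F : (X → X) → ℝ) :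
    ∑ p ∈ perfectMatchings Γ ×ˢ perfectMatchings Γ, (F p.1 - F p.2) ^ 2 ≤
      3 * (Fintype.card X + 2) * Fintype.card X ^ 7 * (nearPerfectMatchings Γ).card *
        ∑ Z ∈ nearPerfectMatchings Γ, localSum Γ F Z := by
  refine (sum_perfect_sq_le F).trans ?_
  refine (mul_le_mul_of_nonneg_left (Finset.sum_le_sum fun x _ => sum_swapOrb_sq_le F x)
    (by positivity)).trans (le_of_eq ?_)
  rw [Finset.sum_const, Finset.card_univ, nsmul_eq_mul]
  ring

end interpolation
end
end FullyGraphic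

namespace FullyGraphic
open scoped Classical symmDiff
noncomputable section

/-! ### Realizations close to graphs with slightly wrong degrees -/

section repair

variable {n : ℕ} {d : Fin n → ℕ} {c₁ c₂ m : ℕ}

lemma exists_nonadj_of_dg_lt (G : SimpleGraph (Fin n)) (b : Fin n) (h : dg G b < (n : ℤ) - 1) :
    ∃ w, b ≠ w ∧ ¬ G.Adj b w := by
  by_contra! hcon
  have : G.neighborFinset b = Finset.univ.erase b := by
    ext w
    simp only [SimpleGraph.mem_neighborFinset, Finset.mem_erase, Finset.mem_univ, and_true]
    exact ⟨fun h => h.ne', fun h => hcon w h.symm⟩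
  rw [dg_eq_degree, ← SimpleGraph.card_neighborFinset_eq_degree, this,
    Finset.card_erase_of_mem (Finset.mem_univ _), Finset.card_univ, Fintype.card_fin] at h
  have := b.pos
  omega

/-- The bound is `2 * 11`, as every step of the walk exchanges at most two ordered pairs. -/
lemma exists_near_of_plus_plus (hd : CornerBound d c₁ c₂ m) {G : SimpleGraph (Fin n)} {a b : Fin n}
    (hG : ∀ x, dg G x = d x + (if x = a then 1 else 0) + (if x = b then 1 else 0)) :
    ∃ H : SimpleGraph (Fin n), (∀ x, dg H x = d x) ∧ gdist G H ≤ 22 := by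
  obtain ⟨W, -, -, h⟩ := exists_trail hd G a b hG
  exact ⟨_, h, gdist_trailGraph_le G W 11⟩

/-- A vertex `b` with a deficit is not joined to all others; adding an edge `bw` trades the deficit
for a surplus at `w`. -/
lemma exists_near_of_plus_minus (hd : CornerBound d c₁ c₂ m) {G : SimpleGraph (Fin n)} {a b : Fin n}
    (hG : ∀ x, dg G x = d x + (if x = a then 1 else 0) - (if x = b then 1 else 0)) :
    ∃ H : SimpleGraph (Fin n), (∀ x, dg H x = d x) ∧ gdist G H ≤ 24 := by
  by_cases hab : a = b
  · subst hab
    refine ⟨G, fun x => ?_, ?_⟩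
    · rw [hG]
      ring
    · rw [gdist_eq_zero.2 rfl]
      omega
  · obtain ⟨w, hw, hadj⟩ := exists_nonadj_of_dg_lt G b (by
      have h1 := hG b
      have h2 := hd.upper b
      have h3 := hd.lt
      rw [if_neg (Ne.symm hab), if_pos rfl] at h1
      omega)
    obtain ⟨H, hH, hd⟩ := exists_near_of_plus_plus (G := G ∆ SimpleGraph.edge b w) (a := a) (b := w) hd
      (by
        intro x
        rw [dg_symmDiff_edge G hw, hG, if_neg hadj]
        ring)
    have h1 := gdist_triangle G (G ∆ SimpleGraph.edge b w) H
    have h2 := gdist_edge_le G b w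
    exact ⟨H, hH, by omega⟩

lemma exists_near_of_minus_minus (hd : CornerBound d c₁ c₂ m) {G : SimpleGraph (Fin n)}
    {a b : Fin n}
    (hG : ∀ x, dg G x = d x - (if x = a then 1 else 0) - (if x = b then 1 else 0)) :
    ∃ H : SimpleGraph (Fin n), (∀ x, dg H x = d x) ∧ gdist G H ≤ 26 := by
  obtain ⟨w, hw, hadj⟩ := exists_nonadj_of_dg_lt G b (by
    have h1 := hG b
    have h2 := hd.upper b
    have h3 := hd.lt
    rw [if_pos rfl] at h1
    split_ifs at h1 <;> omega)
  obtain ⟨H, hH, hd⟩ := exists_near_of_plus_minus (G := G ∆ SimpleGraph.edge b w) (a := w) (b := a) hd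
    (by
      intro x
      rw [dg_symmDiff_edge G hw, hG, if_neg hadj]
      ring)
  have h1 := gdist_triangle G (G ∆ SimpleGraph.edge b w) H
  have h2 := gdist_edge_le G b w
  exact ⟨H, hH, by omega⟩

end repair

/-! ### Realizations as perfect matchings of a gadget -/

section gadget

variable {n : ℕ} (d : Fin n → ℕ)

/-- The elements of the matching gadget: a stub for each ordered pair, and `n - d v` cores at each
vertex `v`. -/
abbrev Gadget : Type := (Fin n × Fin n) ⊕ Σ v, Fin (n - d v)

/-- A stub may be matched to its reverse or to a core at its tail. -/
def gadgetRel : Gadget d → Gadget d → Prop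
  | Sum.inl p, Sum.inl q => p.1 ≠ p.2 ∧ q = p.swap
  | Sum.inl p, Sum.inr c => c.1 = p.1
  | Sum.inr c, Sum.inl p => c.1 = p.1
  | Sum.inr _, Sum.inr _ => False

variable {d}

/-- The graph formed by the pairs whose stubs are matched to each other. -/
def gadgetGraph (m : Gadget d → Gadget d) : SimpleGraph (Fin n) where
  Adj v u := v ≠ u ∧ m (Sum.inl (v, u)) = Sum.inl (u, v) ∧ m (Sum.inl (u, v)) = Sum.inl (v, u)
  symm := ⟨fun _ _ h => ⟨h.1.symm, h.2.2, h.2.1⟩⟩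
  loopless := ⟨fun _ h => h.1 rfl⟩

lemma IsMatching.gadgetGraph_adj {m : Gadget d → Gadget d} (hm : IsMatching (gadgetRel d) m)
    {v u : Fin n} : (gadgetGraph m).Adj v u ↔ v ≠ u ∧ m (Sum.inl (v, u)) = Sum.inl (u, v) := by
  refine ⟨fun h => ⟨h.1, h.2.1⟩, fun h => ⟨h.1, h.2, ?_⟩⟩
  rw [← h.2, hm.1]

lemma IsMatching.stub {m : Gadget d → Gadget d} (hm : IsMatching (gadgetRel d) m) (v u : Fin n) :
    m (Sum.inl (v, u)) = Sum.inl (v, u) ∨ (gadgetGraph m).Adj v u ∨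
      ∃ i, m (Sum.inl (v, u)) = Sum.inr ⟨v, i⟩ := by
  by_cases h : m (Sum.inl (v, u)) = Sum.inl (v, u)
  · exact Or.inl h
  · right
    have h2 := hm.2 _ h
    match hmv : m (Sum.inl (v, u)) with
    | Sum.inl q =>
      rw [hmv] at h2
      obtain ⟨h3, rfl⟩ := h2
      exact Or.inl (hm.gadgetGraph_adj.2 ⟨h3, hmv⟩)
    | Sum.inr ⟨w, i⟩ =>
      rw [hmv] at h2
      obtain rfl : w = v := h2
      exact Or.inr ⟨i, rfl⟩

lemma IsMatching.core {m : Gadget d → Gadget d} (hm : IsMatching (gadgetRel d) m) (v : Fin n)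
    (i : Fin (n - d v)) : m (Sum.inr ⟨v, i⟩) = Sum.inr ⟨v, i⟩ ∨
      ∃ u, m (Sum.inr ⟨v, i⟩) = Sum.inl (v, u) := by
  by_cases h : m (Sum.inr ⟨v, i⟩) = Sum.inr ⟨v, i⟩
  · exact Or.inl h
  · right
    have h2 := hm.2 _ h
    match hmv : m (Sum.inr ⟨v, i⟩) with
    | Sum.inl (w, u) =>
      rw [hmv] at h2
      obtain rfl : v = w := h2
      exact ⟨u, rfl⟩
    | Sum.inr c =>
      rw [hmv] at h2
      exact h2.elim

/-- The degrees of the graph of a matching, in terms of the unmatched elements. -/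
lemma IsMatching.degree_add {m : Gadget d → Gadget d} (hm : IsMatching (gadgetRel d) m) {v : Fin n}
    (hv : d v ≤ n) :
    (gadgetGraph m).degree v +
      (Finset.univ.filter fun u => m (Sum.inl (v, u)) = Sum.inl (v, u)).card =
    d v + (Finset.univ.filter fun i => m (Sum.inr ⟨v, i⟩) = Sum.inr ⟨v, i⟩).card := by
  set D := (gadgetGraph m).neighborFinset v with hD
  set S := Finset.univ.filter fun u => m (Sum.inl (v, u)) = Sum.inl (v, u) with hS
  set T := Finset.univ.filter fun u => ∃ i, m (Sum.inl (v, u)) = Sum.inr ⟨v, i⟩ with hT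
  set C := Finset.univ.filter fun i => m (Sum.inr ⟨v, i⟩) = Sum.inr ⟨v, i⟩ with hC
  set E := Finset.univ.filter fun i => ∃ u, m (Sum.inr ⟨v, i⟩) = Sum.inl (v, u) with hE
  have hTE : E.card = T.card := by
    refine Finset.card_bij (fun i hi => (Finset.mem_filter.1 hi).2.choose) ?_ ?_ ?_
    · intro i hi
      have := (Finset.mem_filter.1 hi).2.choose_spec
      rw [hT, Finset.mem_filter]
      refine ⟨Finset.mem_univ _, i, ?_⟩
      rw [← this, hm.1]
    · intro i hi i' hi' h
      have h1 := (Finset.mem_filter.1 hi).2.choose_spec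
      have h2 := (Finset.mem_filter.1 hi').2.choose_spec
      rw [h, ← h2] at h1
      have := congrArg m h1
      simpa [hm.1] using this
    · intro u hu
      obtain ⟨-, i, hi⟩ := Finset.mem_filter.1 hu
      have hmi : m (Sum.inr ⟨v, i⟩) = Sum.inl (v, u) := by rw [← hi, hm.1]
      have hiE : i ∈ E := Finset.mem_filter.2 ⟨Finset.mem_univ _, u, hmi⟩
      refine ⟨i, hiE, ?_⟩
      have := (Finset.mem_filter.1 hiE).2.choose_spec
      simpa using (hmi.symm.trans this).symm
  have hCE : C.card + E.card = n - d v := by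
    rw [← Finset.card_union_of_disjoint]
    · have : C ∪ E = Finset.univ := by
        ext i
        simpa [hC, hE] using hm.core v i
      rw [this, Finset.card_univ, Fintype.card_fin]
    · rw [Finset.disjoint_left]
      intro i hi hi'
      obtain ⟨-, u, hu⟩ := Finset.mem_filter.1 hi'
      rw [(Finset.mem_filter.1 hi).2] at hu
      exact Sum.inr_ne_inl hu
  have hDST : D.card + S.card + T.card = n := by
    have h1 : Disjoint D S := by
      rw [Finset.disjoint_left]
      intro u hu hu'
      rw [hD, SimpleGraph.mem_neighborFinset] at hu
      have := hu.2.1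
      rw [(Finset.mem_filter.1 hu').2] at this
      have h3 := hu.1
      simp at this
      exact h3 this.1
    have h2 : Disjoint (D ∪ S) T := by
      rw [Finset.disjoint_left]
      intro u hu hu'
      obtain ⟨-, i, hi⟩ := Finset.mem_filter.1 hu'
      rcases Finset.mem_union.1 hu with hu | hu
      · rw [hD, SimpleGraph.mem_neighborFinset] at hu
        rw [hu.2.1] at hi
        exact Sum.inl_ne_inr hi
      · rw [(Finset.mem_filter.1 hu).2] at hi
        exact Sum.inl_ne_inr hi
    rw [← Finset.card_union_of_disjoint h1, ← Finset.card_union_of_disjoint h2]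
    have : D ∪ S ∪ T = Finset.univ := by
      ext u
      have := hm.stub v u
      simp only [hD, hS, hT, Finset.mem_union, SimpleGraph.mem_neighborFinset, Finset.mem_filter,
        Finset.mem_univ, true_and, iff_true]
      tauto
    rw [this, Finset.card_univ, Fintype.card_fin]
  have : (gadgetGraph m).degree v = D.card := rfl
  omega

/-- The perfect matching of the gadget given by a graph and an assignment of the cores to the
non-neighbours. -/
def gadgetLift (H : SimpleGraph (Fin n)) (g : ∀ v, Fin (n - d v) ≃ {u // ¬ H.Adj v u}) :
    Gadget d → Gadget d
  | Sum.inl p => if h : H.Adj p.1 p.2 then Sum.inl p.swap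
      else Sum.inr ⟨p.1, (g p.1).symm ⟨p.2, h⟩⟩
  | Sum.inr c => Sum.inl (c.1, g c.1 c.2)

lemma gadgetLift_mem (H : SimpleGraph (Fin n)) (g : ∀ v, Fin (n - d v) ≃ {u // ¬ H.Adj v u}) :
    gadgetLift H g ∈ perfectMatchings (gadgetRel d) := by
  rw [mem_perfectMatchings]
  refine ⟨⟨?_, ?_⟩, ?_⟩
  · rintro (⟨v, u⟩ | ⟨v, i⟩)
    · by_cases h : H.Adj v u
      · simp [gadgetLift, h, h.symm]
      · simp [gadgetLift, h]
    · simp [gadgetLift, (g v i).2]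
  · rintro (⟨v, u⟩ | ⟨v, i⟩) -
    · by_cases h : H.Adj v u
      · simp [gadgetLift, h, gadgetRel, h.ne]
      · simp [gadgetLift, h, gadgetRel]
    · simp [gadgetLift, gadgetRel]
  · rintro (⟨v, u⟩ | ⟨v, i⟩)
    · by_cases h : H.Adj v u
      · simp [gadgetLift, h, h.ne']
      · simp [gadgetLift, h]
    · simp [gadgetLift]

lemma gadgetGraph_gadgetLift (H : SimpleGraph (Fin n))
    (g : ∀ v, Fin (n - d v) ≃ {u // ¬ H.Adj v u}) : gadgetGraph (gadgetLift H g) = H := by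
  ext v u
  rw [(mem_perfectMatchings.1 (gadgetLift_mem H g)).1.gadgetGraph_adj]
  by_cases h : H.Adj v u
  · simp [gadgetLift, h, h.ne]
  · simp [gadgetLift, h]

lemma gadgetLift_injective (H : SimpleGraph (Fin n)) :
    Function.Injective (gadgetLift (d := d) H) := by
  intro g g' h
  funext v
  ext i
  have := congrFun h (Sum.inr ⟨v, i⟩)
  simp only [gadgetLift, Sum.inl.injEq, Prod.mk.injEq, true_and] at this
  exact congrArg Fin.val this

lemma card_core_eq {H : SimpleGraph (Fin n)} (hH : ∀ x, dg H x = d x) (v : Fin n) :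
    Fintype.card (Fin (n - d v)) = Fintype.card {u // ¬ H.Adj v u} := by
  rw [Fintype.card_fin, Fintype.card_subtype_compl, Fintype.card_fin, Fintype.card_subtype]
  have h := hH v
  rw [dg_eq_degree, ← SimpleGraph.card_neighborFinset_eq_degree,
    SimpleGraph.neighborFinset_eq_filter] at h
  have h' : (Finset.univ.filter fun u => H.Adj v u).card = d v := by exact_mod_cast h
  rw [h']

/-- A lift of `H` that agrees with a matching `Z` as far as possible. -/
lemma exists_gadgetLift {H : SimpleGraph (Fin n)} (hH : ∀ x, dg H x = d x)
    {Z : Gadget d → Gadget d} (hZ : IsMatching (gadgetRel d) Z) :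
    ∃ g, ∀ x, Z x ≠ gadgetLift H g x → Z x = x ∨
      ∃ p, adjFun (gadgetGraph Z) p ≠ adjFun H p ∧ (x = Sum.inl p ∨ Z x = Sum.inl p) := by
  have hg : ∀ v, ∃ g : Fin (n - d v) ≃ {u // ¬ H.Adj v u}, ∀ i u,
      Z (Sum.inr ⟨v, i⟩) = Sum.inl (v, u) → ¬ H.Adj v u → (g i).1 = u := by
    intro v
    have hne : ∀ i : Fin (n - d v), Nonempty {u // ¬ H.Adj v u} := fun i =>
      Fintype.card_pos_iff.1 (by rw [← card_core_eq hH v]; exact Fintype.card_pos_iff.2 ⟨i⟩)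
    let s : Finset (Fin (n - d v)) :=
      Finset.univ.filter fun i => ∃ u : {u // ¬ H.Adj v u}, Z (Sum.inr ⟨v, i⟩) = Sum.inl (v, u.1)
    let f : Fin (n - d v) → {u // ¬ H.Adj v u} := fun i =>
      if h : ∃ u : {u // ¬ H.Adj v u}, Z (Sum.inr ⟨v, i⟩) = Sum.inl (v, u.1) then h.choose
        else (hne i).some
    have hf : ∀ i ∈ s, Z (Sum.inr ⟨v, i⟩) = Sum.inl (v, (f i).1) := by
      intro i hi
      have h := (Finset.mem_filter.1 hi).2
      simp only [f, dif_pos h]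
      exact h.choose_spec
    -- `Z` is injective on the cores it sends to non-neighbours in `H`, so this part extends to a
    -- bijection; the default values of `f` off `s` are irrelevant.
    obtain ⟨g, hg⟩ := Finset.exists_equiv_extend_of_card_eq (s := s) (f := f)
      (t := Finset.univ) (by rw [Finset.card_univ, card_core_eq hH v]) (Finset.subset_univ _) (by
        intro i hi i' hi' h
        have h1 := hf i hi
        rw [h, ← hf i' hi'] at h1
        have := congrArg Z h1
        simpa [hZ.1] using this)
    refine ⟨g.trans (Equiv.subtypeUnivEquiv (by simp)), fun i u h1 h2 => ?_⟩
    have his : i ∈ s := Finset.mem_filter.2 ⟨Finset.mem_univ _, ⟨u, h2⟩, h1⟩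
    have h3 := hf i his
    rw [h1] at h3
    simp only [Sum.inl.injEq, Prod.mk.injEq, true_and] at h3
    simp only [Equiv.trans_apply, Equiv.subtypeUnivEquiv_apply]
    rw [hg i his, ← h3]
  choose g hg using hg
  refine ⟨g, ?_⟩
  rintro (⟨v, u⟩ | ⟨v, i⟩) hx
  · by_cases hadj : (gadgetGraph Z).Adj v u ↔ H.Adj v u
    · left
      rcases hZ.stub v u with h | h | ⟨i, h⟩
      · exact h
      · exact absurd (by simp [gadgetLift, hadj.1 h, h.2.1]) hx
      · have hna : ¬ (gadgetGraph Z).Adj v u := fun h' => by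
          rw [h'.2.1] at h
          exact Sum.inl_ne_inr h
        have hnH : ¬ H.Adj v u := fun h' => hna (hadj.2 h')
        have hgi := hg v i u (by rw [← h, hZ.1]) hnH
        refine absurd ?_ hx
        rw [h]
        simp only [gadgetLift, dif_neg hnH]
        congr
        rw [Equiv.eq_symm_apply]
        exact Subtype.ext hgi
    · exact Or.inr ⟨(v, u), fun h => hadj (iff_of_eq h), Or.inl rfl⟩
  · rcases hZ.core v i with h | ⟨u, h⟩
    · exact Or.inl h
    · by_cases hH : H.Adj v u
      · refine Or.inr ⟨(v, u), fun h' => ?_, Or.inr h⟩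
        have h2 : (gadgetGraph Z).Adj v u := (iff_of_eq h').2 hH
        have h3 := h2.2.1
        rw [← h, hZ.1] at h3
        exact Sum.inr_ne_inl h3
      · refine absurd ?_ hx
        rw [h]
        simp [gadgetLift, hg v i u h hH]

end gadget
end
end FullyGraphic

namespace FullyGraphic
open scoped Classical symmDiff
noncomputable section

/-! ### Near-perfect matchings are close to perfect ones -/

section nearPerfect

variable {n : ℕ} {d : Fin n → ℕ} {c₁ c₂ m : ℕ}

lemma card_filter_eq_or {α β : Type*} [Fintype α] [DecidableEq β] (f : α → β) {a b : β}
    (h : a ≠ b) : (Finset.univ.filter fun w => f w = a ∨ f w = b).card =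
      (Finset.univ.filter fun w => f w = a).card + (Finset.univ.filter fun w => f w = b).card := by
  rw [Finset.filter_or, Finset.card_union_of_disjoint]
  rw [Finset.disjoint_filter]
  rintro w - rfl
  exact h

lemma card_stub_eq (x : Fin n) (a : Gadget d) :
    (Finset.univ.filter fun u => (Sum.inl (x, u) : Gadget d) = a).card =
      Sum.elim (fun p => if x = p.1 then 1 else 0) (fun _ => 0) a := by
  rcases a with ⟨v, w⟩ | c
  · by_cases h : x = v
    · subst h
      simp [Finset.filter_eq']
    · simp [h]
  · simp

lemma card_core_eq_ite (x : Fin n) (a : Gadget d) :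
    (Finset.univ.filter fun i => (Sum.inr ⟨x, i⟩ : Gadget d) = a).card =
      Sum.elim (fun _ => 0) (fun c => if x = c.1 then 1 else 0) a := by
  rcases a with p | ⟨v, j⟩
  · simp
  · by_cases h : x = v
    · subst h
      simp [Finset.filter_eq']
    · simp [h]

lemma dg_gadgetGraph_of_perfect (hd : ∀ v, d v ≤ n) {M : Gadget d → Gadget d}
    (hM : M ∈ perfectMatchings (gadgetRel d)) (v : Fin n) : dg (gadgetGraph M) v = d v := by
  rw [mem_perfectMatchings] at hM
  have h := hM.1.degree_add (hd v)
  simp only [hM.2, Finset.filter_false, Finset.card_empty, add_zero] at h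
  rw [dg_eq_degree, h]

lemma CornerBound.le_card (hd : CornerBound d c₁ c₂ m) (v : Fin n) : d v ≤ n :=
  (hd.upper v).trans hd.lt.le

/-- The graph of a near-perfect matching is close to a realization. -/
lemma exists_near_graph (hd : CornerBound d c₁ c₂ m) {Z : Gadget d → Gadget d}
    (hZ : Z ∈ nearPerfectMatchings (gadgetRel d)) :
    ∃ H : SimpleGraph (Fin n), (∀ x, dg H x = d x) ∧ gdist (gadgetGraph Z) H ≤ 26 := by
  rw [mem_nearPerfectMatchings] at hZ
  obtain ⟨hm, hZ | ⟨a, b, hab, hfix⟩⟩ := hZ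
  · refine ⟨gadgetGraph Z, dg_gadgetGraph_of_perfect hd.le_card
      (mem_perfectMatchings.2 ⟨hm, hZ⟩), ?_⟩
    rw [gdist_eq_zero.2 rfl]
    omega
  · have hdeg : ∀ x, (dg (gadgetGraph Z) x : ℤ) +
        (Sum.elim (fun p => if x = p.1 then 1 else 0) (fun _ => 0) a +
          Sum.elim (fun p => if x = p.1 then 1 else 0) (fun _ => 0) b : ℕ) =
        d x + (Sum.elim (fun _ => 0) (fun c => if x = c.1 then 1 else 0) a +
          Sum.elim (fun _ => 0) (fun c => if x = c.1 then 1 else 0) b : ℕ) := by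
      intro x
      have h := hm.degree_add (hd.le_card x)
      simp only [hfix] at h
      rw [card_filter_eq_or (fun u => (Sum.inl (x, u) : Gadget d)) hab,
        card_filter_eq_or (fun i => (Sum.inr ⟨x, i⟩ : Gadget d)) hab, card_stub_eq, card_stub_eq,
        card_core_eq_ite, card_core_eq_ite] at h
      rw [dg_eq_degree]
      exact_mod_cast h
    rcases a with p | c <;> rcases b with p' | c'
    · refine exists_near_of_minus_minus (a := p.1) (b := p'.1) hd fun x => ?_
      have := hdeg x
      simp only [Sum.elim_inl] at this
      push_cast at this
      linarith
    · obtain ⟨H, h1, h2⟩ := exists_near_of_plus_minus (G := gadgetGraph Z) (a := c'.1) (b := p.1) hd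
        fun x => by
          have := hdeg x
          simp only [Sum.elim_inl, Sum.elim_inr] at this
          push_cast at this
          linarith
      exact ⟨H, h1, by omega⟩
    · obtain ⟨H, h1, h2⟩ := exists_near_of_plus_minus (G := gadgetGraph Z) (a := c.1) (b := p'.1) hd
        fun x => by
          have := hdeg x
          simp only [Sum.elim_inl, Sum.elim_inr] at this
          push_cast at this
          linarith
      exact ⟨H, h1, by omega⟩
    · obtain ⟨H, h1, h2⟩ := exists_near_of_plus_plus (G := gadgetGraph Z) (a := c.1) (b := c'.1) hd
        fun x => by
          have := hdeg x
          simp only [Sum.elim_inr] at this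
          push_cast at this
          linarith
      exact ⟨H, h1, by omega⟩

/-- A near-perfect matching is close to a perfect one. -/
lemma exists_near_perfect [DecidableEq (Gadget d)] (hd : CornerBound d c₁ c₂ m)
    {Z : Gadget d → Gadget d} (hZ : Z ∈ nearPerfectMatchings (gadgetRel d)) :
    ∃ M ∈ perfectMatchings (gadgetRel d), hammingDist Z M ≤ 54 := by
  obtain ⟨H, hH, hdist⟩ := exists_near_graph hd hZ
  rw [mem_nearPerfectMatchings] at hZ
  obtain ⟨g, hg⟩ := exists_gadgetLift hH hZ.1
  refine ⟨gadgetLift H g, gadgetLift_mem H g, ?_⟩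
  set E : Finset (Gadget d) := (Finset.univ.filter fun p =>
    adjFun (gadgetGraph Z) p ≠ adjFun H p).image Sum.inl with hE
  have hEcard : E.card ≤ 26 := Finset.card_image_le.trans hdist
  set Fx : Finset (Gadget d) := Finset.univ.filter fun x => Z x = x with hFx
  have hFcard : Fx.card ≤ 2 := by
    obtain ⟨-, h | ⟨a, b, -, h⟩⟩ := hZ
    · simp [hFx, h]
    · simp only [hFx, h]
      rw [Finset.filter_or, Finset.filter_eq', Finset.filter_eq']
      simpa using (Finset.card_le_two (a := a) (b := b))
  have hsub : (Finset.univ.filter fun x => Z x ≠ gadgetLift H g x) ⊆ Fx ∪ (E ∪ E.image Z) := by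
    intro x hx
    rw [Finset.mem_filter] at hx
    simp only [Finset.mem_union, hFx, Finset.mem_filter, Finset.mem_univ, true_and, hE,
      Finset.mem_image]
    rcases hg x hx.2 with h | ⟨p, hp, h | h⟩
    · exact Or.inl h
    · exact Or.inr (Or.inl ⟨p, hp, h.symm⟩)
    · refine Or.inr (Or.inr ⟨Sum.inl p, ⟨p, hp, rfl⟩, ?_⟩)
      rw [← h, hZ.1.1]
  have h1 := Finset.card_le_card hsub
  have h2 := Finset.card_union_le Fx (E ∪ E.image Z)
  have h3 := Finset.card_union_le E (E.image Z)
  have h4 : (E.image Z).card ≤ E.card := Finset.card_image_le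
  unfold hammingDist
  omega

lemma gdist_gadgetGraph_le [DecidableEq (Gadget d)] {M M' : Gadget d → Gadget d}
    (hM : IsMatching (gadgetRel d) M) (hM' : IsMatching (gadgetRel d) M') :
    gdist (gadgetGraph M) (gadgetGraph M') ≤ hammingDist M M' := by
  refine Finset.card_le_card_of_injOn (fun p => (Sum.inl p : Gadget d)) ?_
    (fun p _ q _ h => Sum.inl_injective h)
  rintro ⟨v, u⟩ hp
  rw [Finset.mem_coe, Finset.mem_filter] at hp ⊢
  refine ⟨Finset.mem_univ _, fun h => hp.2 (propext ?_)⟩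
  change (gadgetGraph M).Adj v u ↔ (gadgetGraph M').Adj v u
  rw [hM.gadgetGraph_adj, hM'.gadgetGraph_adj, h]

lemma card_gadget_le : Fintype.card (Gadget d) ≤ 2 * n ^ 2 := by
  rw [Fintype.card_sum, Fintype.card_prod, Fintype.card_sigma]
  simp only [Fintype.card_fin]
  have : ∑ v, (n - d v) ≤ ∑ _v : Fin n, n := Finset.sum_le_sum fun v _ => Nat.sub_le _ _
  simp at this
  nlinarith

variable (d) in
/-- The number of lifts of a realization to a perfect matching. -/
def liftCount : ℕ := ∏ v, (n - d v).factorial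

lemma liftCount_pos : 0 < liftCount d := Finset.prod_pos fun _ _ => Nat.factorial_pos _

/-- A perfect matching with graph `H` has no room to differ from the lift in `exists_gadgetLift`, so
all of them are lifts. Their number does not depend on `H`. -/
lemma card_lifts {H : SimpleGraph (Fin n)} (hH : ∀ x, dg H x = d x) :
    ((perfectMatchings (gadgetRel d)).filter fun M => gadgetGraph M = H).card = liftCount d := by
  have himg : ((perfectMatchings (gadgetRel d)).filter fun M => gadgetGraph M = H) =
      Finset.univ.image (gadgetLift (d := d) H) := by
    ext M
    rw [Finset.mem_filter, Finset.mem_image]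
    constructor
    · rintro ⟨hM, rfl⟩
      rw [mem_perfectMatchings] at hM
      obtain ⟨g, hg⟩ := exists_gadgetLift hH hM.1
      refine ⟨g, Finset.mem_univ _, ?_⟩
      funext x
      by_contra hne
      rcases hg x (Ne.symm hne) with h | ⟨p, hp, -⟩
      · exact hM.2 x h
      · exact hp rfl
    · rintro ⟨g, -, rfl⟩
      exact ⟨gadgetLift_mem H g, gadgetGraph_gadgetLift H g⟩
  rw [himg, Finset.card_image_of_injective _ (gadgetLift_injective H), Finset.card_univ,
    Fintype.card_pi]
  refine Finset.prod_congr rfl fun v _ => ?_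
  rw [Fintype.card_equiv (Fintype.equivOfCardEq (card_core_eq hH v)), Fintype.card_fin]

/-- Summation over perfect matchings is summation over realizations. -/
lemma sum_perfectMatchings (hd : ∀ v, d v ≤ n) (φ : SimpleGraph (Fin n) → ℝ) :
    ∑ M ∈ perfectMatchings (gadgetRel d), φ (gadgetGraph M) =
      liftCount d * ∑ H : Realization d, φ H.1 := by
  have hmaps : ∀ M ∈ perfectMatchings (gadgetRel d), gadgetGraph M ∈
      (Finset.univ : Finset (Realization d)).image Subtype.val := by
    intro M hM
    exact Finset.mem_image.2 ⟨Realization.mk' _ (dg_gadgetGraph_of_perfect hd hM),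
      Finset.mem_univ _, rfl⟩
  rw [← Finset.sum_fiberwise_of_maps_to hmaps, Finset.sum_image (by
    intro a _ b _ h
    exact Subtype.ext h), Finset.mul_sum]
  refine Finset.sum_congr rfl fun H _ => ?_
  rw [Finset.sum_congr rfl (g := fun _ => φ H.1)
    (fun M hM => by rw [(Finset.mem_filter.1 hM).2]), Finset.sum_const, nsmul_eq_mul,
    card_lifts (realization_dg H)]

end nearPerfect
end
end FullyGraphic

namespace FullyGraphic
open scoped Classical symmDiff
noncomputable section

/-! ### The Poincaré inequality for switches -/

section poincare

variable {n : ℕ} {d : Fin n → ℕ} {c₁ c₂ m : ℕ}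

lemma sum_comp_le_card_mul {α β : Type*} [DecidableEq β] {s : Finset α} {t : Finset β} {φ : α → β}
    {ψ : β → ℝ} {B : ℕ} (hmaps : ∀ x ∈ s, φ x ∈ t)
    (hcard : ∀ y ∈ t, (s.filter fun x => φ x = y).card ≤ B) (hψ : ∀ y ∈ t, 0 ≤ ψ y) :
    ∑ x ∈ s, ψ (φ x) ≤ B * ∑ y ∈ t, ψ y := by
  rw [← Finset.sum_fiberwise_of_maps_to hmaps, Finset.mul_sum]
  refine Finset.sum_le_sum fun y hy => ?_
  rw [Finset.sum_congr rfl (g := fun _ => ψ y) (fun x hx => by rw [(Finset.mem_filter.1 hx).2]),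
    Finset.sum_const, nsmul_eq_mul]
  exact mul_le_mul_of_nonneg_right (by exact_mod_cast hcard y hy) (hψ y hy)

/-- A function on realizations as a function on all graphs. -/
def extendFun (f : Realization d → ℝ) (G : SimpleGraph (Fin n)) : ℝ :=
  if h : ∀ x, dg G x = d x then f (Realization.mk' G h) else 0

lemma extendFun_val (f : Realization d → ℝ) (G : Realization d) : extendFun f G.1 = f G := by
  unfold extendFun
  rw [dif_pos (realization_dg G)]
  rfl

lemma sum_perfect_sq_eq (hd : ∀ v, d v ≤ n) (f : Realization d → ℝ) :
    ∑ p ∈ perfectMatchings (gadgetRel d) ×ˢ perfectMatchings (gadgetRel d),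
      (extendFun f (gadgetGraph p.1) - extendFun f (gadgetGraph p.2)) ^ 2 =
    (liftCount d : ℝ) ^ 2 * ∑ G, ∑ H, (f G - f H) ^ 2 := by
  rw [Finset.sum_product]
  simp only
  rw [Finset.sum_congr rfl fun M _ => sum_perfectMatchings hd fun G =>
    (extendFun f (gadgetGraph M) - extendFun f G) ^ 2]
  rw [sum_perfectMatchings hd fun G => liftCount d * ∑ H : Realization d,
    (extendFun f G - extendFun f H.1) ^ 2, ← Finset.mul_sum]
  simp only [extendFun_val]
  ring

lemma card_perfectMatchings (hd : ∀ v, d v ≤ n) :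
    ((perfectMatchings (gadgetRel d)).card : ℝ) = liftCount d * numRealizations d := by
  have := sum_perfectMatchings hd fun _ => 1
  simpa [numRealizations] using this

/-- Sums over pairs of close perfect matchings are dominated by sums over close realizations. -/
lemma sum_near_perfect_le (hd : ∀ v, d v ≤ n) (f : Realization d → ℝ) (c : ℕ)
    [DecidableEq (Gadget d)] :
    ∑ M ∈ perfectMatchings (gadgetRel d),
      ∑ M' ∈ (perfectMatchings (gadgetRel d)).filter fun M' => hammingDist M M' ≤ c,
        (extendFun f (gadgetGraph M) - extendFun f (gadgetGraph M')) ^ 2 ≤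
    ((Fintype.card (Gadget d) * Fintype.card (Gadget d) + 1) ^ c : ℕ) *
      (liftCount d * pairSum (nearRel c) f) := by
  set B := (Fintype.card (Gadget d) * Fintype.card (Gadget d) + 1) ^ c with hB
  have hM : ∀ M ∈ perfectMatchings (gadgetRel d),
      ∑ M' ∈ (perfectMatchings (gadgetRel d)).filter fun M' => hammingDist M M' ≤ c,
        (extendFun f (gadgetGraph M) - extendFun f (gadgetGraph M')) ^ 2 ≤
      B * ∑ H : Realization d, if gdist (gadgetGraph M) H.1 ≤ c then
        (extendFun f (gadgetGraph M) - extendFun f H.1) ^ 2 else 0 := by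
    intro M hM
    set t : Finset (SimpleGraph (Fin n)) := ((Finset.univ : Finset (Realization d)).filter
      fun H => gdist (gadgetGraph M) H.1 ≤ c).image Subtype.val with ht
    have hmaps : ∀ M' ∈ (perfectMatchings (gadgetRel d)).filter fun M' => hammingDist M M' ≤ c,
        gadgetGraph M' ∈ t := by
      intro M' hM'
      rw [Finset.mem_filter] at hM'
      refine Finset.mem_image.2 ⟨Realization.mk' _ (dg_gadgetGraph_of_perfect hd hM'.1),
        Finset.mem_filter.2 ⟨Finset.mem_univ _, ?_⟩, rfl⟩
      exact (gdist_gadgetGraph_le (mem_perfectMatchings.1 hM).1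
        (mem_perfectMatchings.1 hM'.1).1).trans hM'.2
    have h := sum_comp_le_card_mul (B := B)
      (ψ := fun G => (extendFun f (gadgetGraph M) - extendFun f G) ^ 2) hmaps (by
        intro G _
        refine card_le_of_hammingDist_le M c _ fun M' hM' => ?_
        exact (Finset.mem_filter.1 (Finset.mem_filter.1 hM').1).2) (fun _ _ => sq_nonneg _)
    refine h.trans (le_of_eq ?_)
    rw [ht, Finset.sum_image (fun a _ b _ h => Subtype.ext h), Finset.sum_filter]
  refine (Finset.sum_le_sum hM).trans (le_of_eq ?_)
  rw [← Finset.mul_sum, sum_perfectMatchings hd fun G => ∑ H : Realization d,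
    if gdist G H.1 ≤ c then (extendFun f G - extendFun f H.1) ^ 2 else 0]
  simp only [extendFun_val, pairSum]
  congr 2
  refine Finset.sum_congr rfl fun G _ => Finset.sum_congr rfl fun H _ => ?_
  by_cases h : gdist G.1 H.1 ≤ c <;> simp [h, nearRel]

/-- A retraction of the near-perfect matchings to the perfect ones that moves them little. -/
lemma exists_retraction [DecidableEq (Gadget d)] (hd : CornerBound d c₁ c₂ m) :
    ∃ Φ : (Gadget d → Gadget d) → (Gadget d → Gadget d),
      (∀ Z ∈ nearPerfectMatchings (gadgetRel d),
        Φ Z ∈ perfectMatchings (gadgetRel d) ∧ hammingDist Z (Φ Z) ≤ 54) ∧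
      ∀ M ∈ perfectMatchings (gadgetRel d), Φ M = M := by
  have h : ∀ Z, ∃ M, (Z ∈ nearPerfectMatchings (gadgetRel d) →
      M ∈ perfectMatchings (gadgetRel d) ∧ hammingDist Z M ≤ 54) ∧
      (Z ∈ perfectMatchings (gadgetRel d) → M = Z) := by
    intro Z
    by_cases h1 : Z ∈ perfectMatchings (gadgetRel d)
    · exact ⟨Z, fun _ => ⟨h1, by simp⟩, fun _ => rfl⟩
    · by_cases h2 : Z ∈ nearPerfectMatchings (gadgetRel d)
      · obtain ⟨M, hM, h⟩ := exists_near_perfect hd h2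
        exact ⟨M, fun _ => ⟨hM, h⟩, fun h => absurd h h1⟩
      · exact ⟨Z, fun h => absurd h h2, fun _ => rfl⟩
  choose Φ hΦ using h
  exact ⟨Φ, fun Z => (hΦ Z).1, fun Z => (hΦ Z).2⟩

section retraction

variable {r : ℕ} [DecidableEq (Gadget d)] {Φ : (Gadget d → Gadget d) → (Gadget d → Gadget d)}

lemma card_retraction_fiber_le
    (hΦ : ∀ Z ∈ nearPerfectMatchings (gadgetRel d),
      Φ Z ∈ perfectMatchings (gadgetRel d) ∧ hammingDist Z (Φ Z) ≤ r)
    (M : Gadget d → Gadget d) :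
    ((nearPerfectMatchings (gadgetRel d)).filter fun Z => Φ Z = M).card ≤
      (Fintype.card (Gadget d) * Fintype.card (Gadget d) + 1) ^ r := by
  refine card_le_of_hammingDist_le M r _ fun Z hZ => ?_
  obtain ⟨h1, rfl⟩ := Finset.mem_filter.1 hZ
  rw [hammingDist_comm]
  exact (hΦ Z h1).2

/-- The fibres of `Φ` lie in Hamming balls of radius `r`. This polynomial bound is what stability
contributes to mixing. -/
lemma card_nearPerfectMatchings_le
    (hΦ : ∀ Z ∈ nearPerfectMatchings (gadgetRel d),
      Φ Z ∈ perfectMatchings (gadgetRel d) ∧ hammingDist Z (Φ Z) ≤ r)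
    (hd : ∀ v, d v ≤ n) :
    ((nearPerfectMatchings (gadgetRel d)).card : ℝ) ≤
      ((Fintype.card (Gadget d) * Fintype.card (Gadget d) + 1 : ℕ) : ℝ) ^ r *
        (liftCount d * numRealizations d) := by
  have h := sum_comp_le_card_mul (s := nearPerfectMatchings (gadgetRel d)) (φ := Φ)
    (ψ := fun _ => 1) (fun Z hZ => (hΦ Z hZ).1) (fun M _ => card_retraction_fiber_le hΦ M)
    (fun _ _ => zero_le_one)
  simp only [Finset.sum_const, nsmul_eq_mul, mul_one] at h
  rw [card_perfectMatchings hd, Nat.cast_pow] at h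
  exact h

/-- Local sums over near-perfect matchings are dominated by sums over close realizations. -/
lemma sum_localSum_le
    (hΦ : ∀ Z ∈ nearPerfectMatchings (gadgetRel d),
      Φ Z ∈ perfectMatchings (gadgetRel d) ∧ hammingDist Z (Φ Z) ≤ r)
    (hd : ∀ v, d v ≤ n) (f : Realization d → ℝ) :
    ∑ Z ∈ nearPerfectMatchings (gadgetRel d),
      localSum (gadgetRel d) (fun Z => extendFun f (gadgetGraph (Φ Z))) Z ≤
    ((Fintype.card (Gadget d) * Fintype.card (Gadget d) + 1 : ℕ) : ℝ) ^ (r + r) *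
      (((Fintype.card (Gadget d) * Fintype.card (Gadget d) + 1 : ℕ) : ℝ) ^ (r + 3 + r) *
        (liftCount d * pairSum (nearRel (r + 3 + r)) f)) := by
  have hfib := card_retraction_fiber_le hΦ
  set 𝓜 := perfectMatchings (gadgetRel d) with h𝓜
  set Ω := nearPerfectMatchings (gadgetRel d) with hΩ
  set b : ℕ := Fintype.card (Gadget d) * Fintype.card (Gadget d) + 1 with hb
  set ψ : (Gadget d → Gadget d) × (Gadget d → Gadget d) → ℝ := fun p =>
    (extendFun f (gadgetGraph p.1) - extendFun f (gadgetGraph p.2)) ^ 2 with hψ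
  have e1 : ∑ Z ∈ Ω, localSum (gadgetRel d) (fun Z => extendFun f (gadgetGraph (Φ Z))) Z =
      ∑ q ∈ (Ω ×ˢ Ω).filter (fun q => hammingDist q.1 q.2 ≤ 3), ψ (Φ q.1, Φ q.2) := by
    rw [Finset.sum_filter, Finset.sum_product]
    refine Finset.sum_congr rfl fun Z _ => ?_
    unfold localSum
    rw [Finset.sum_filter]
    refine Finset.sum_congr rfl fun Z' _ => ?_
    simp only [hψ]
    congr!
  -- Retracting both ends turns a local move into one of size at most `r + 3 + r`, and a pair of
  -- perfect matchings has at most `b ^ (r + r)` preimages.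
  have e2 := sum_comp_le_card_mul (s := (Ω ×ˢ Ω).filter (fun q => hammingDist q.1 q.2 ≤ 3))
    (t := (𝓜 ×ˢ 𝓜).filter (fun q => hammingDist q.1 q.2 ≤ r + 3 + r))
    (φ := fun q => (Φ q.1, Φ q.2)) (ψ := ψ) (B := b ^ (r + r)) (by
      rintro ⟨Z, Z'⟩ hq
      rw [Finset.mem_filter, Finset.mem_product] at hq ⊢
      obtain ⟨⟨h1, h2⟩, h3⟩ := hq
      dsimp only at h1 h2 h3 ⊢
      refine ⟨⟨(hΦ Z h1).1, (hΦ Z' h2).1⟩, ?_⟩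
      have h4 := hammingDist_triangle (Φ Z) Z (Φ Z')
      have h5 := hammingDist_triangle Z Z' (Φ Z')
      have h6 := (hΦ Z h1).2
      have h7 := (hΦ Z' h2).2
      rw [hammingDist_comm] at h6
      omega) (by
      rintro ⟨M, M'⟩ -
      have hsub : (((Ω ×ˢ Ω).filter (fun q => hammingDist q.1 q.2 ≤ 3)).filter
          fun q => (Φ q.1, Φ q.2) = (M, M')) ⊆
          (Ω.filter fun Z => Φ Z = M) ×ˢ (Ω.filter fun Z => Φ Z = M') := by
        rintro ⟨Z, Z'⟩ hq
        simp only [Finset.mem_filter, Finset.mem_product, Prod.mk.injEq] at hq ⊢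
        exact ⟨⟨hq.1.1.1, hq.2.1⟩, hq.1.1.2, hq.2.2⟩
      refine (Finset.card_le_card hsub).trans ?_
      rw [Finset.card_product, pow_add]
      exact Nat.mul_le_mul (hfib M) (hfib M')) (fun _ _ => sq_nonneg _)
  have e3 := sum_near_perfect_le hd f (r + 3 + r)
  have e4 : ∑ q ∈ (𝓜 ×ˢ 𝓜).filter (fun q => hammingDist q.1 q.2 ≤ r + 3 + r), ψ q =
      ∑ M ∈ 𝓜, ∑ M' ∈ 𝓜.filter fun M' => hammingDist M M' ≤ r + 3 + r,
        (extendFun f (gadgetGraph M) - extendFun f (gadgetGraph M')) ^ 2 := by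
    rw [Finset.sum_filter, Finset.sum_product]
    refine Finset.sum_congr rfl fun M _ => ?_
    rw [Finset.sum_filter]
  rw [e1]
  refine e2.trans ?_
  rw [e4, Nat.cast_pow]
  rw [Nat.cast_pow] at e3
  exact mul_le_mul_of_nonneg_left e3 (by positivity)

end retraction

/-- The factor in the comparison of the variance with the sum over switches. -/
def poincareBound {R : Type*} [CommSemiring R] (x : R) : R :=
  -- For `r = 54` the exponents are `111 = 54 + 3 + 54` and `273 = 54 + 108 + 111`. The semiring is
  -- arbitrary so that the same expression serves as number and as polynomial.
  3 * (2 * x ^ 2 + 2) * (2 * x ^ 2) ^ 7 * ((2 * x ^ 2) * (2 * x ^ 2) + 1) ^ 273 *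
    (8 * (2 * x ^ 2 + 1) ^ 8) ^ 111

lemma map_poincareBound {R S : Type*} [CommSemiring R] [CommSemiring S] (φ : R →+* S) (x : R) :
    φ (poincareBound x) = poincareBound (φ x) := by
  simp only [poincareBound, map_mul, map_add, map_pow, map_ofNat, map_one]

/-- The number `K` of near-perfect matchings and the local sum `L` each bring one factor `W`, the
number of lifts, which cancels `W ^ 2` on the left. -/
lemma le_of_chain {S L P Q W R N K b a x y : ℝ} {r s t : ℕ} (hW : 0 < W) (hN : 0 ≤ N) (hR : 0 ≤ R)
    (hP : 0 ≤ P) (hb : 0 ≤ b) (ha : 0 ≤ a) (hL : 0 ≤ L)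
    (hmain : W ^ 2 * S ≤ 3 * (N + 2) * N ^ 7 * K * L) (hKle : K ≤ b ^ r * (W * R))
    (hLle : L ≤ b ^ s * (b ^ t * (W * Q))) (hQle : Q ≤ a ^ t * P) (hNx : N ≤ x) (hby : b ≤ y) :
    S ≤ 3 * (x + 2) * x ^ 7 * y ^ (r + s + t) * a ^ t * R * P := by
  have hx : 0 ≤ x := hN.trans hNx
  have hy : 0 ≤ y := hb.trans hby
  refine le_of_mul_le_mul_left ?_ (show 0 < W ^ 2 by positivity)
  calc W ^ 2 * S ≤ 3 * (N + 2) * N ^ 7 * K * L := hmain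
    _ ≤ 3 * (N + 2) * N ^ 7 * (b ^ r * (W * R)) * (b ^ s * (b ^ t * (W * Q))) := by gcongr
    _ ≤ 3 * (N + 2) * N ^ 7 * (b ^ r * (W * R)) * (b ^ s * (b ^ t * (W * (a ^ t * P)))) := by
        gcongr
    _ = W ^ 2 * (3 * (N + 2) * N ^ 7 * b ^ (r + s + t) * a ^ t * R * P) := by ring
    _ ≤ W ^ 2 * (3 * (x + 2) * x ^ 7 * y ^ (r + s + t) * a ^ t * R * P) := by gcongr

/-- A Poincaré inequality for the graph of switches, in terms of a retraction. -/
lemma sum_sq_le_of_retraction {r : ℕ} (hd : ∀ v, d v ≤ n)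
    {Φ : (Gadget d → Gadget d) → (Gadget d → Gadget d)}
    (hΦ : ∀ Z ∈ nearPerfectMatchings (gadgetRel d),
      Φ Z ∈ perfectMatchings (gadgetRel d) ∧ hammingDist Z (Φ Z) ≤ r)
    (hΦid : ∀ M ∈ perfectMatchings (gadgetRel d), Φ M = M) (f : Realization d → ℝ) :
    ∑ G, ∑ H, (f G - f H) ^ 2 ≤ 3 * (2 * (n : ℝ) ^ 2 + 2) * (2 * (n : ℝ) ^ 2) ^ 7 *
      ((2 * (n : ℝ) ^ 2) * (2 * (n : ℝ) ^ 2) + 1) ^ (r + (r + r) + (r + 3 + r)) *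
      (8 * (2 * (n : ℝ) ^ 2 + 1) ^ 8) ^ (r + 3 + r) * numRealizations d *
      pairSum switchRel f := by
  have hΩcard := card_nearPerfectMatchings_le hΦ hd
  have hloc := sum_localSum_le hΦ hd f
  have hmain := sum_perfect_sq_le_localSum (gadgetRel d) fun Z => extendFun f (gadgetGraph (Φ Z))
  set 𝓜 := perfectMatchings (gadgetRel d) with h𝓜
  set Ω := nearPerfectMatchings (gadgetRel d) with hΩ
  set N := Fintype.card (Gadget d) with hN
  set b : ℕ := N * N + 1 with hb
  set W : ℝ := ((liftCount d : ℕ) : ℝ) with hW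
  set R : ℝ := ((numRealizations d : ℕ) : ℝ) with hR
  have e5 : ∑ p ∈ 𝓜 ×ˢ 𝓜, (extendFun f (gadgetGraph (Φ p.1)) - extendFun f (gadgetGraph (Φ p.2))) ^ 2
      = W ^ 2 * ∑ G, ∑ H, (f G - f H) ^ 2 := by
    rw [← sum_perfect_sq_eq hd]
    refine Finset.sum_congr rfl fun p hp => ?_
    rw [Finset.mem_product] at hp
    rw [hΦid _ hp.1, hΦid _ hp.2]
  rw [e5] at hmain
  set S := ∑ G, ∑ H, (f G - f H) ^ 2 with hS
  have hW0 : 0 < W := Nat.cast_pos.2 liftCount_pos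
  have hR0 : 0 ≤ R := Nat.cast_nonneg _
  have hP0 := pairSum_nonneg (switchRel (d := d)) f
  have hN' : (N : ℝ) ≤ 2 * (n : ℝ) ^ 2 := by exact_mod_cast card_gadget_le (d := d)
  have hNb : (b : ℝ) ≤ (2 * (n : ℝ) ^ 2) * (2 * (n : ℝ) ^ 2) + 1 := by
    rw [hb]
    push_cast
    gcongr
  have hnear := pairSum_near_le (r + 3 + r) f
  have hloc0 : 0 ≤ ∑ Z ∈ Ω, localSum (gadgetRel d) (fun Z => extendFun f (gadgetGraph (Φ Z))) Z :=
    Finset.sum_nonneg fun _ _ => localSum_nonneg _ _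
  have ha : ((8 * (2 * n ^ 2 + 1) ^ 8 : ℕ) : ℝ) = 8 * (2 * (n : ℝ) ^ 2 + 1) ^ 8 := by
    push_cast
    ring
  rw [ha] at hnear
  exact le_of_chain hW0 (Nat.cast_nonneg N) hR0 hP0 (Nat.cast_nonneg b)
    (by positivity) hloc0 hmain hΩcard hloc hnear hN' hNb

/-- A Poincaré inequality for the graph of switches. -/
theorem sum_sq_le_pairSum_switchRel (hd : CornerBound d c₁ c₂ m) (f : Realization d → ℝ) :
    ∑ G, ∑ H, (f G - f H) ^ 2 ≤
      poincareBound (n : ℝ) * numRealizations d * pairSum switchRel f := by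
  obtain ⟨Φ, hΦ, hΦid⟩ := exists_retraction hd
  exact sum_sq_le_of_retraction hd.le_card hΦ hΦid f

end poincare
end
end FullyGraphic

namespace FullyGraphic
open scoped Classical symmDiff
noncomputable section

/-! ### The number of switches of a graph -/

section count

variable {n : ℕ} {d : Fin n → ℕ}

/-- The edges of the 4-cycle through the points of `τ`. -/
def cycleEdges (τ : Fin 4 → Fin n) : Set (Sym2 (Fin n)) := {e | ∃ i, e = s(τ i, τ (i + 1))}

lemma mem_cycleEdges {τ : Fin 4 → Fin n} {e : Sym2 (Fin n)} :
    e ∈ cycleEdges τ ↔ e = s(τ 0, τ 1) ∨ e = s(τ 1, τ 2) ∨ e = s(τ 2, τ 3) ∨ e = s(τ 3, τ 0) := by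
  constructor
  · rintro ⟨i, rfl⟩
    fin_cases i
    · exact Or.inl rfl
    · exact Or.inr (Or.inl rfl)
    · exact Or.inr (Or.inr (Or.inl rfl))
    · exact Or.inr (Or.inr (Or.inr rfl))
  · rintro (h | h | h | h)
    · exact ⟨0, h⟩
    · exact ⟨1, h⟩
    · exact ⟨2, h⟩
    · exact ⟨3, h⟩

lemma IsSwitch.exists_cycle {G H : SimpleGraph (Fin n)} (h : IsSwitch G H) :
    ∃ τ : Fin 4 ↪ Fin n, H.edgeSet = G.edgeSet ∆ cycleEdges τ := by
  obtain ⟨v₁, w₁, v₂, w₂, h1, h2, h3, h4, h5, h6, hH⟩ := h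
  have h7 : v₁ ≠ v₂ := by
    rintro rfl
    exact h6 h1
  have h8 : w₁ ≠ w₂ := by
    rintro rfl
    exact h5 h1
  refine ⟨⟨![v₁, w₁, v₂, w₂], ?_⟩, ?_⟩
  · have h9 := h1.ne
    have h10 := h2.ne
    intro i j hij
    fin_cases i <;> fin_cases j <;> simp_all [eq_comm]
  · rw [hH]
    ext e
    simp only [Set.mem_union, Set.mem_sdiff, Set.mem_insert_iff, Set.mem_singleton_iff,
      Set.mem_symmDiff, mem_cycleEdges]
    change _ ↔ (e ∈ G.edgeSet ∧ ¬ (e = s(v₁, w₁) ∨ e = s(w₁, v₂) ∨ e = s(v₂, w₂) ∨ e = s(w₂, v₁)))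
      ∨ ((e = s(v₁, w₁) ∨ e = s(w₁, v₂) ∨ e = s(v₂, w₂) ∨ e = s(w₂, v₁)) ∧ e ∉ G.edgeSet)
    rw [Sym2.eq_swap (a := w₁) (b := v₂), Sym2.eq_swap (a := w₂) (b := v₁)]
    have g1 : e = s(v₁, w₁) → e ∈ G.edgeSet := by
      rintro rfl
      exact h1
    have g2 : e = s(v₂, w₂) → e ∈ G.edgeSet := by
      rintro rfl
      exact h2
    have g3 : e = s(v₁, w₂) → e ∉ G.edgeSet := by
      rintro rfl
      exact h5
    have g4 : e = s(v₂, w₁) → e ∉ G.edgeSet := by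
      rintro rfl
      exact h6
    clear * - g1 g2 g3 g4
    tauto

/-- The eight symmetries of a 4-cycle. -/
def cycleSymm (b : Bool) (k i : Fin 4) : Fin 4 := if b then k + i else k - i

lemma cycleSymm_injective (b : Bool) (k : Fin 4) : Function.Injective (cycleSymm b k) := by
  revert b k
  decide

lemma cycleEdges_symm (τ : Fin 4 → Fin n) (b : Bool) (k : Fin 4) :
    cycleEdges (τ ∘ cycleSymm b k) = cycleEdges τ := by
  ext e
  cases b
  · constructor
    · rintro ⟨i, rfl⟩
      refine ⟨k - i - 1, ?_⟩
      have h1 : k - i - 1 + 1 = k - i := by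
        clear * -
        revert i k
        decide
      have h2 : k - (i + 1) = k - i - 1 := by
        clear * -
        revert i k
        decide
      simp only [Function.comp, cycleSymm, h1, h2, Bool.false_eq_true, if_false]
      exact Sym2.eq_swap
    · rintro ⟨i, rfl⟩
      refine ⟨k - i - 1, ?_⟩
      have h1 : k - (k - i - 1) = i + 1 := by
        clear * -
        revert i k
        decide
      have h2 : k - (k - i - 1 + 1) = i := by
        clear * -
        revert i k
        decide
      simp only [Function.comp, cycleSymm, h1, h2, Bool.false_eq_true, if_false]
      exact Sym2.eq_swap
  · constructor
    · rintro ⟨i, rfl⟩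
      refine ⟨k + i, ?_⟩
      have h1 : k + (i + 1) = k + i + 1 := by
        clear * -
        revert i k
        decide
      simp only [Function.comp, cycleSymm, h1, if_true]
    · rintro ⟨i, rfl⟩
      refine ⟨i - k, ?_⟩
      have h1 : k + (i - k) = i := by
        clear * -
        revert i k
        decide
      have h2 : k + (i - k + 1) = i + 1 := by
        clear * -
        revert i k
        decide
      simp only [Function.comp, cycleSymm, h1, h2, if_true]

/-- A graph has at most `3 * choose n 4` switches. -/
lemma card_switch_le (G : SimpleGraph (Fin n)) (s : Finset (SimpleGraph (Fin n)))
    (hs : ∀ H ∈ s, IsSwitch G H) : s.card ≤ 3 * n.choose 4 := by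
  have hτ : ∀ H : s, ∃ τ : Fin 4 ↪ Fin n, H.1.edgeSet = G.edgeSet ∆ cycleEdges τ :=
    fun H => (hs H.1 H.2).exists_cycle
  choose τ hτ using hτ
  -- The cycle determines `H`, so the eight parametrizations of the cycles of distinct switches are
  -- all distinct: `8 * |s| ≤ 24 * choose n 4`.
  let φ : s × Bool × Fin 4 → (Fin 4 ↪ Fin n) := fun p =>
    (⟨cycleSymm p.2.1 p.2.2, cycleSymm_injective _ _⟩ : Fin 4 ↪ Fin 4).trans (τ p.1)
  have hφ : Function.Injective φ := by
    rintro ⟨H, b, k⟩ ⟨H', b', k'⟩ h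
    have h' : τ H ∘ cycleSymm b k = τ H' ∘ cycleSymm b' k' := congrArg DFunLike.coe h
    have hc : cycleEdges (τ H) = cycleEdges (τ H') := by
      rw [← cycleEdges_symm (τ H) b k, ← cycleEdges_symm (τ H') b' k', h']
    have hHH : H = H' := by
      apply Subtype.ext
      apply SimpleGraph.edgeSet_injective
      rw [hτ, hτ, hc]
    subst hHH
    have hb : ∀ i, cycleSymm b k i = cycleSymm b' k' i := fun i => (τ H).injective (congrFun h' i)
    have hdec : ∀ (b b' : Bool) (k k' : Fin 4), (∀ i, cycleSymm b k i = cycleSymm b' k' i) →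
        b = b' ∧ k = k' := by decide
    obtain ⟨rfl, rfl⟩ := hdec b b' k k' hb
    rfl
  have := Fintype.card_le_of_injective φ hφ
  rw [Fintype.card_embedding_eq, Fintype.card_prod, Fintype.card_prod, Fintype.card_bool,
    Fintype.card_fin, Fintype.card_fin, Fintype.card_coe, Nat.descFactorial_eq_factorial_mul_choose,
    show Nat.factorial 4 = 24 by rfl] at this
  omega

lemma IsSwitch.choose_pos {G H : SimpleGraph (Fin n)} (h : IsSwitch G H) : 0 < n.choose 4 := by
  have := card_switch_le G {H} (by simpa using h)
  rw [Finset.card_singleton] at this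
  omega

end count

/-! ### The switch chain as an operator -/

section chain

variable {n : ℕ} {d : Fin n → ℕ}

lemma switchProb_nonneg (G H : SimpleGraph (Fin n)) : 0 ≤ switchProb G H := by
  unfold switchProb
  split_ifs <;> positivity

lemma switchProb_comm (G H : SimpleGraph (Fin n)) : switchProb G H = switchProb H G := by
  unfold switchProb
  rw [show IsSwitch G H ↔ IsSwitch H G from ⟨IsSwitch.symm, IsSwitch.symm⟩]

lemma sum_switchProb_le (G : Realization d) : ∑ K : Realization d, switchProb G.1 K.1 ≤ 1 / 2 := by
  unfold switchProb
  rw [← Finset.sum_filter, Finset.sum_const, nsmul_eq_mul]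
  set s := (Finset.univ : Finset (Realization d)).filter fun K => IsSwitch G.1 K.1 with hs
  have h := card_switch_le G.1 (s.image Subtype.val) (by
    intro H hH
    obtain ⟨K, hK, rfl⟩ := Finset.mem_image.1 hH
    exact (Finset.mem_filter.1 hK).2)
  rw [Finset.card_image_of_injective _ Subtype.val_injective] at h
  -- For `n < 4` the probability `1 / 0` is `0` by convention.
  by_cases h0 : n.choose 4 = 0
  · rw [h0]
    norm_num
  · have h0' : (0 : ℝ) < n.choose 4 := by exact_mod_cast Nat.pos_of_ne_zero h0
    have h1 : (s.card : ℝ) ≤ 3 * n.choose 4 := by exact_mod_cast h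
    rw [mul_one_div, div_le_iff₀ (by positivity)]
    linarith

lemma sum_switchMatrix_mul (f : Realization d → ℝ) (G : Realization d) :
    ∑ H, switchMatrix d G H * f H = f G + ∑ H, switchProb G.1 H.1 * (f H - f G) := by
  rw [← Finset.add_sum_erase _ _ (Finset.mem_univ G)]
  have h1 : ∑ H ∈ Finset.univ.erase G, switchMatrix d G H * f H =
      ∑ H ∈ Finset.univ.erase G, switchProb G.1 H.1 * f H := by
    refine Finset.sum_congr rfl fun H hH => ?_
    have : G ≠ H := (Finset.ne_of_mem_erase hH).symm
    simp only [switchMatrix, if_neg this]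
  have h2 : switchMatrix d G G = 1 - ∑ K ∈ Finset.univ.erase G, switchProb G.1 K.1 := by
    simp only [switchMatrix, if_true]
  have h3 : ∑ H : Realization d, switchProb G.1 H.1 * (f H - f G) =
      ∑ H ∈ Finset.univ.erase G, switchProb G.1 H.1 * (f H - f G) := by
    rw [← Finset.add_sum_erase _ _ (Finset.mem_univ G)]
    simp
  rw [h1, h2, h3]
  simp only [mul_sub, Finset.sum_sub_distrib, ← Finset.sum_mul]
  ring

lemma switchMatrix_comm (G H : Realization d) : switchMatrix d G H = switchMatrix d H G := by
  by_cases h : G = H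
  · rw [h]
  · simp only [switchMatrix, if_neg h, if_neg (Ne.symm h)]
    exact switchProb_comm _ _

/-- The action of the switch chain on functions. -/
def chainStep (f : Realization d → ℝ) (G : Realization d) : ℝ := ∑ H, switchMatrix d G H * f H

/-- The Dirichlet form, up to a factor. -/
def switchEnergy (f : Realization d → ℝ) : ℝ :=
  ∑ G : Realization d, ∑ H : Realization d, switchProb G.1 H.1 * (f G - f H) ^ 2

lemma sum_chainStep (f : Realization d → ℝ) : ∑ G, chainStep f G = ∑ G, f G := by
  unfold chainStep
  simp only [sum_switchMatrix_mul, Finset.sum_add_distrib]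
  have h : ∑ G : Realization d, ∑ H : Realization d, switchProb G.1 H.1 * (f H - f G) =
      - ∑ G : Realization d, ∑ H : Realization d, switchProb G.1 H.1 * (f H - f G) := by
    conv_lhs => rw [Finset.sum_comm]
    rw [← Finset.sum_neg_distrib]
    refine Finset.sum_congr rfl fun G _ => ?_
    rw [← Finset.sum_neg_distrib]
    refine Finset.sum_congr rfl fun H _ => ?_
    rw [switchProb_comm]
    ring
  linarith

/-- With `P` the chain and `E` its energy, `‖Pf‖² = ‖f‖² - E + ‖Pf - f‖²`. The last term is at most
`E / 2` by Cauchy–Schwarz, as a state is left with probability at most `1 / 2`. So laziness replaces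
any discussion of negative eigenvalues. -/
lemma sum_sq_chainStep_le (f : Realization d → ℝ) :
    ∑ G, chainStep f G ^ 2 ≤ ∑ G, f G ^ 2 - switchEnergy f / 2 := by
  have hpt : ∀ G : Realization d, chainStep f G ^ 2 ≤ f G ^ 2 +
      ∑ H : Realization d, 2 * (switchProb G.1 H.1 * (f G * (f H - f G))) +
      (∑ H : Realization d, switchProb G.1 H.1 * (f G - f H) ^ 2) / 2 := by
    intro G
    rw [chainStep, sum_switchMatrix_mul]
    have hcs := Finset.sum_mul_sq_le_sq_mul_sq Finset.univ
      (fun H : Realization d => Real.sqrt (switchProb G.1 H.1))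
      (fun H : Realization d => Real.sqrt (switchProb G.1 H.1) * (f H - f G))
    simp only [mul_pow, Real.sq_sqrt (switchProb_nonneg _ _), ← mul_assoc,
      Real.mul_self_sqrt (switchProb_nonneg _ _)] at hcs
    have h1 := sum_switchProb_le G
    have h2 : 0 ≤ ∑ H : Realization d, switchProb G.1 H.1 * (f H - f G) ^ 2 :=
      Finset.sum_nonneg fun H _ => mul_nonneg (switchProb_nonneg _ _) (sq_nonneg _)
    have h3 := mul_le_mul_of_nonneg_right h1 h2
    have h4 : ∑ H : Realization d, switchProb G.1 H.1 * (f G - f H) ^ 2 =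
        ∑ H : Realization d, switchProb G.1 H.1 * (f H - f G) ^ 2 :=
      Finset.sum_congr rfl fun H _ => by ring
    have h5 : ∑ H : Realization d, 2 * (switchProb G.1 H.1 * (f G * (f H - f G))) =
        2 * f G * ∑ H : Realization d, switchProb G.1 H.1 * (f H - f G) := by
      rw [Finset.mul_sum]
      exact Finset.sum_congr rfl fun H _ => by ring
    rw [h4, h5]
    nlinarith
  have hsymm : ∑ G : Realization d, ∑ H : Realization d,
      2 * (switchProb G.1 H.1 * (f G * (f H - f G))) = - switchEnergy f := by
    have h : ∑ G : Realization d, ∑ H : Realization d, switchProb G.1 H.1 * (f G * (f H - f G)) =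
        ∑ G : Realization d, ∑ H : Realization d, switchProb G.1 H.1 * (f H * (f G - f H)) := by
      rw [Finset.sum_comm]
      refine Finset.sum_congr rfl fun G _ => Finset.sum_congr rfl fun H _ => ?_
      rw [switchProb_comm]
    have h' : - switchEnergy f = ∑ G : Realization d, ∑ H : Realization d,
        switchProb G.1 H.1 * (f G * (f H - f G)) +
        ∑ G : Realization d, ∑ H : Realization d, switchProb G.1 H.1 * (f H * (f G - f H)) := by
      rw [switchEnergy, ← Finset.sum_neg_distrib, ← Finset.sum_add_distrib]
      refine Finset.sum_congr rfl fun G _ => ?_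
      rw [← Finset.sum_neg_distrib, ← Finset.sum_add_distrib]
      exact Finset.sum_congr rfl fun H _ => by ring
    simp only [← Finset.mul_sum]
    linarith
  refine (Finset.sum_le_sum fun G _ => hpt G).trans (le_of_eq ?_)
  rw [Finset.sum_add_distrib, Finset.sum_add_distrib, hsymm, ← Finset.sum_div]
  simp only [switchEnergy]
  ring

lemma pairSum_switchRel_le (f : Realization d → ℝ) :
    pairSum switchRel f ≤ 6 * (n : ℝ) ^ 4 * switchEnergy f := by
  unfold pairSum switchEnergy
  rw [Finset.mul_sum]
  refine Finset.sum_le_sum fun G _ => ?_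
  rw [Finset.mul_sum]
  refine Finset.sum_le_sum fun H _ => ?_
  unfold switchRel switchProb
  by_cases h : IsSwitch G.1 H.1
  · have h0 : (0 : ℝ) < n.choose 4 := by exact_mod_cast h.choose_pos
    have h1 : (n.choose 4 : ℝ) ≤ (n : ℝ) ^ 4 := by exact_mod_cast Nat.choose_le_pow n 4
    rw [if_pos h, if_pos h, ← mul_assoc]
    refine le_mul_of_one_le_left (sq_nonneg _) ?_
    rw [mul_one_div, one_le_div (by positivity)]
    linarith
  · rw [if_neg h, if_neg h]
    simp

end chain
end
end FullyGraphic

namespace FullyGraphic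
open scoped Classical symmDiff
noncomputable section

/-! ### Contraction and the mixing time -/

section mixing

variable {n : ℕ} {d : Fin n → ℕ} {c₁ c₂ m : ℕ}

/-- A bound for the relaxation time of the switch chain. -/
def relaxBound {R : Type*} [CommSemiring R] (x : R) : R := 6 * x ^ 4 * poincareBound x + 1

lemma poincareBound_nonneg (n : ℕ) : 0 ≤ poincareBound (n : ℝ) := by
  unfold poincareBound
  positivity

lemma sum_sub_sq {Ω : Type*} [Fintype Ω] (f : Ω → ℝ) (hf : ∑ G, f G = 0) :
    ∑ G, ∑ H, (f G - f H) ^ 2 = 2 * Fintype.card Ω * ∑ G, f G ^ 2 := by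
  have h : ∀ G, ∑ H, (f G - f H) ^ 2 = Fintype.card Ω * f G ^ 2 + ∑ H, f H ^ 2 := by
    intro G
    have : ∀ H, (f G - f H) ^ 2 = f G ^ 2 - 2 * f G * f H + f H ^ 2 := fun H => by ring
    simp only [this, Finset.sum_add_distrib, Finset.sum_sub_distrib, ← Finset.mul_sum, hf]
    simp
  simp only [h, Finset.sum_add_distrib, ← Finset.mul_sum]
  simp
  ring

lemma one_le_relaxBound (n : ℕ) : 1 ≤ relaxBound (n : ℝ) :=
  le_add_of_nonneg_left
    (mul_nonneg (mul_nonneg (by norm_num) (pow_nonneg (Nat.cast_nonneg n) 4))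
      (poincareBound_nonneg n))

/-- `h1` and `h2` give `A ≤ 3 * y * K * E`, so the loss `E / 2` in `h3` is a fixed proportion of
`A`. -/
lemma le_mul_of_energy {A B E K P R y : ℝ} (hR : 0 < R) (hK : 0 ≤ K) (hE : 0 ≤ E) (hy : 0 ≤ y)
    (h1 : 2 * R * A ≤ K * R * P) (h2 : P ≤ 6 * y * E) (h3 : B ≤ A - E / 2) :
    B ≤ (1 - 1 / (6 * y * K + 1)) * A := by
  have h4 : A ≤ 3 * y * K * E := by
    have h5 : R * A ≤ R * (3 * y * K * E) := by
      have h6 := mul_le_mul_of_nonneg_left h2 (mul_nonneg hK hR.le)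
      linarith
    exact le_of_mul_le_mul_left h5 hR
  have hΛ : 0 < 6 * y * K + 1 := by positivity
  have h7 : 1 / (6 * y * K + 1) * A ≤ E / 2 := by
    rw [one_div, inv_mul_le_iff₀ hΛ]
    linarith
  linarith

/-- The switch chain contracts functions of mean zero. -/
lemma sum_sq_chainStep_le_mul (hd : CornerBound d c₁ c₂ m) (f : Realization d → ℝ)
    (hf : ∑ G, f G = 0) :
    ∑ G, chainStep f G ^ 2 ≤ (1 - 1 / relaxBound (n : ℝ)) * ∑ G, f G ^ 2 := by
  rcases isEmpty_or_nonempty (Realization d) with h | h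
  · simp
  · have h1 := sum_sq_le_pairSum_switchRel hd f
    rw [sum_sub_sq f hf] at h1
    exact le_mul_of_energy (Nat.cast_pos.2 Fintype.card_pos) (poincareBound_nonneg n)
      (Finset.sum_nonneg fun G _ => Finset.sum_nonneg fun H _ =>
        mul_nonneg (switchProb_nonneg _ _) (sq_nonneg _)) (pow_nonneg (Nat.cast_nonneg n) 4) h1
      (pairSum_switchRel_le f) (sum_sq_chainStep_le f)

/-- The deviation of the distribution after `t` steps from the uniform distribution. -/
def deviation (d : Fin n → ℕ) (t : ℕ) (G H : Realization d) : ℝ :=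
  (switchMatrix d ^ t) G H - 1 / (numRealizations d : ℝ)

/-- Distributions are row vectors, but the matrix is symmetric, so they evolve by the operator that
acts on functions, and constants are preserved. -/
lemma deviation_succ (t : ℕ) (G : Realization d) :
    deviation d (t + 1) G = chainStep (deviation d t G) := by
  funext H
  unfold chainStep
  rw [sum_switchMatrix_mul]
  have h : (switchMatrix d ^ (t + 1)) G H = ∑ K, switchMatrix d H K * (switchMatrix d ^ t) G K := by
    rw [pow_succ, Matrix.mul_apply]
    refine Finset.sum_congr rfl fun K _ => ?_
    rw [switchMatrix_comm H K, mul_comm]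
  rw [deviation, h, sum_switchMatrix_mul]
  simp only [deviation]
  rw [show (switchMatrix d ^ t) G H + ∑ K : Realization d, switchProb H.1 K.1 *
    ((switchMatrix d ^ t) G K - (switchMatrix d ^ t) G H) - 1 / (numRealizations d : ℝ) =
    (switchMatrix d ^ t) G H - 1 / (numRealizations d : ℝ) + ∑ K : Realization d,
      switchProb H.1 K.1 * ((switchMatrix d ^ t) G K - (switchMatrix d ^ t) G H) by ring]
  congr 1
  exact Finset.sum_congr rfl fun K _ => by ring

lemma deviation_zero (G H : Realization d) :
    deviation d 0 G H = (if G = H then 1 else 0) - 1 / (numRealizations d : ℝ) := by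
  rw [deviation, pow_zero, Matrix.one_apply]

lemma sum_deviation (t : ℕ) (G : Realization d) : ∑ H, deviation d t G H = 0 := by
  induction t with
  | zero =>
    have hR : (numRealizations d : ℝ) ≠ 0 := by
      unfold numRealizations
      exact_mod_cast (Fintype.card_pos_iff.2 ⟨G⟩).ne'
    simp only [deviation_zero, Finset.sum_sub_distrib, Finset.sum_ite_eq, Finset.mem_univ, if_true,
      Finset.sum_const, nsmul_eq_mul, Finset.card_univ]
    rw [← numRealizations, mul_one_div, div_self hR, sub_self]
  | succ t ih => rw [deviation_succ, sum_chainStep, ih]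

lemma sum_sq_deviation_le (hd : CornerBound d c₁ c₂ m) (t : ℕ) (G : Realization d) :
    ∑ H, deviation d t G H ^ 2 ≤ (1 - 1 / relaxBound (n : ℝ)) ^ t := by
  have hΛ := one_le_relaxBound n
  induction t with
  | zero =>
    have hR : (0 : ℝ) < numRealizations d := by
      unfold numRealizations
      exact_mod_cast Fintype.card_pos_iff.2 ⟨G⟩
    have h : ∀ H, deviation d 0 G H ^ 2 = (if G = H then 1 - 2 / (numRealizations d : ℝ) else 0) +
        1 / (numRealizations d : ℝ) ^ 2 := by
      intro H
      rw [deviation_zero]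
      split_ifs <;> ring
    simp only [h, Finset.sum_add_distrib, Finset.sum_ite_eq, Finset.mem_univ, if_true,
      Finset.sum_const, nsmul_eq_mul, Finset.card_univ, pow_zero]
    rw [← numRealizations]
    have : (numRealizations d : ℝ) * (1 / (numRealizations d : ℝ) ^ 2) =
        1 / (numRealizations d : ℝ) := by
      field_simp
    rw [this]
    have : 0 < 1 / (numRealizations d : ℝ) := by positivity
    have : 2 / (numRealizations d : ℝ) = 2 * (1 / (numRealizations d : ℝ)) := by ring
    linarith
  | succ t ih =>
    rw [deviation_succ, pow_succ']
    refine (sum_sq_chainStep_le_mul hd _ (sum_deviation t G)).trans ?_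
    refine mul_le_mul_of_nonneg_left ih ?_
    rw [sub_nonneg, div_le_one (by linarith)]
    exact hΛ

lemma numRealizations_le : (numRealizations d : ℝ) ≤ Real.exp ((n : ℝ) ^ 2) := by
  have h : numRealizations d ≤ 2 ^ (n * n) := by
    have := Fintype.card_le_of_injective (fun G : Realization d => adjFun G.1)
      (fun G H h => Subtype.ext (adjFun_injective h))
    rwa [Fintype.card_fun, Fintype.card_prop, Fintype.card_prod, Fintype.card_fin] at this
  have h2 : (2 : ℝ) ≤ Real.exp 1 := by
    have := Real.add_one_le_exp (1 : ℝ)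
    linarith
  calc (numRealizations d : ℝ) ≤ 2 ^ (n * n) := by exact_mod_cast h
    _ ≤ Real.exp 1 ^ (n * n) := by gcongr
    _ = Real.exp ((n : ℝ) ^ 2) := by
      rw [← Real.exp_nat_mul]
      push_cast
      ring_nf

/-- Passing from the sum of absolute values to the sum of squares costs a factor `numRealizations
d`, which `exp (n ^ 2)` absorbs. -/
lemma sq_distToUniform_le (hd : CornerBound d c₁ c₂ m) (t : ℕ) (G : Realization d) :
    distToUniform d t G ^ 2 ≤ Real.exp ((n : ℝ) ^ 2 - t / relaxBound (n : ℝ)) := by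
  have h1 : (∑ H, |deviation d t G H|) ^ 2 ≤ numRealizations d * ∑ H, deviation d t G H ^ 2 := by
    have := sq_sum_le_card_mul_sum_sq (s := (Finset.univ : Finset (Realization d)))
      (f := fun H => |deviation d t G H|)
    simp only [sq_abs, Finset.card_univ] at this
    exact this
  have h2 := sum_sq_deviation_le hd t G
  have hΛ := one_le_relaxBound n
  have h3 : (1 - 1 / relaxBound (n : ℝ)) ^ t ≤ Real.exp (- (t / relaxBound (n : ℝ))) := by
    have h4 : 1 - 1 / relaxBound (n : ℝ) ≤ Real.exp (- (1 / relaxBound (n : ℝ))) := by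
      have := Real.add_one_le_exp (- (1 / relaxBound (n : ℝ)))
      linarith
    have h5 : 0 ≤ 1 - 1 / relaxBound (n : ℝ) := by
      rw [sub_nonneg, div_le_one (by linarith)]
      exact hΛ
    refine (pow_le_pow_left₀ h5 h4 t).trans (le_of_eq ?_)
    rw [← Real.exp_nat_mul]
    congr 1
    ring
  have h6 : distToUniform d t G = 1 / 2 * ∑ H, |deviation d t G H| := rfl
  rw [h6, sub_eq_add_neg, Real.exp_add]
  have h7 : (numRealizations d : ℝ) * ∑ H, deviation d t G H ^ 2 ≤
      Real.exp ((n : ℝ) ^ 2) * Real.exp (- (t / relaxBound (n : ℝ))) :=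
    mul_le_mul numRealizations_le (h2.trans h3) (Finset.sum_nonneg fun _ _ => sq_nonneg _)
      (Real.exp_pos _).le
  have h8 : 0 ≤ (∑ H, |deviation d t G H|) ^ 2 := sq_nonneg _
  rw [mul_pow]
  linarith

/-- The switch chain mixes in polynomial time on the fully graphic regions. -/
theorem isRapidlyMixing_maxFullyGraphicRegion : IsRapidlyMixing maxFullyGraphicRegion := by
  -- From `t = Λ * (n ^ 2 + 2 * log (1 / ε))` on, the exponent `n ^ 2 - t / Λ` is at most `2 * log
  -- ε`; the summand `1` pays for rounding up.
  refine ⟨relaxBound (MvPolynomial.X 0) * (MvPolynomial.X 0 ^ 2 + 2 * MvPolynomial.X 1) + 1, ?_⟩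
  intro s hs _ ε hε0 hε1
  obtain ⟨c₁, c₂, m, hd⟩ := exists_cornerBound_of_mem hs
  set Λ : ℝ := relaxBound (s.1 : ℝ) with hΛdef
  have hΛ : 0 < Λ := zero_lt_one.trans_le (one_le_relaxBound s.1)
  have heval : MvPolynomial.eval ![(s.1 : ℝ), Real.log (1 / ε)] (relaxBound (MvPolynomial.X 0) *
      (MvPolynomial.X 0 ^ 2 + 2 * MvPolynomial.X 1) + 1) =
      Λ * ((s.1 : ℝ) ^ 2 + 2 * Real.log (1 / ε)) + 1 := by
    simp only [relaxBound, map_add, map_mul, map_pow, map_one, map_ofNat, map_poincareBound,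
      MvPolynomial.eval_X, hΛdef]
    rfl
  have hlog : 0 ≤ Real.log (1 / ε) := Real.log_nonneg (by rw [le_div_iff₀ hε0]; linarith)
  refine ⟨⌈Λ * ((s.1 : ℝ) ^ 2 + 2 * Real.log (1 / ε))⌉₊, ?_, ?_⟩
  · rw [heval]
    exact (Nat.ceil_lt_add_one (by positivity)).le
  · intro t ht G
    have h1 := sq_distToUniform_le hd t G
    have h2 : Λ * ((s.1 : ℝ) ^ 2 + 2 * Real.log (1 / ε)) ≤ t := Nat.ceil_le.1 ht
    have h3 : (s.1 : ℝ) ^ 2 + 2 * Real.log (1 / ε) ≤ t / Λ := by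
      rw [le_div_iff₀ hΛ]
      linarith
    have h4 : (s.1 : ℝ) ^ 2 - t / Λ ≤ 2 * Real.log ε := by
      rw [one_div, Real.log_inv] at h3
      linarith
    have h5 : Real.exp ((s.1 : ℝ) ^ 2 - t / Λ) ≤ ε ^ 2 := by
      refine (Real.exp_le_exp.2 h4).trans (le_of_eq ?_)
      rw [mul_comm, Real.exp_mul, Real.exp_log hε0]
      norm_cast
    exact le_of_sq_le_sq (h1.trans h5) hε0.le

end mixing
end
end FullyGraphic

theorem corollary1p4 :
    FullyGraphic.IsStable (3 * Polynomial.X ^ 13) FullyGraphic.maxFullyGraphicRegion ∧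
      FullyGraphic.IsPStable FullyGraphic.maxFullyGraphicRegion ∧
      FullyGraphic.IsRapidlyMixing FullyGraphic.maxFullyGraphicRegion :=
  ⟨FullyGraphic.isStable_maxFullyGraphicRegion,
    ⟨FullyGraphic.infinite_maxFullyGraphicRegion, _, FullyGraphic.isStable_maxFullyGraphicRegion⟩,
    FullyGraphic.isRapidlyMixing_maxFullyGraphicRegion⟩
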